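/- Let $N\ge 1$ and let $\Omega\subset\mathbb R^N$ be open, let $d$ be the signed distance from $\partial\Omega$ (positive in $\Omega$, negative outside $\overline\Omega$), and assume (O) $\Omega$ is of class $W^{2,\infty}$: for every $\hat s\in\partial\Omega$ there are $r>0$ and a $W^{2,\infty}$-diffeomorphism $\psi$ from $B_r(\hat s)$ onto an open subset of $\mathbb R^N$ whose last component is $\psi_N=d$ on $B_r(\hat s)$. Write $n=-Dd$ for the exterior unit normal on $\partial\Omega$. A modulus is a nondecreasing function $\omega$ on $[0,\infty)$ with $\omega(0)=0$ that is continuous at $0$. Let $(\mu_x)_{x\in\overline\Omega}$ be nonnegative measures with Lebesgue densities $\frac{d\mu_x}{dz}\ge 0$ and let $j:\overline\Omega\times\mathbb R^N\to\mathbb R^N$ satisfy (M) there are $C_\mu,D_\mu>0$ and $\sigma\in(0,1)$ such that for all $x,y\in\overline\Omega$, $z\neq0$: $\frac{d\mu_x}{dz}(z)\le C_\mu|z|^{-(N+\sigma)}$ and $\left|\frac{d\mu_x}{dz}(z)-\frac{d\mu_y}{dz}(z)\right|\le D_\mu|x-y||z|^{-(N+\sigma)}$; (J0) for each $x\in\overline\Omega$,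 $j(x,\cdot)$ is a $C^1$ bijection of $\mathbb R^N$ with $C^1$ inverse, and $|Dj^{-1}(x,\cdot)|\le A_j$ with $A_j$ independent of $x$; (J1) there are $\tilde C_j,C_j,D_j>0$ such that for all $x,y\in\overline\Omega$, $z\in\mathbb R^N$: $\tilde C_j|z|\le|j(x,z)|\le C_j|z|$ and $|j(x,z)-j(y,z)|\le D_j|z||x-y|$. Let $H:\overline\Omega\times\mathbb R^N\to\mathbb R$ be continuous and satisfy (E) for every $R$ there is $H_R>0$ with $|H(x,p)|\le H_R$ for all $x\in\overline\Omega$ and $|p|\le R$. Assume moreover that $H$ is of one of the following types. * *Bellman type*: $H(x,p)=\sup_{\alpha\in\mathcal A}\{-b(x,\alpha)\cdot p-l(x,\alpha)\}$, where $\mathcal A$ is a nonempty compact metric space, and $b:\overline\Omega\times\mathcal A\to\mathbb R^N$, $l:\overline\Omega\times\mathcal A\to\mathbb R$ are continuous and bounded, such that (C) $|l(x,\alpha)-l(y,\alpha)|\le\omega_l(|x-y|)$ for a modulus $\omega_l$ and all $x,y\in\overline\Omega$, $\alpha\in\mathcal A$; (L) $|b(x,\alpha)-b(y,\alpha)|\le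 C|x-y|$ for some $C>0$ and all $x,y\in\overline\Omega$, $\alpha\in\mathcal A$; and (B) $\partial\Omega=\Gamma_{\rm in}\cup\Gamma_{\rm out}\cup\Gamma$, each of these three sets being a union of connected components of $\partial\Omega$, where $\Gamma_{\rm in}$ (resp. $\Gamma_{\rm out}$) is the set of $x\in\partial\Omega$ with $b(x,\alpha)\cdot n(x)<0$ (resp. $>0$) for all $\alpha\in\mathcal A$, and $\Gamma$ is the set of $x\in\partial\Omega$ for which there are $\alpha_1,\alpha_2\in\mathcal A$ with $b(x,\alpha_1)\cdot n(x)<0<b(x,\alpha_2)\cdot n(x)$. * *Sublinearly coercive*: (H1) $H(x,p)\ge c_0|p|^m-D$ for all $x\in\overline\Omega$, $p\in\mathbb R^N$, with some $c_0,D>0$ and $m>\sigma$, here with $m\le1$; and (Ha) there are $C>0$ and a modulus $\omega_1$ with $H(y,p)-H(x,q)\le\omega_1(|x-y|)(1+|p|)+C|p-q|$ for all $x,y\in\overline\Omega$, $p,q\in\mathbb R^N$. * *Superlinearly coercive*: (H1) for some $m>\sigma$, and for some $m>1$: (Hb) there are $A,\bar C>0$ with $H(x,p)-tH(x,t^{-1}p)\le(1-t)\left(\bar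 C(1-m)|p|^m+A\right)$ for all $t\in(0,1)$, $x\in\overline\Omega$, $p\in\mathbb R^N$; and (Hc) there are $C>0$ and a modulus $\omega_1$ with $H(y,p)-H(x,q)\le\omega_1(|x-y|)\left(1+\max(|p|^m,|q|^m)\right)+C|p-q|\max(|p|^{m-1},|q|^{m-1})$ for all $x,y\in\overline\Omega$, $p,q\in\mathbb R^N$. For $\xi>0$ put $$\mathcal I_\xi[\phi](x)=\int_{|z|<\xi,\ x+j(x,z)\in\overline\Omega}\bigl(\phi(x+j(x,z))-\phi(x)\bigr)\,d\mu_x(z),\qquad \mathcal I^\xi[u](x)=\int_{|z|\ge\xi,\ x+j(x,z)\in\overline\Omega}\bigl(u(x+j(x,z))-u(x)\bigr)\,d\mu_x(z).$$ A bounded upper semicontinuous $u:\overline\Omega\to\mathbb R$ is a viscosity subsolution of $$u-\mathcal I[u]+H(x,Du)=0\ \text{ in }\Omega,\qquad \frac{\partial u}{\partial n}=0\ \text{ on }\partial\Omega, \tag{P}$$ if for all $\phi\in C^1(\mathbb R^N)$, $\xi>0$, $x\in\overline\Omega$ such that $u-\phi$ has a maximum over $\overline B_{C_j\xi}(x)\cap\overline\Omega$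 at $x$, the number $F=u(x)-\mathcal I_\xi[\phi](x)-\mathcal I^\xi[u](x)+H(x,D\phi(x))$ satisfies $F\le0$ if $x\in\Omega$, and $\min\{F,\frac{\partial\phi}{\partial n}(x)\}\le0$ if $x\in\partial\Omega$. A bounded lower semicontinuous $v:\overline\Omega\to\mathbb R$ is a viscosity supersolution if, for all such $\phi,\xi,x$ with "minimum of $v-\phi$" in place of "maximum of $u-\phi$", and $F$ formed with $v$, one has $F\ge0$ if $x\in\Omega$ and $\max\{F,\frac{\partial\phi}{\partial n}(x)\}\ge0$ if $x\in\partial\Omega$. A viscosity solution is both a sub- and a supersolution. Then problem (P) has exactly one bounded viscosity solution $u:\overline\Omega\to\mathbb R$, and $u$ is continuous on $\overline\Omega$. -/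

import Mathlib

universe u

noncomputable section

namespace CensoredNeumann

open Set Filter Topology MeasureTheory

/-- Euclidean space `ℝ^N`. -/
abbrev RN (N : ℕ) : Type := EuclideanSpace ℝ (Fin N)

open Classical in
/-- The signed distance `d` from the boundary of `Ω`: nonnegative on `closure Ω`, negative outside. -/
def signedDist {N : ℕ} (Ω : Set (RN N)) (x : RN N) : ℝ :=
  if x ∈ closure Ω then Metric.infDist x (frontier Ω) else -Metric.infDist x (frontier Ω)

/-- The exterior unit normal `n = -Dd` at a boundary point of a domain for which the signed
distance `d` is differentiable there. -/
def outerNormal {N : ℕ} (Ω : Set (RN N)) (x : RN N) : RN N :=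
  -gradient (signedDist Ω) x

/-- `f` is of class `W^{2,∞} = C^{1,1}` on the (open) set `s`: it is differentiable there, with
Lipschitz derivative. -/
def IsC11On {N : ℕ} (f : RN N → RN N) (s : Set (RN N)) : Prop :=
  DifferentiableOn ℝ f s ∧ ∃ K : NNReal, LipschitzOnWith K (fderiv ℝ f) s

/-- Assumption (O), `Ω` is of class `W^{2,∞}`: around each boundary point there is a
`W^{2,∞}`-diffeomorphism from a ball onto an open set whose last component (`Fin.rev 0` is the
last index) is the signed distance from the boundary. -/
def AssumptionO {N : ℕ} [NeZero N] (Ω : Set (RN N)) : Prop :=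
  ∀ s₀ ∈ frontier Ω, ∃ r : ℝ, 0 < r ∧ ∃ ψ : OpenPartialHomeomorph (RN N) (RN N),
    ψ.source = Metric.ball s₀ r ∧ IsC11On ψ ψ.source ∧ IsC11On ψ.symm ψ.target ∧
    ∀ s ∈ Metric.ball s₀ r, ψ s (Fin.rev 0) = signedDist Ω s

/-- Assumption (M): the jump measures `μ x`, `x ∈ closure Ω`, are nonnegative with a density `g x`
with respect to Lebesgue measure, singular at the origin of order `σ < 1` and Lipschitz in `x`. -/
def AssumptionM {N : ℕ} (Ω : Set (RN N)) (μ : RN N → Measure (RN N)) (σ : ℝ) : Prop :=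
  0 < σ ∧ σ < 1 ∧ ∃ g : RN N → RN N → ℝ,
    (∀ x ∈ closure Ω, Measurable (g x) ∧ (∀ z, 0 ≤ g x z) ∧
      μ x = volume.withDensity (fun z => ENNReal.ofReal (g x z))) ∧
    ∃ Cμ Dμ : ℝ, 0 < Cμ ∧ 0 < Dμ ∧
      ∀ x ∈ closure Ω, ∀ y ∈ closure Ω, ∀ z : RN N, z ≠ 0 →
        g x z ≤ Cμ * ‖z‖ ^ (-((N : ℝ) + σ)) ∧
        |g x z - g y z| ≤ Dμ * ‖x - y‖ * ‖z‖ ^ (-((N : ℝ) + σ))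

/-- Assumption (J0): `j x` is a `C¹` bijection of `ℝ^N` with `C¹` inverse, the derivative of the
inverse being bounded uniformly in `x ∈ closure Ω`. -/
def AssumptionJ0 {N : ℕ} (Ω : Set (RN N)) (j : RN N → RN N → RN N) : Prop :=
  ∃ (jinv : RN N → RN N → RN N) (Aj : ℝ), ∀ x ∈ closure Ω,
    ContDiff ℝ 1 (j x) ∧ ContDiff ℝ 1 (jinv x) ∧
    Function.LeftInverse (jinv x) (j x) ∧ Function.RightInverse (jinv x) (j x) ∧
    ∀ w, ‖fderiv ℝ (jinv x) w‖ ≤ Aj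

/-- Assumption (J1), with its constants. -/
def AssumptionJ1 {N : ℕ} (Ω : Set (RN N)) (j : RN N → RN N → RN N) (Cj' Cj Dj : ℝ) : Prop :=
  0 < Cj' ∧ 0 < Cj ∧ 0 < Dj ∧ ∀ x ∈ closure Ω, ∀ y ∈ closure Ω, ∀ z : RN N,
    Cj' * ‖z‖ ≤ ‖j x z‖ ∧ ‖j x z‖ ≤ Cj * ‖z‖ ∧ ‖j x z - j y z‖ ≤ Dj * ‖z‖ * ‖x - y‖

/-- A modulus of continuity: nondecreasing on `[0,∞)`, vanishing and continuous at `0`. -/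
def IsModulus (ω : ℝ → ℝ) : Prop :=
  ω 0 = 0 ∧ MonotoneOn ω (Ici 0) ∧ ContinuousWithinAt ω (Ici 0) 0

section Bellman

variable {N : ℕ} {A : Type*}

/-- `Γ_in`. -/
def gammaIn (Ω : Set (RN N)) (b : RN N → A → RN N) : Set (RN N) :=
  {x | x ∈ frontier Ω ∧ ∀ α, inner ℝ (b x α) (outerNormal Ω x) < 0}

/-- `Γ_out`. -/
def gammaOut (Ω : Set (RN N)) (b : RN N → A → RN N) : Set (RN N) :=
  {x | x ∈ frontier Ω ∧ ∀ α, 0 < inner ℝ (b x α) (outerNormal Ω x)}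

/-- `Γ`. -/
def gammaMixed (Ω : Set (RN N)) (b : RN N → A → RN N) : Set (RN N) :=
  {x | x ∈ frontier Ω ∧ ∃ α₁ α₂, inner ℝ (b x α₁) (outerNormal Ω x) < 0 ∧
    0 < inner ℝ (b x α₂) (outerNormal Ω x)}

/-- `S ⊆ T` is a union of connected components of `T`. -/
def IsUnionOfComponents (S T : Set (RN N)) : Prop :=
  S ⊆ T ∧ ∀ x ∈ S, connectedComponentIn T x ⊆ S

/-- Assumption (B). -/
def AssumptionB (Ω : Set (RN N)) (b : RN N → A → RN N) : Prop :=
  gammaIn Ω b ∪ gammaOut Ω b ∪ gammaMixed Ω b = frontier Ω ∧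
  IsUnionOfComponents (gammaIn Ω b) (frontier Ω) ∧
  IsUnionOfComponents (gammaOut Ω b) (frontier Ω) ∧
  IsUnionOfComponents (gammaMixed Ω b) (frontier Ω)

/-- Assumption (C): uniform continuity of the cost. -/
def AssumptionC (Ω : Set (RN N)) (l : RN N → A → ℝ) : Prop :=
  ∃ ω, IsModulus ω ∧ ∀ α, ∀ x ∈ closure Ω, ∀ y ∈ closure Ω, |l x α - l y α| ≤ ω ‖x - y‖

/-- Assumption (L): uniform Lipschitz continuity of the drift. -/
def AssumptionL (Ω : Set (RN N)) (b : RN N → A → RN N) : Prop :=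
  ∃ C : ℝ, 0 < C ∧ ∀ α, ∀ x ∈ closure Ω, ∀ y ∈ closure Ω, ‖b x α - b y α‖ ≤ C * ‖x - y‖

end Bellman

/-- `H` is of Bellman type, `H(x,p) = sup_α {-b(x,α)·p - l(x,α)}`, with a compact metric control
space, continuous bounded `b` and `l`, and satisfies (C), (L), (B). -/
def IsBellman {N : ℕ} (Ω : Set (RN N)) (H : RN N → RN N → ℝ) : Prop :=
  ∃ (A : Type u) (_ : MetricSpace A) (_ : CompactSpace A) (_ : Nonempty A)
    (b : RN N → A → RN N) (l : RN N → A → ℝ),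
    ContinuousOn (fun q : RN N × A => b q.1 q.2) (closure Ω ×ˢ univ) ∧
    ContinuousOn (fun q : RN N × A => l q.1 q.2) (closure Ω ×ˢ univ) ∧
    (∃ K : ℝ, ∀ x ∈ closure Ω, ∀ α, ‖b x α‖ ≤ K ∧ |l x α| ≤ K) ∧
    (∀ x ∈ closure Ω, ∀ p,
      IsLUB (range fun α => -inner ℝ (b x α) p - l x α) (H x p)) ∧
    AssumptionC Ω l ∧ AssumptionL Ω b ∧ AssumptionB Ω b

section Coercive

variable {N : ℕ} (Ω : Set (RN N)) (H : RN N → RN N → ℝ)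

/-- Assumption (H1), with exponent `m`: superfractional coercivity. -/
def AssumptionH1 (σ m : ℝ) : Prop :=
  σ < m ∧ ∃ c₀ D : ℝ, 0 < c₀ ∧ 0 < D ∧ ∀ x ∈ closure Ω, ∀ p, c₀ * ‖p‖ ^ m - D ≤ H x p

/-- Assumption (Ha). -/
def AssumptionHa : Prop :=
  ∃ (C : ℝ) (ω : ℝ → ℝ), 0 < C ∧ IsModulus ω ∧
    ∀ x ∈ closure Ω, ∀ y ∈ closure Ω, ∀ p q,
      H y p - H x q ≤ ω ‖x - y‖ * (1 + ‖p‖) + C * ‖p - q‖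

/-- Assumption (Hb), with exponent `m > 1`. -/
def AssumptionHb (m : ℝ) : Prop :=
  1 < m ∧ ∃ A C' : ℝ, 0 < A ∧ 0 < C' ∧ ∀ t : ℝ, 0 < t → t < 1 → ∀ x ∈ closure Ω, ∀ p,
    H x p - t * H x (t⁻¹ • p) ≤ (1 - t) * (C' * (1 - m) * ‖p‖ ^ m + A)

/-- Assumption (Hc), with exponent `m`. -/
def AssumptionHc (m : ℝ) : Prop :=
  ∃ (C : ℝ) (ω : ℝ → ℝ), 0 < C ∧ IsModulus ω ∧
    ∀ x ∈ closure Ω, ∀ y ∈ closure Ω, ∀ p q,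
      H y p - H x q ≤ ω ‖x - y‖ * (1 + max (‖p‖ ^ m) (‖q‖ ^ m)) +
        C * ‖p - q‖ * max (‖p‖ ^ (m - 1)) (‖q‖ ^ (m - 1))

/-- Sublinearly coercive Hamiltonian: (H1) with `m ≤ 1`, and (Ha). -/
def IsSublinearlyCoercive (σ : ℝ) : Prop :=
  (∃ m ≤ 1, AssumptionH1 Ω H σ m) ∧ AssumptionHa Ω H

/-- Superlinearly coercive Hamiltonian: (H1), and (Hb), (Hc) with a common exponent. -/
def IsSuperlinearlyCoercive (σ : ℝ) : Prop :=
  (∃ m, AssumptionH1 Ω H σ m) ∧ ∃ m, AssumptionHb Ω H m ∧ AssumptionHc Ω H m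

/-- Assumption (E): local boundedness in `p`, uniformly in `x`. -/
def AssumptionE : Prop :=
  ∀ R : ℝ, ∃ HR : ℝ, 0 < HR ∧ ∀ p, ‖p‖ ≤ R → ∀ x ∈ closure Ω, |H x p| ≤ HR

end Coercive

section Viscosity

variable {N : ℕ} (Ω : Set (RN N)) (μ : RN N → Measure (RN N)) (j : RN N → RN N → RN N)

/-- The inner part `I_ξ[φ](x)` of the censored operator, over jumps with `|z| < ξ` landing in
`closure Ω`. For `φ ∈ C¹` the integrand is `O(|z|)`, hence absolutely integrable under
(M) and (J1). -/
def innerPart (ξ : ℝ) (φ : RN N → ℝ) (x : RN N) : ℝ :=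
  ∫ z in {z | ‖z‖ < ξ ∧ x + j x z ∈ closure Ω}, (φ (x + j x z) - φ x) ∂(μ x)

/-- The outer part `I^ξ[u](x)`, over jumps with `|z| ≥ ξ` landing in `closure Ω`. -/
def outerPart (ξ : ℝ) (u : RN N → ℝ) (x : RN N) : ℝ :=
  ∫ z in {z | ξ ≤ ‖z‖ ∧ x + j x z ∈ closure Ω}, (u (x + j x z) - u x) ∂(μ x)

/-- `F(x, u(x), Dφ(x), I_ξ[φ](x) + I^ξ[u](x)) = u(x) - (I_ξ[φ](x) + I^ξ[u](x)) + H(x, Dφ(x))`. -/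
def opF (H : RN N → RN N → ℝ) (ξ : ℝ) (u φ : RN N → ℝ) (x : RN N) : ℝ :=
  u x - (innerPart Ω μ j ξ φ x + outerPart Ω μ j ξ u x) + H x (gradient φ x)

/-- The normal derivative `∂φ/∂n`. -/
def normalDeriv (φ : RN N → ℝ) (x : RN N) : ℝ :=
  inner ℝ (gradient φ x) (outerNormal Ω x)

/-- Bounded on `closure Ω`. -/
def BoundedOnClosure (u : RN N → ℝ) : Prop :=
  ∃ K : ℝ, ∀ x ∈ closure Ω, |u x| ≤ K

/-- Bounded usc viscosity subsolution on `closure Ω`; only the values of `u` on `closure Ω`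
matter. -/
def IsSubsolution (Cj : ℝ) (H : RN N → RN N → ℝ) (u : RN N → ℝ) : Prop :=
  BoundedOnClosure Ω u ∧ UpperSemicontinuousOn u (closure Ω) ∧
  ∀ (φ : RN N → ℝ) (ξ : ℝ) (x : RN N), ContDiff ℝ 1 φ → 0 < ξ → x ∈ closure Ω →
    IsMaxOn (fun y => u y - φ y) (Metric.closedBall x (Cj * ξ) ∩ closure Ω) x →
    (x ∈ Ω → opF Ω μ j H ξ u φ x ≤ 0) ∧
    (x ∈ frontier Ω → min (opF Ω μ j H ξ u φ x) (normalDeriv Ω φ x) ≤ 0)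

/-- Bounded lsc viscosity supersolution on `closure Ω`; only the values of `v` on `closure Ω`
matter. -/
def IsSupersolution (Cj : ℝ) (H : RN N → RN N → ℝ) (v : RN N → ℝ) : Prop :=
  BoundedOnClosure Ω v ∧ LowerSemicontinuousOn v (closure Ω) ∧
  ∀ (φ : RN N → ℝ) (ξ : ℝ) (x : RN N), ContDiff ℝ 1 φ → 0 < ξ → x ∈ closure Ω →
    IsMinOn (fun y => v y - φ y) (Metric.closedBall x (Cj * ξ) ∩ closure Ω) x →
    (x ∈ Ω → 0 ≤ opF Ω μ j H ξ v φ x) ∧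
    (x ∈ frontier Ω → 0 ≤ max (opF Ω μ j H ξ v φ x) (normalDeriv Ω φ x))

/-- Bounded viscosity solution: both a sub- and a supersolution. -/
def IsViscositySolution (Cj : ℝ) (H : RN N → RN N → ℝ) (u : RN N → ℝ) : Prop :=
  IsSubsolution Ω μ j Cj H u ∧ IsSupersolution Ω μ j Cj H u

end Viscosity

end CensoredNeumann

end

/-! Everything reduces to a comparison principle: every subsolution lies below every supersolution.
Given that, Perron's method (`exists_unique_of_comparison`) yields the solution. The upper envelope
of the supremum of all subsolutions between two constants is a subsolution
(`isSubsolution_upperEnv`). Its lower envelope is a supersolution, since otherwise a bump would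
produce a larger subsolution (`exists_larger_subsolution`). Comparison then makes the two envelopes
equal, which gives continuity, and comparison between two solutions gives uniqueness.

Comparison (`comparison`, `doubling_le`) is a doubling of variables for `t u(x) - v(y)`, with three
obstacles.

The Neumann condition must be inactive at the maximum points. The penalization contains `-8δ
D/(1+νD)`, where `D` is the distance to the boundary. Its slope at the boundary gives the test
function a normal derivative of the wrong sign for the Neumann alternative, while its size is at
most `8δ/ν`, so it vanishes in the limit.

The domain of integration depends on the point. Jumps that are admissible from only one of `x`, `y`
land, when they are small, in a layer `|D| ≤ |D x - D y| + c|x - y||z|` about the boundary. The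
increments at a maximum are only known to be at most `min (2M) (cν|z|)`, so this mismatch costs `ν`
times the first moment of the kernel over the layer. Knowing `ν|x - y| → 0` does not control this
cost: `|D x - D y|` must be smaller than a rate prescribed in advance
(`JumpKernel.tendsto_mismatch`).

To obtain that rate, the penalization also contains `ν√(|e x - e y|² + η²)` with `η` as small as
desired in terms of `ν`. If `|e x - e y| > η`, the two gradients are nearly opposite and of order
`ν` in the direction selected by `e`. One of the Hamiltonians is then at least of order `ν^m`
(coercive case) or `ν` (Bellman case), whereas the nonlocal terms are `O(1 + ν^θ)` for an exponent
`θ` strictly between `σ` and that power. This is impossible, so `|e x - e y| ≤ η`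
(`NondegenerateAt.norm_sub_le`). For coercive Hamiltonians `e` is the identity. For Bellman
Hamiltonians `e = D`: by (B), on each boundary portion a large multiple of the normal makes either
the Hamiltonian at `x` large or the one at `y` very negative.

There remains the difference of the Hamiltonians at two nearby points, with gradients equal up to
`O(δ)`. The factor `t < 1` is used in the superlinear case, where (Hb) supplies a negative term of
order `(1-t)|p|^m` that absorbs the perturbation; otherwise `t = 1`. -/

noncomputable section

namespace CensoredNeumann

open Set Filter Topology MeasureTheory

/-- The kernel `|z|^{-(N+σ)}` bounding the jump densities. -/
def kern {N : ℕ} (σ : ℝ) (z : RN N) : ℝ := ‖z‖ ^ (-((N : ℝ) + σ))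

/-! ### Moments of the singular kernel. -/

section Kernel

variable {N : ℕ} {σ : ℝ}

lemma kern_nonneg (z : RN N) : 0 ≤ kern σ z := Real.rpow_nonneg (norm_nonneg _) _

lemma measurable_kern : Measurable (kern σ : RN N → ℝ) :=
  measurable_norm.pow_const _

/-- In polar coordinates the radial integrand is `r^(θ-σ-1)` near `0` and `r^(-σ-1)` at infinity, so
`θ > σ` and `σ > 0` are exactly what is needed. -/
lemma integrable_min_rpow_mul_kern [NeZero N] {θ : ℝ} (hσ : 0 < σ) (hθ : σ < θ) :
    Integrable (fun z : RN N => min 1 (‖z‖ ^ θ) * kern σ z) := by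
  have hN : 1 ≤ N := Nat.one_le_iff_ne_zero.mpr (NeZero.ne N)
  have : Nontrivial (RN N) := by
    have : Nonempty (Fin N) := ⟨⟨0, hN⟩⟩
    infer_instance
  have h := (integrable_fun_norm_addHaar (volume : Measure (RN N))
    (f := fun r : ℝ => min 1 (r ^ θ) * r ^ (-((N : ℝ) + σ))))
  rw [show (fun z : RN N => min 1 (‖z‖ ^ θ) * kern σ z) =
    (fun z : RN N => (fun r : ℝ => min 1 (r ^ θ) * r ^ (-((N : ℝ) + σ))) ‖z‖) from rfl, h]
  have hdim : Module.finrank ℝ (RN N) = N := by simp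
  rw [hdim]
  have hpow : ∀ r : ℝ, 0 < r → r ^ (N - 1) * r ^ (-((N : ℝ) + σ)) = r ^ (-σ - 1) := by
    intro r hr
    rw [← Real.rpow_natCast, ← Real.rpow_add hr]
    congr 1
    push_cast [Nat.cast_sub hN]
    ring
  rw [← Ioc_union_Ioi_eq_Ioi (zero_le_one' ℝ)]
  refine IntegrableOn.union ?_ ?_
  · have h1 : IntegrableOn (fun r : ℝ => r ^ (θ - σ - 1)) (Ioc 0 1) := by
      rw [← intervalIntegrable_iff_integrableOn_Ioc_of_le zero_le_one]
      exact intervalIntegral.intervalIntegrable_rpow' (by linarith)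
    refine h1.congr_fun (fun r hr => ?_) measurableSet_Ioc
    have hr0 : 0 < r := hr.1
    simp only [smul_eq_mul]
    rw [min_eq_right (Real.rpow_le_one hr0.le hr.2 (by linarith)), mul_left_comm, hpow r hr0,
      ← Real.rpow_add hr0]
    ring_nf
  · have h1 : IntegrableOn (fun r : ℝ => r ^ (-σ - 1)) (Ioi 1) :=
      integrableOn_Ioi_rpow_of_lt (by linarith) zero_lt_one
    refine h1.congr_fun (fun r hr => ?_) measurableSet_Ioi
    have hr1 : 1 < r := hr
    have hr0 : 0 < r := by linarith
    simp only [smul_eq_mul]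
    rw [min_eq_left (Real.one_le_rpow hr1.le (by linarith)), one_mul, hpow r hr0]

lemma integrable_min_mul_kern [NeZero N] (hσ : 0 < σ) (hσ1 : σ < 1) :
    Integrable (fun z : RN N => min 1 ‖z‖ * kern σ z) := by
  simpa using integrable_min_rpow_mul_kern (N := N) (θ := 1) hσ hσ1

/-- A nonnegative measurable function below `min B (C‖z‖)` is integrable against the kernel. -/
lemma integrable_mul_kern_of_le [NeZero N] (hσ : 0 < σ) (hσ1 : σ < 1) {f : RN N → ℝ} {C : ℝ}
    (hf : AEStronglyMeasurable f volume)
    (hb : ∀ z, |f z| ≤ C * min 1 ‖z‖) : Integrable (fun z => f z * kern σ z) := by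
  refine ((integrable_min_mul_kern hσ hσ1).const_mul C).mono'
    (hf.mul measurable_kern.aestronglyMeasurable) (ae_of_all _ fun z => ?_)
  rw [Real.norm_eq_abs, abs_mul, abs_of_nonneg (kern_nonneg z), ← mul_assoc]
  exact mul_le_mul_of_nonneg_right (hb z) (kern_nonneg z)

lemma min_le_max_mul_min {B L s : ℝ} (hs : 0 ≤ s) :
    min B (L * s) ≤ max B L * min 1 s := by
  rcases le_total s 1 with h | h
  · rw [min_eq_right h]
    exact (min_le_right _ _).trans (mul_le_mul_of_nonneg_right (le_max_right _ _) hs)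
  · rw [min_eq_left h, mul_one]
    exact (min_le_left _ _).trans (le_max_left _ _)

lemma abs_min_le_max_mul_min {B L s : ℝ} (hs : 0 ≤ s) (hB : 0 ≤ B) (hL : 0 ≤ L) :
    |min B (L * s)| ≤ max B L * min 1 s := by
  rw [abs_of_nonneg (le_min hB (mul_nonneg hL hs))]
  exact min_le_max_mul_min hs

lemma integrable_min_lin_kern [NeZero N] (hσ : 0 < σ) (hσ1 : σ < 1) {B L : ℝ}
    (hB : 0 ≤ B) (hL : 0 ≤ L) :
    Integrable (fun z : RN N => min B (L * ‖z‖) * kern σ z) :=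
  integrable_mul_kern_of_le hσ hσ1
    (measurable_const.min (measurable_norm.const_mul L)).aestronglyMeasurable
    fun z => abs_min_le_max_mul_min (norm_nonneg z) hB hL

lemma abs_min_quad_le {B θ s : ℝ} (hs : 0 ≤ s) (hB : 0 ≤ B) (hθ : 0 ≤ θ) :
    |min B (θ * (s + s ^ 2))| ≤ max B (2 * θ) * min 1 s := by
  rw [abs_of_nonneg (le_min hB (mul_nonneg hθ (by positivity)))]
  rcases le_total s 1 with h | h
  · rw [min_eq_right h]
    refine (min_le_right _ _).trans ?_
    calc θ * (s + s ^ 2) ≤ (2 * θ) * s := by nlinarith [mul_nonneg hθ (mul_nonneg hs (sub_nonneg.2 h))]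
      _ ≤ _ := mul_le_mul_of_nonneg_right (le_max_right _ _) hs
  · rw [min_eq_left h, mul_one]
    exact (min_le_left _ _).trans (le_max_left _ _)

lemma integrable_min_quad_kern [NeZero N] (hσ : 0 < σ) (hσ1 : σ < 1) {B θ : ℝ}
    (hB : 0 ≤ B) (hθ : 0 ≤ θ) :
    Integrable (fun z : RN N => min B (θ * (‖z‖ + ‖z‖ ^ 2)) * kern σ z) :=
  integrable_mul_kern_of_le hσ hσ1
    (measurable_const.min ((measurable_norm.add (measurable_norm.pow_const 2)).const_mul
      θ)).aestronglyMeasurable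
    fun z => abs_min_quad_le (norm_nonneg z) hB hθ

/-- Joint increments at a maximum of the doubling are bounded by such an integrand with `θ`
proportional to `δ`; this limit disposes of them when `δ → 0`. -/
lemma tendsto_integral_min_quad_kern [NeZero N] (hσ : 0 < σ) (hσ1 : σ < 1) {B : ℝ}
    (hB : 0 ≤ B) :
    Tendsto (fun θ : ℝ => ∫ z : RN N, min B (θ * (‖z‖ + ‖z‖ ^ 2)) * kern σ z)
      (𝓝[≥] 0) (𝓝 0) := by
  have h0 : ∫ z : RN N, min B ((0:ℝ) * (‖z‖ + ‖z‖ ^ 2)) * kern σ z = 0 := by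
    simp [min_eq_right hB]
  have key : Tendsto (fun θ : ℝ => ∫ z : RN N, min B (θ * (‖z‖ + ‖z‖ ^ 2)) * kern σ z)
      (𝓝[≥] 0) (𝓝 (∫ z : RN N, min B ((0:ℝ) * (‖z‖ + ‖z‖ ^ 2)) * kern σ z)) := by
    refine tendsto_integral_filter_of_dominated_convergence
      (fun z => (max B 2 * min 1 ‖z‖) * kern σ z) ?_ ?_ ?_ ?_
    · refine Eventually.of_forall fun θ => ?_
      exact ((measurable_const.min ((measurable_norm.add (measurable_norm.pow_const 2)).const_mul
        θ)).mul measurable_kern).aestronglyMeasurable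
    · have h1 : ∀ᶠ θ : ℝ in 𝓝[≥] 0, θ ≤ 1 :=
        nhdsWithin_le_nhds (Iic_mem_nhds zero_lt_one)
      filter_upwards [h1, self_mem_nhdsWithin] with θ h1 h2
      refine ae_of_all _ fun z => ?_
      rw [Real.norm_eq_abs, abs_mul, abs_of_nonneg (kern_nonneg z)]
      refine mul_le_mul_of_nonneg_right ?_ (kern_nonneg z)
      refine (abs_min_quad_le (norm_nonneg z) hB h2).trans ?_
      refine mul_le_mul_of_nonneg_right (max_le_max le_rfl ?_) (le_min zero_le_one (norm_nonneg z))
      linarith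
    · simpa [mul_assoc] using (integrable_min_mul_kern (N := N) hσ hσ1).const_mul (max B 2)
    · refine ae_of_all _ fun z => ?_
      have : Continuous fun θ : ℝ => min B (θ * (‖z‖ + ‖z‖ ^ 2)) * kern σ z := by fun_prop
      exact (this.tendsto 0).mono_left nhdsWithin_le_nhds
  rwa [h0] at key

/-- The growth in the slope `L` is only of order `L^θ`, by the interpolation `min B s ≤ (B + 1)
s^θ`. This sublinear growth is what a Hamiltonian of order `m > σ` beats. -/
lemma integral_min_lin_kern_le [NeZero N] (hσ : 0 < σ) {θ : ℝ} (hθ : σ < θ) (hθ1 : θ < 1) {B : ℝ}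
    (hB : 0 ≤ B) :
    ∃ C : ℝ, 0 ≤ C ∧ ∀ L : ℝ, 0 ≤ L →
      ∫ z : RN N, min B (L * ‖z‖) * kern σ z ≤ C * (1 + L ^ θ) := by
  set I := ∫ z : RN N, min 1 (‖z‖ ^ θ) * kern σ z
  have hI : 0 ≤ I := integral_nonneg fun z =>
    mul_nonneg (le_min zero_le_one (Real.rpow_nonneg (norm_nonneg _) _)) (kern_nonneg z)
  have hθ0 : 0 < θ := hσ.trans hθ
  refine ⟨(B + 1) * I, by positivity, fun L hL => ?_⟩
  have hLθ : 0 ≤ L ^ θ := Real.rpow_nonneg hL θ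
  calc ∫ z : RN N, min B (L * ‖z‖) * kern σ z
      ≤ ∫ z : RN N, (B + 1) * (1 + L ^ θ) * (min 1 (‖z‖ ^ θ) * kern σ z) := by
        refine integral_mono (integrable_min_lin_kern hσ (hθ.trans hθ1) hB hL)
          ((integrable_min_rpow_mul_kern hσ hθ).const_mul _) fun z => ?_
        simp only
        rw [← mul_assoc]
        refine mul_le_mul_of_nonneg_right ?_ (kern_nonneg z)
        have hz := norm_nonneg z
        have hzθ : 0 ≤ ‖z‖ ^ θ := Real.rpow_nonneg hz θ
        rcases le_total ‖z‖ 1 with h | h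
        · rw [min_eq_right (Real.rpow_le_one hz h hθ0.le)]
          have h2 : min B (L * ‖z‖) ≤ (B + 1) * (L * ‖z‖) ^ θ := by
            have hLz : 0 ≤ L * ‖z‖ := mul_nonneg hL hz
            rcases le_total (L * ‖z‖) 1 with h3 | h3
            · refine (min_le_right _ _).trans ?_
              calc L * ‖z‖ = (L * ‖z‖) ^ (1 : ℝ) := (Real.rpow_one _).symm
                _ ≤ (L * ‖z‖) ^ θ := Real.rpow_le_rpow_of_exponent_ge' hLz h3 hθ0.le hθ1.le
                _ ≤ (B + 1) * (L * ‖z‖) ^ θ := by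
                  nlinarith [Real.rpow_nonneg hLz θ]
            · refine (min_le_left _ _).trans ?_
              nlinarith [Real.one_le_rpow h3 hθ0.le]
          rw [Real.mul_rpow hL hz] at h2
          refine h2.trans ?_
          rw [mul_assoc]
          refine mul_le_mul_of_nonneg_left ?_ (by linarith)
          nlinarith
        · rw [min_eq_left (Real.one_le_rpow h hθ0.le)]
          refine (min_le_left _ _).trans ?_
          nlinarith
    _ = (B + 1) * I * (1 + L ^ θ) := by rw [integral_const_mul]; ring

lemma integrable_indicator_norm_mul_kern [NeZero N] (hσ : 0 < σ) (hσ1 : σ < 1) (s : ℝ) :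
    Integrable (fun z : RN N => {z : RN N | ‖z‖ < s}.indicator (fun z => ‖z‖) z * kern σ z) := by
  refine integrable_mul_kern_of_le (C := max 1 s) hσ hσ1 ?_ fun z => ?_
  · exact (measurable_norm.indicator (measurableSet_lt measurable_norm
      measurable_const)).aestronglyMeasurable
  · by_cases h : ‖z‖ < s
    · rw [indicator_of_mem (by exact h), abs_norm]
      rcases le_total ‖z‖ 1 with h1 | h1
      · rw [min_eq_right h1]
        nlinarith [norm_nonneg z, le_max_left 1 s]
      · rw [min_eq_left h1, mul_one]
        exact h.le.trans (le_max_right _ _)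
    · rw [indicator_of_notMem (by exact h), abs_zero]
      exact mul_nonneg (zero_le_one.trans (le_max_left _ _)) (le_min zero_le_one (norm_nonneg z))

/-- The first moment of the kernel over the ball of radius `s`. -/
def ballMoment (N : ℕ) (σ s : ℝ) : ℝ :=
  ∫ z : RN N, {z : RN N | ‖z‖ < s}.indicator (fun z => ‖z‖) z * kern σ z

lemma ballMoment_nonneg (s : ℝ) : 0 ≤ ballMoment N σ s :=
  integral_nonneg fun z => mul_nonneg (indicator_nonneg (fun _ _ => norm_nonneg _) _)
    (kern_nonneg z)

/-- Since `σ < 1` the first moment is finite, so the part of the operator near the singularity is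
negligible on functions with linearly bounded increments. -/
lemma tendsto_ballMoment [NeZero N] (hσ : 0 < σ) (hσ1 : σ < 1) :
    Tendsto (ballMoment N σ) (𝓝[>] 0) (𝓝 0) := by
  have h0 : ∫ _ : RN N, (0 : ℝ) = 0 := integral_zero _ _
  suffices h : Tendsto (ballMoment N σ) (𝓝[>] 0) (𝓝 (∫ _ : RN N, (0 : ℝ))) by rwa [h0] at h
  refine tendsto_integral_filter_of_dominated_convergence
    (fun z => {z : RN N | ‖z‖ < 1}.indicator (fun z => ‖z‖) z * kern σ z) ?_ ?_
    (integrable_indicator_norm_mul_kern hσ hσ1 1) ?_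
  · exact Eventually.of_forall fun s =>
      (integrable_indicator_norm_mul_kern hσ hσ1 s).aestronglyMeasurable
  · have h1 : ∀ᶠ θ : ℝ in 𝓝[>] 0, θ ≤ 1 := nhdsWithin_le_nhds (Iic_mem_nhds zero_lt_one)
    filter_upwards [h1] with s hs
    refine ae_of_all _ fun z => ?_
    have hi : 0 ≤ {z : RN N | ‖z‖ < s}.indicator (fun z => ‖z‖) z :=
      indicator_nonneg (fun _ _ => norm_nonneg _) _
    rw [Real.norm_eq_abs, abs_of_nonneg (mul_nonneg hi (kern_nonneg z))]
    refine mul_le_mul_of_nonneg_right ?_ (kern_nonneg z)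
    refine indicator_le_indicator_of_subset (fun z hz => ?_) (fun _ => norm_nonneg _) z
    exact lt_of_lt_of_le hz hs
  · refine ae_of_all _ fun z => ?_
    refine tendsto_const_nhds.congr' ?_
    rcases eq_or_ne z 0 with rfl | hz
    · refine Eventually.of_forall fun s => ?_
      by_cases h : (0 : RN N) ∈ {z : RN N | ‖z‖ < s} <;> simp [indicator]
    · filter_upwards [nhdsWithin_le_nhds (Iio_mem_nhds (norm_pos_iff.2 hz))] with s hs
      rw [indicator_of_notMem, zero_mul]
      exact not_lt.2 ((le_of_lt (show s < ‖z‖ from hs)))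

end Kernel

end CensoredNeumann

end


/-! ### The jump kernel and the censored operator written as a Lebesgue integral. -/

noncomputable section

namespace CensoredNeumann

open Set Filter Topology MeasureTheory

/-- The jump measures with their densities, and the jump function with its inverses, bundled with
the constants of (M), (J0) and (J1). -/
structure JumpKernel {N : ℕ} (Ω : Set (RN N)) (μ : RN N → Measure (RN N))
    (j : RN N → RN N → RN N) (σ Cj : ℝ) where
  g : RN N → RN N → ℝ
  C : ℝ
  D : ℝ
  low : ℝ
  jlip : ℝ
  inv : RN N → RN N → RN N
  invBound : ℝ
  σ_pos : 0 < σ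
  σ_lt_one : σ < 1
  meas : ∀ x ∈ closure Ω, Measurable (g x)
  nonneg : ∀ x ∈ closure Ω, ∀ z, 0 ≤ g x z
  density : ∀ x ∈ closure Ω, μ x = volume.withDensity (fun z => ENNReal.ofReal (g x z))
  C_pos : 0 < C
  D_pos : 0 < D
  g_le : ∀ x ∈ closure Ω, ∀ z, z ≠ 0 → g x z ≤ C * kern σ z
  g_lip : ∀ x ∈ closure Ω, ∀ y ∈ closure Ω, ∀ z, z ≠ 0 →
    |g x z - g y z| ≤ D * ‖x - y‖ * kern σ z
  contDiff : ∀ x ∈ closure Ω, ContDiff ℝ 1 (j x)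
  contDiff_inv : ∀ x ∈ closure Ω, ContDiff ℝ 1 (inv x)
  left_inv : ∀ x ∈ closure Ω, Function.LeftInverse (inv x) (j x)
  right_inv : ∀ x ∈ closure Ω, Function.RightInverse (inv x) (j x)
  fderiv_inv_le : ∀ x ∈ closure Ω, ∀ w, ‖fderiv ℝ (inv x) w‖ ≤ invBound
  low_pos : 0 < low
  Cj_pos : 0 < Cj
  jlip_pos : 0 < jlip
  low_le : ∀ x ∈ closure Ω, ∀ z, low * ‖z‖ ≤ ‖j x z‖
  le_up : ∀ x ∈ closure Ω, ∀ z, ‖j x z‖ ≤ Cj * ‖z‖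
  j_lip : ∀ x ∈ closure Ω, ∀ y ∈ closure Ω, ∀ z, ‖j x z - j y z‖ ≤ jlip * ‖z‖ * ‖x - y‖

lemma exists_jumpKernel {N : ℕ} {Ω : Set (RN N)} {μ : RN N → Measure (RN N)} {σ : ℝ}
    (hM : AssumptionM Ω μ σ) {j : RN N → RN N → RN N} (hJ0 : AssumptionJ0 Ω j) {Cj' Cj Dj : ℝ}
    (hJ1 : AssumptionJ1 Ω j Cj' Cj Dj) : Nonempty (JumpKernel Ω μ j σ Cj) := by
  obtain ⟨hσ, hσ1, g, hg, Cμ, Dμ, hC, hD, hb⟩ := hM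
  obtain ⟨jinv, Aj, hj⟩ := hJ0
  obtain ⟨h1, h2, h3, h4⟩ := hJ1
  exact ⟨{ g := g, C := Cμ, D := Dμ, low := Cj', jlip := Dj, inv := jinv, invBound := Aj
           σ_pos := hσ, σ_lt_one := hσ1
           meas := fun x hx => (hg x hx).1
           nonneg := fun x hx => (hg x hx).2.1
           density := fun x hx => (hg x hx).2.2
           C_pos := hC, D_pos := hD
           g_le := fun x hx z hz => (hb x hx x hx z hz).1
           g_lip := fun x hx y hy z hz => (hb x hx y hy z hz).2
           contDiff := fun x hx => (hj x hx).1
           contDiff_inv := fun x hx => (hj x hx).2.1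
           left_inv := fun x hx => (hj x hx).2.2.1
           right_inv := fun x hx => (hj x hx).2.2.2.1
           fderiv_inv_le := fun x hx => (hj x hx).2.2.2.2
           low_pos := h1, Cj_pos := h2, jlip_pos := h3
           low_le := fun x hx z => (h4 x hx x hx z).1
           le_up := fun x hx z => (h4 x hx x hx z).2.1
           j_lip := fun x hx y hy z => (h4 x hx y hy z).2.2 }⟩

/-- Bounded on `closure Ω` and Borel there. -/
def Adm {N : ℕ} (Ω : Set (RN N)) (u : RN N → ℝ) : Prop :=
  BoundedOnClosure Ω u ∧ Measurable ((closure Ω).indicator u)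

section Adm

variable {N : ℕ} {Ω : Set (RN N)} {u : RN N → ℝ}

/-- The indicator is essential: nothing is known about `u` outside `closure Ω`, and the operator
only sees landing points inside. -/
lemma measurable_indicator_of_usc (h : UpperSemicontinuousOn u (closure Ω)) :
    Measurable ((closure Ω).indicator u) := by
  have h1 : UpperSemicontinuous ((closure Ω).domRestrict u) := by
    rwa [upperSemicontinuousOn_iff_restrict]
  have h2 : Measurable ((closure Ω).domRestrict u) := h1.measurable
  have hm : MeasurableSet (closure Ω) := isClosed_closure.measurableSet
  refine measurable_of_restrict_of_restrict_compl hm ?_ ?_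
  · convert h2 using 1
    ext x
    simp [x.2]
  · have : ((closure Ω)ᶜ).domRestrict ((closure Ω).indicator u) = fun _ => 0 := by
      ext x
      have := x.2
      simp only [domRestrict_apply]
      rw [indicator_of_notMem this]
    rw [this]; exact measurable_const

lemma adm_of_usc (hb : BoundedOnClosure Ω u) (h : UpperSemicontinuousOn u (closure Ω)) :
    Adm Ω u := ⟨hb, measurable_indicator_of_usc h⟩

lemma BoundedOnClosure.neg (hb : BoundedOnClosure Ω u) : BoundedOnClosure Ω (fun x => -u x) := by
  obtain ⟨K, hK⟩ := hb
  exact ⟨K, fun x hx => by rw [abs_neg]; exact hK x hx⟩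

lemma Adm.neg (h : Adm Ω u) : Adm Ω (fun x => -u x) := by
  refine ⟨h.1.neg, ?_⟩
  have : (closure Ω).indicator (fun x => -u x) = fun x => -((closure Ω).indicator u x) := by
    ext x; by_cases hx : x ∈ closure Ω <;> simp [hx]
  rw [this]; exact h.2.neg

lemma LowerSemicontinuousOn.neg_usc {s : Set (RN N)} (h : LowerSemicontinuousOn u s) :
    UpperSemicontinuousOn (fun x => -u x) s := by
  intro x hx y hy
  filter_upwards [h x hx (-y) (by simp only at hy; linarith)] with z hz
  linarith

lemma UpperSemicontinuousOn.neg_lsc {s : Set (RN N)} (h : UpperSemicontinuousOn u s) :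
    LowerSemicontinuousOn (fun x => -u x) s := by
  intro x hx y hy
  filter_upwards [h x hx (-y) (by simp only at hy; linarith)] with z hz
  linarith

lemma adm_of_lsc (hb : BoundedOnClosure Ω u) (h : LowerSemicontinuousOn u (closure Ω)) :
    Adm Ω u := by
  simpa using (adm_of_usc hb.neg (LowerSemicontinuousOn.neg_usc h)).neg

end Adm

section Parts

variable {N : ℕ} {Ω : Set (RN N)} {μ : RN N → Measure (RN N)} {j : RN N → RN N → RN N}
  {σ Cj : ℝ} (J : JumpKernel Ω μ j σ Cj)

/-- The jumps from `x` that land in `closure Ω`. -/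
def jumpSet (Ω : Set (RN N)) (j : RN N → RN N → RN N) (x : RN N) : Set (RN N) :=
  {z | x + j x z ∈ closure Ω}

/-- The integrand of the censored operator, with respect to Lebesgue measure. -/
def JumpKernel.incr (u : RN N → ℝ) (x z : RN N) : ℝ :=
  (jumpSet Ω j x).indicator (fun z => J.g x z * (u (x + j x z) - u x)) z

include J in
lemma JumpKernel.measurable_j {x : RN N} (hx : x ∈ closure Ω) : Measurable (j x) :=
  (J.contDiff x hx).continuous.measurable

include J in
lemma JumpKernel.measurableSet_jumpSet {x : RN N} (hx : x ∈ closure Ω) :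
    MeasurableSet (jumpSet Ω j x) :=
  ((J.measurable_j hx).const_add x) isClosed_closure.measurableSet

lemma JumpKernel.measurable_incr {u : RN N → ℝ} (hu : Measurable ((closure Ω).indicator u))
    {x : RN N} (hx : x ∈ closure Ω) : Measurable (J.incr u x) := by
  have h : J.incr u x = (jumpSet Ω j x).indicator
      (fun z => J.g x z * ((closure Ω).indicator u (x + j x z) - u x)) := by
    ext z
    unfold JumpKernel.incr
    by_cases hz : z ∈ jumpSet Ω j x
    · rw [indicator_of_mem hz, indicator_of_mem hz, indicator_of_mem (by exact hz)]
    · rw [indicator_of_notMem hz, indicator_of_notMem hz]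
  rw [h]
  refine Measurable.indicator ((J.meas x hx).mul (Measurable.sub_const ?_ _))
    (J.measurableSet_jumpSet hx)
  exact hu.comp ((J.measurable_j hx).const_add x)

lemma JumpKernel.measurable_indicator_of_continuous {φ : RN N → ℝ} (hφ : Continuous φ) :
    Measurable ((closure Ω).indicator φ) :=
  hφ.measurable.indicator isClosed_closure.measurableSet

/-- Passing to a fixed reference measure makes operators at different base points comparable under a
single integral sign. -/
lemma JumpKernel.setIntegral_eq {x : RN N} (hx : x ∈ closure Ω) {S : Set (RN N)}
    (hS : MeasurableSet S) (f : RN N → ℝ) :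
    ∫ z in S, f z ∂(μ x) = ∫ z, S.indicator (fun z => J.g x z * f z) z := by
  rw [J.density x hx, setIntegral_withDensity_eq_setIntegral_toReal_smul
    ((J.meas x hx).ennreal_ofReal) (ae_of_all _ fun z => ENNReal.ofReal_lt_top) f hS,
    ← integral_indicator hS]
  congr 1
  ext z
  simp only [indicator]
  split_ifs
  · rw [ENNReal.toReal_ofReal (J.nonneg x hx z), smul_eq_mul]
  · rfl

lemma JumpKernel.outerPart_eq {x : RN N} (hx : x ∈ closure Ω) (ξ : ℝ) (u : RN N → ℝ) :
    outerPart Ω μ j ξ u x = ∫ z, {z : RN N | ξ ≤ ‖z‖}.indicator (J.incr u x) z := by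
  unfold outerPart
  rw [J.setIntegral_eq hx (S := {z | ξ ≤ ‖z‖ ∧ x + j x z ∈ closure Ω})
    ((measurableSet_le measurable_const measurable_norm).inter (J.measurableSet_jumpSet hx))]
  congr 1
  ext z
  simp only [indicator, JumpKernel.incr, jumpSet, mem_ofPred_eq]
  split_ifs <;> simp_all

lemma JumpKernel.innerPart_eq {x : RN N} (hx : x ∈ closure Ω) (ξ : ℝ) (u : RN N → ℝ) :
    innerPart Ω μ j ξ u x = ∫ z, {z : RN N | ‖z‖ < ξ}.indicator (J.incr u x) z := by
  unfold innerPart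
  rw [J.setIntegral_eq hx (S := {z | ‖z‖ < ξ ∧ x + j x z ∈ closure Ω})
    ((measurableSet_lt measurable_norm measurable_const).inter (J.measurableSet_jumpSet hx))]
  congr 1
  ext z
  simp only [indicator, JumpKernel.incr, jumpSet, mem_ofPred_eq]
  split_ifs <;> simp_all

include J in
lemma JumpKernel.j_zero {x : RN N} (hx : x ∈ closure Ω) : j x 0 = 0 := by
  have := J.le_up x hx 0
  simpa using this

lemma JumpKernel.incr_zero (u : RN N → ℝ) {x : RN N} (hx : x ∈ closure Ω) : J.incr u x 0 = 0 := by
  unfold JumpKernel.incr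
  rw [indicator_apply_eq_zero]
  intro _
  simp [J.j_zero hx]

/-- Upper bound of the integrand from an upper bound of the increment. -/
lemma JumpKernel.incr_le {u : RN N → ℝ} {x : RN N} (hx : x ∈ closure Ω) {z : RN N} {B : ℝ}
    (hB : 0 ≤ B) (h : x + j x z ∈ closure Ω → u (x + j x z) - u x ≤ B) :
    J.incr u x z ≤ J.C * (B * kern σ z) := by
  have hr : 0 ≤ J.C * (B * kern σ z) :=
    mul_nonneg J.C_pos.le (mul_nonneg hB (kern_nonneg z))
  rcases eq_or_ne z 0 with rfl | hz
  · rwa [J.incr_zero u hx]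
  unfold JumpKernel.incr
  by_cases hm : z ∈ jumpSet Ω j x
  · rw [indicator_of_mem hm]
    calc J.g x z * (u (x + j x z) - u x) ≤ J.g x z * B :=
          mul_le_mul_of_nonneg_left (h hm) (J.nonneg x hx z)
      _ ≤ (J.C * kern σ z) * B := mul_le_mul_of_nonneg_right (J.g_le x hx z hz) hB
      _ = _ := by ring
  · rwa [indicator_of_notMem hm]

lemma JumpKernel.incr_neg (u : RN N → ℝ) (x z : RN N) :
    J.incr (fun y => -u y) x z = -J.incr u x z := by
  unfold JumpKernel.incr
  by_cases hm : z ∈ jumpSet Ω j x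
  · rw [indicator_of_mem hm, indicator_of_mem hm]; ring
  · rw [indicator_of_notMem hm, indicator_of_notMem hm, neg_zero]

lemma JumpKernel.abs_incr_le {u : RN N → ℝ} {x : RN N} (hx : x ∈ closure Ω) {z : RN N} {B : ℝ}
    (hB : 0 ≤ B) (h : x + j x z ∈ closure Ω → |u (x + j x z) - u x| ≤ B) :
    |J.incr u x z| ≤ J.C * (B * kern σ z) := by
  refine abs_le.2 ⟨?_, J.incr_le hx hB fun hm => (le_abs_self _).trans (h hm)⟩
  rw [neg_le, ← J.incr_neg]
  refine J.incr_le hx hB fun hm => ?_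
  have := (neg_abs_le _).trans' (neg_le_neg (h hm))
  linarith

lemma Adm.exists_bound {u : RN N → ℝ} (h : Adm Ω u) :
    ∃ K, 0 ≤ K ∧ ∀ x ∈ closure Ω, |u x| ≤ K := by
  obtain ⟨⟨K, hK⟩, -⟩ := h
  exact ⟨max K 0, le_max_right _ _, fun x hx => (hK x hx).trans (le_max_left _ _)⟩

lemma abs_sub_le_two_mul {a b K : ℝ} (ha : |a| ≤ K) (hb : |b| ≤ K) : |a - b| ≤ 2 * K := by
  have := abs_sub a b
  linarith

lemma indicator_norm_ge_kern_le {ξ B : ℝ} (hξ : 0 < ξ) (hB : 0 ≤ B) (z : RN N) (hz : ξ ≤ ‖z‖) :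
    B * kern σ z ≤ B / min 1 ξ * (min 1 ‖z‖ * kern σ z) := by
  have hm : 0 < min 1 ξ := lt_min one_pos hξ
  have h1 : min 1 ξ ≤ min 1 ‖z‖ := min_le_min le_rfl hz
  have h2 : B ≤ B / min 1 ξ * min 1 ‖z‖ := by
    rw [div_mul_eq_mul_div, le_div_iff₀ hm]
    exact mul_le_mul_of_nonneg_left h1 hB
  rw [← mul_assoc]
  exact mul_le_mul_of_nonneg_right h2 (kern_nonneg z)

lemma JumpKernel.abs_outer_le {u : RN N → ℝ} {K : ℝ} (hK0 : 0 ≤ K)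
    (hK : ∀ x ∈ closure Ω, |u x| ≤ K) {x : RN N}
    (hx : x ∈ closure Ω) {ξ : ℝ} (hξ : 0 < ξ) (z : RN N) :
    |{z : RN N | ξ ≤ ‖z‖}.indicator (J.incr u x) z| ≤
      J.C * (2 * K / min 1 ξ) * (min 1 ‖z‖ * kern σ z) := by
  by_cases hz : z ∈ {z : RN N | ξ ≤ ‖z‖}
  · rw [indicator_of_mem hz]
    refine (J.abs_incr_le hx (B := 2 * K) (by positivity)
      fun hm => abs_sub_le_two_mul (hK _ hm) (hK _ hx)).trans ?_
    rw [mul_assoc J.C]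
    exact mul_le_mul_of_nonneg_left (indicator_norm_ge_kern_le hξ (by positivity) z hz) J.C_pos.le
  · rw [indicator_of_notMem hz, abs_zero]
    have : 0 < min 1 ξ := lt_min one_pos hξ
    have := J.C_pos
    exact mul_nonneg (by positivity)
      (mul_nonneg (le_min zero_le_one (norm_nonneg _)) (kern_nonneg z))

lemma JumpKernel.integrable_outer [NeZero N] {u : RN N → ℝ} (hu : Adm Ω u) {x : RN N}
    (hx : x ∈ closure Ω) {ξ : ℝ} (hξ : 0 < ξ) :
    Integrable ({z : RN N | ξ ≤ ‖z‖}.indicator (J.incr u x)) := by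
  obtain ⟨K, hK0, hK⟩ := hu.exists_bound
  refine ((integrable_min_mul_kern J.σ_pos J.σ_lt_one).const_mul
    (J.C * (2 * K / min 1 ξ))).mono' ?_ (ae_of_all _ fun z => ?_)
  · exact ((J.measurable_incr hu.2 hx).indicator
      (measurableSet_le measurable_const measurable_norm)).aestronglyMeasurable
  · exact J.abs_outer_le hK0 hK hx hξ z

lemma JumpKernel.abs_inner_le {φ : RN N → ℝ} {x : RN N} (hx : x ∈ closure Ω) {ξ K : ℝ}
    (hK : 0 ≤ K) (h : ∀ z, ‖z‖ < ξ → x + j x z ∈ closure Ω → |φ (x + j x z) - φ x| ≤ K * ‖z‖)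
    (z : RN N) :
    |{z : RN N | ‖z‖ < ξ}.indicator (J.incr φ x) z| ≤
      J.C * K * ({z : RN N | ‖z‖ < ξ}.indicator (fun z => ‖z‖) z * kern σ z) := by
  by_cases hz : z ∈ {z : RN N | ‖z‖ < ξ}
  · rw [indicator_of_mem hz, indicator_of_mem hz]
    refine (J.abs_incr_le hx (B := K * ‖z‖) (by positivity) (h z hz)).trans (le_of_eq ?_)
    ring
  · rw [indicator_of_notMem hz, indicator_of_notMem hz]
    simp

lemma JumpKernel.integrable_inner [NeZero N] {φ : RN N → ℝ}
    (hφ : Measurable ((closure Ω).indicator φ)) {x : RN N} (hx : x ∈ closure Ω) {ξ K : ℝ}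
    (hK : 0 ≤ K) (h : ∀ z, ‖z‖ < ξ → x + j x z ∈ closure Ω → |φ (x + j x z) - φ x| ≤ K * ‖z‖) :
    Integrable ({z : RN N | ‖z‖ < ξ}.indicator (J.incr φ x)) := by
  refine ((integrable_indicator_norm_mul_kern J.σ_pos J.σ_lt_one ξ).const_mul
    (J.C * K)).mono' ?_ (ae_of_all _ fun z => ?_)
  · exact ((J.measurable_incr hφ hx).indicator
      (measurableSet_lt measurable_norm measurable_const)).aestronglyMeasurable
  · exact J.abs_inner_le hx hK h z

lemma JumpKernel.abs_innerPart_le [NeZero N] {φ : RN N → ℝ} {x : RN N} (hx : x ∈ closure Ω)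
    {ξ K : ℝ} (hK : 0 ≤ K)
    (h : ∀ z, ‖z‖ < ξ → x + j x z ∈ closure Ω → |φ (x + j x z) - φ x| ≤ K * ‖z‖) :
    |innerPart Ω μ j ξ φ x| ≤ J.C * K * ballMoment N σ ξ := by
  rw [J.innerPart_eq hx, ballMoment, ← integral_const_mul, ← Real.norm_eq_abs]
  refine norm_integral_le_of_norm_le
    ((integrable_indicator_norm_mul_kern J.σ_pos J.σ_lt_one ξ).const_mul _)
    (ae_of_all _ fun z => J.abs_inner_le hx hK h z)

lemma exists_lipschitz_bound {φ : RN N → ℝ} (hφ : ContDiff ℝ 1 φ) (x : RN N) (R : ℝ) :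
    ∃ K, 0 ≤ K ∧ ∀ w, ‖w‖ ≤ R → |φ (x + w) - φ x| ≤ K * ‖w‖ := by
  obtain ⟨K, hK⟩ := (isCompact_closedBall x R).exists_bound_of_continuousOn
    ((hφ.continuous_fderiv one_ne_zero).continuousOn)
  refine ⟨max K 0, le_max_right _ _, fun w hw => ?_⟩
  have hR : 0 ≤ R := (norm_nonneg w).trans hw
  have := (convex_closedBall x R).norm_image_sub_le_of_norm_fderiv_le (𝕜 := ℝ) (f := φ)
    (fun y _ => (hφ.differentiable one_ne_zero).differentiableAt)
    (fun y hy => (hK y hy).trans (le_max_left K 0)) (Metric.mem_closedBall_self hR)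
    (show x + w ∈ Metric.closedBall x R by simpa using hw)
  simpa using this

include J in
lemma JumpKernel.exists_test_bound {φ : RN N → ℝ} (hφ : ContDiff ℝ 1 φ) {x : RN N}
    (hx : x ∈ closure Ω) (R : ℝ) :
    ∃ K, 0 ≤ K ∧ ∀ z, ‖z‖ < R → x + j x z ∈ closure Ω → |φ (x + j x z) - φ x| ≤ K * ‖z‖ := by
  obtain ⟨K, hK0, hK⟩ := exists_lipschitz_bound hφ x (Cj * R)
  refine ⟨K * Cj, mul_nonneg hK0 J.Cj_pos.le, fun z hz _ => ?_⟩
  have h1 := J.le_up x hx z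
  have h2 : ‖j x z‖ ≤ Cj * R := h1.trans (mul_le_mul_of_nonneg_left hz.le J.Cj_pos.le)
  calc |φ (x + j x z) - φ x| ≤ K * ‖j x z‖ := hK _ h2
    _ ≤ K * (Cj * ‖z‖) := mul_le_mul_of_nonneg_left h1 hK0
    _ = _ := by ring

/-- The part of the operator over `ξ' ≤ |z|` splits at `|z| = ξ`; if increments are controlled by
`K|z|` on the annulus, the annulus contributes at most a multiple of `ballMoment`. -/
lemma JumpKernel.outerPart_le_outerPart_add [NeZero N] {u : RN N → ℝ} (hu : Adm Ω u) {x : RN N}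
    (hx : x ∈ closure Ω) {ξ ξ' K : ℝ} (hξ' : 0 < ξ') (hle : ξ' ≤ ξ) (hK : 0 ≤ K)
    (h : ∀ z, ‖z‖ < ξ → x + j x z ∈ closure Ω → u (x + j x z) - u x ≤ K * ‖z‖) :
    outerPart Ω μ j ξ' u x ≤ outerPart Ω μ j ξ u x + J.C * K * ballMoment N σ ξ := by
  have hm := (integrable_indicator_norm_mul_kern (N := N) J.σ_pos J.σ_lt_one ξ).const_mul (J.C * K)
  rw [J.outerPart_eq hx, J.outerPart_eq hx, ballMoment, ← integral_const_mul,
    ← integral_add (J.integrable_outer hu hx (hξ'.trans_le hle)) hm]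
  refine integral_mono (J.integrable_outer hu hx hξ')
    ((J.integrable_outer hu hx (hξ'.trans_le hle)).add hm) fun z => ?_
  simp only
  by_cases h1 : ξ ≤ ‖z‖
  · rw [indicator_of_mem (by exact hle.trans h1), indicator_of_mem (by exact h1),
      indicator_of_notMem (by exact not_lt.2 h1)]
    simp
  · have h1' := not_le.1 h1
    have h3 : J.incr u x z ≤ J.C * K * (‖z‖ * kern σ z) := by
      refine (J.incr_le hx (B := K * ‖z‖) (by positivity) (h z h1')).trans (le_of_eq ?_)
      ring
    rw [indicator_of_notMem (s := {z : RN N | ξ ≤ ‖z‖}) (by exact h1),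
      indicator_of_mem (s := {z : RN N | ‖z‖ < ξ}) (by exact h1'), zero_add]
    by_cases h2 : ξ' ≤ ‖z‖
    · rwa [indicator_of_mem (by exact h2)]
    · rw [indicator_of_notMem (by exact h2)]
      have := J.C_pos
      exact mul_nonneg (by positivity) (mul_nonneg (norm_nonneg z) (kern_nonneg z))

lemma outerPart_neg (ξ : ℝ) (u : RN N → ℝ) (x : RN N) :
    outerPart Ω μ j ξ (fun y => -u y) x = -outerPart Ω μ j ξ u x := by
  unfold outerPart
  rw [← integral_neg]
  congr 1
  ext z
  ring

lemma innerPart_neg (ξ : ℝ) (u : RN N → ℝ) (x : RN N) :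
    innerPart Ω μ j ξ (fun y => -u y) x = -innerPart Ω μ j ξ u x := by
  unfold innerPart
  rw [← integral_neg]
  congr 1
  ext z
  ring

lemma outerPart_const_mul (t ξ : ℝ) (u : RN N → ℝ) (x : RN N) :
    outerPart Ω μ j ξ (fun y => t * u y) x = t * outerPart Ω μ j ξ u x := by
  unfold outerPart
  rw [← integral_const_mul]
  congr 1
  ext z
  ring

end Parts

end CensoredNeumann

end


/-! ### Test functions, duality, and removal of the inner part. -/

noncomputable section

namespace CensoredNeumann

open Set Filter Topology MeasureTheory

section Jets

variable {N : ℕ} (Ω : Set (RN N)) (μ : RN N → Measure (RN N)) (j : RN N → RN N → RN N)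

/-- The subsolution inequality at `x` for the gradient `p`, the inner part having been sent to
zero. -/
def SubAt (H : RN N → RN N → ℝ) (u : RN N → ℝ) (x p : RN N) : Prop :=
  ∀ η > 0, ∀ᶠ ξ in 𝓝[>] (0 : ℝ), u x - outerPart Ω μ j ξ u x + H x p ≤ η

/-- The supersolution inequality at `x` for the gradient `p`. -/
def SuperAt (H : RN N → RN N → ℝ) (v : RN N → ℝ) (x p : RN N) : Prop :=
  ∀ η > 0, ∀ᶠ ξ in 𝓝[>] (0 : ℝ), -η ≤ v x - outerPart Ω μ j ξ v x + H x p

/-- The Hamiltonian of the problem solved by `-u`. -/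
def dualH (H : RN N → RN N → ℝ) : RN N → RN N → ℝ := fun x p => -H x (-p)

end Jets

section Lemmas

variable {N : ℕ} {Ω : Set (RN N)} {μ : RN N → Measure (RN N)} {j : RN N → RN N → RN N}
  {σ Cj : ℝ} {H : RN N → RN N → ℝ}

lemma superAt_iff_dual {v : RN N → ℝ} {x p : RN N} :
    SuperAt Ω μ j H v x p ↔ SubAt Ω μ j (dualH H) (fun y => -v y) x (-p) := by
  unfold SuperAt SubAt dualH
  refine forall₂_congr fun η _ => eventually_congr (Eventually.of_forall fun ξ => ?_)
  rw [outerPart_neg, neg_neg]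
  constructor <;> intro h <;> linarith

lemma gradient_neg' (φ : RN N → ℝ) (x : RN N) :
    gradient (fun y => -φ y) x = -gradient φ x := by
  unfold gradient
  rw [fderiv_fun_neg, map_neg]

lemma opF_dual (ξ : ℝ) (u φ : RN N → ℝ) (x : RN N) :
    opF Ω μ j (dualH H) ξ (fun y => -u y) (fun y => -φ y) x = -opF Ω μ j H ξ u φ x := by
  unfold opF dualH
  rw [innerPart_neg, outerPart_neg, gradient_neg', neg_neg]
  ring

lemma normalDeriv_neg (φ : RN N → ℝ) (x : RN N) :
    normalDeriv Ω (fun y => -φ y) x = -normalDeriv Ω φ x := by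
  unfold normalDeriv
  rw [gradient_neg', inner_neg_left]

/-- The change `v ↦ -v`, `H ↦ dualH H` exchanges the two notions, so only subsolutions need to be
studied, and the doubling can be made symmetric in its two variables. -/
lemma IsSupersolution.dual {v : RN N → ℝ} (h : IsSupersolution Ω μ j Cj H v) :
    IsSubsolution Ω μ j Cj (dualH H) (fun x => -v x) := by
  refine ⟨h.1.neg, LowerSemicontinuousOn.neg_usc h.2.1, fun φ ξ x hφ hξ hx hmax => ?_⟩
  have hmin : IsMinOn (fun y => v y - -φ y) (Metric.closedBall x (Cj * ξ) ∩ closure Ω) x := by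
    intro y hy
    have := hmax hy
    simp only [mem_ofPred_eq] at this ⊢
    linarith
  obtain ⟨h1, h2⟩ := h.2.2 (fun y => -φ y) ξ x hφ.neg hξ hx hmin
  have e : opF Ω μ j (dualH H) ξ (fun x => -v x) φ x = -opF Ω μ j H ξ v (fun y => -φ y) x := by
    simpa using opF_dual (Ω := Ω) (μ := μ) (j := j) (H := H) ξ v (fun y => -φ y) x
  have e2 := normalDeriv_neg (Ω := Ω) φ x
  rw [e]
  refine ⟨fun hx => by linarith [h1 hx], fun hx => ?_⟩
  rcases le_max_iff.1 (h2 hx) with h3 | h3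
  · exact (min_le_left _ _).trans (by linarith)
  · exact (min_le_right _ _).trans (by linarith)

lemma isSupersolution_of_dual {v : RN N → ℝ}
    (h : IsSubsolution Ω μ j Cj (dualH H) (fun x => -v x)) : IsSupersolution Ω μ j Cj H v := by
  refine ⟨by simpa using h.1.neg, by simpa using UpperSemicontinuousOn.neg_lsc h.2.1,
    fun φ ξ x hφ hξ hx hmin => ?_⟩
  have hmax : IsMaxOn (fun y => -v y - -φ y) (Metric.closedBall x (Cj * ξ) ∩ closure Ω) x := by
    intro y hy
    have := hmin hy
    simp only [mem_ofPred_eq] at this ⊢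
    linarith
  obtain ⟨h1, h2⟩ := h.2.2 (fun y => -φ y) ξ x hφ.neg hξ hx hmax
  rw [opF_dual] at h1 h2
  rw [normalDeriv_neg] at h2
  refine ⟨fun hx => by linarith [h1 hx], fun hx => ?_⟩
  rcases min_le_iff.1 (h2 hx) with h3 | h3
  · exact (by linarith : (0:ℝ) ≤ _).trans (le_max_left _ _)
  · exact (by linarith : (0:ℝ) ≤ _).trans (le_max_right _ _)

/-- The penalizations involve the signed distance, which is `C¹` only near the boundary; a bump
function turns them into global test functions. -/
lemma exists_global_test {φ : RN N → ℝ} {x : RN N} (hφ : ContDiffAt ℝ 1 φ x) :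
    ∃ ψ : RN N → ℝ, ContDiff ℝ 1 ψ ∧ ψ =ᶠ[𝓝 x] φ := by
  have h1 : ∀ᶠ y in 𝓝 x, ContDiffAt ℝ 1 φ y := hφ.eventually (by simp)
  obtain ⟨r, hr, hb⟩ := Metric.eventually_nhds_iff_ball.1 h1
  let f : ContDiffBump x := ⟨r / 4, r / 2, by linarith, by linarith⟩
  refine ⟨fun y => f y * φ y, contDiff_iff_contDiffAt.2 fun y => ?_, ?_⟩
  · by_cases hy : y ∈ Metric.ball x r
    · exact (f.contDiff.contDiffAt).mul (hb y hy)
    · have h2 : y ∉ tsupport f := by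
        rw [f.tsupport_eq]
        intro h3
        refine hy (Metric.closedBall_subset_ball ?_ h3)
        change r / 2 < r
        linarith
      have h3 : (fun y => f y * φ y) =ᶠ[𝓝 y] fun _ => 0 := by
        filter_upwards [notMem_tsupport_iff_eventuallyEq.1 h2] with w hw
        simp [hw]
      exact contDiffAt_const.congr_of_eventuallyEq h3
  · filter_upwards [f.eventuallyEq_one] with y hy
    simp [hy]

lemma gradient_congr {φ ψ : RN N → ℝ} {x : RN N} (h : φ =ᶠ[𝓝 x] ψ) :
    gradient φ x = gradient ψ x := by
  unfold gradient
  rw [h.fderiv_eq]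

lemma eventually_ballMoment_lt [NeZero N] (J : JumpKernel Ω μ j σ Cj) (K : ℝ) {η : ℝ}
    (hη : 0 < η) : ∀ᶠ ξ in 𝓝[>] (0 : ℝ), J.C * K * ballMoment N σ ξ < η := by
  have h := (tendsto_ballMoment (N := N) J.σ_pos J.σ_lt_one).const_mul (J.C * K)
  rw [mul_zero] at h
  exact h.eventually (Iio_mem_nhds hη)

/-- The increments of a `C¹` function are `O(|z|)`, so its inner part is at most a constant times
`ballMoment N σ ξ`, which tends to zero. -/
lemma subAt_of_opF [NeZero N] (J : JumpKernel Ω μ j σ Cj) {u φ : RN N → ℝ} {x : RN N}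
    (hx : x ∈ closure Ω) (hφ : ContDiff ℝ 1 φ)
    (h : ∀ᶠ ξ in 𝓝[>] (0 : ℝ), opF Ω μ j H ξ u φ x ≤ 0) :
    SubAt Ω μ j H u x (gradient φ x) := by
  intro η hη
  obtain ⟨K, hK0, hK⟩ := J.exists_test_bound hφ hx 1
  filter_upwards [h, eventually_ballMoment_lt J K hη,
    nhdsWithin_le_nhds (Iio_mem_nhds (zero_lt_one' ℝ))] with ξ h1 h2 h3
  have h4 := J.abs_innerPart_le hx hK0 fun z hz => hK z (hz.trans h3)
  have h5 := (abs_le.1 h4).2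
  unfold opF at h1
  linarith

/-- Localization of the test functions of a subsolution. -/
theorem IsSubsolution.jet [NeZero N] (J : JumpKernel Ω μ j σ Cj) {u : RN N → ℝ}
    (hu : IsSubsolution Ω μ j Cj H u) {x : RN N} (hx : x ∈ closure Ω) {φ : RN N → ℝ}
    (hφ : ContDiffAt ℝ 1 φ x) (hmax : ∀ᶠ y in 𝓝[closure Ω] x, u y - φ y ≤ u x - φ x) :
    (x ∈ Ω → SubAt Ω μ j H u x (gradient φ x)) ∧
    (x ∈ frontier Ω → normalDeriv Ω φ x ≤ 0 ∨ SubAt Ω μ j H u x (gradient φ x)) := by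
  obtain ⟨ψ, hψ, hψφ⟩ := exists_global_test hφ
  have hg : gradient φ x = gradient ψ x := gradient_congr hψφ.symm
  have hn : normalDeriv Ω φ x = normalDeriv Ω ψ x := by unfold normalDeriv; rw [hg]
  have h1 : ∀ᶠ y in 𝓝 x, y ∈ closure Ω → u y - ψ y ≤ u x - ψ x := by
    filter_upwards [eventually_nhdsWithin_iff.1 hmax, hψφ] with y hy hyφ hyc
    rw [hyφ, hψφ.eq_of_nhds]
    exact hy hyc
  obtain ⟨r, hr, hb⟩ := Metric.eventually_nhds_iff_ball.1 h1
  have hsmall : ∀ᶠ ξ in 𝓝[>] (0 : ℝ),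
      0 < ξ ∧ IsMaxOn (fun y => u y - ψ y) (Metric.closedBall x (Cj * ξ) ∩ closure Ω) x := by
    have h2 : ∀ᶠ ξ in 𝓝 (0 : ℝ), Cj * ξ < r := by
      have : Tendsto (fun ξ : ℝ => Cj * ξ) (𝓝 0) (𝓝 (Cj * 0)) := tendsto_id.const_mul Cj
      rw [mul_zero] at this
      exact this.eventually (Iio_mem_nhds hr)
    filter_upwards [nhdsWithin_le_nhds h2, self_mem_nhdsWithin] with ξ h3 h4
    refine ⟨h4, fun y hy => hb y (Metric.closedBall_subset_ball h3 hy.1) hy.2⟩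
  rw [hg, hn]
  refine ⟨fun hxΩ => subAt_of_opF J hx hψ ?_, fun hxf => ?_⟩
  · filter_upwards [hsmall] with ξ hξ
    exact (hu.2.2 ψ ξ x hψ hξ.1 hx hξ.2).1 hxΩ
  · rcases le_or_gt (normalDeriv Ω ψ x) 0 with h5 | h5
    · exact Or.inl h5
    · refine Or.inr (subAt_of_opF J hx hψ ?_)
      filter_upwards [hsmall] with ξ hξ
      rcases min_le_iff.1 ((hu.2.2 ψ ξ x hψ hξ.1 hx hξ.2).2 hxf) with h6 | h6
      · exact h6
      · exact absurd h6 (not_le.2 h5)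

/-- On the annulus `ξ' ≤ |z| < ξ` the maximum property gives `u`-increments below `φ`-increments, so
replacing `u` by `φ` there only raises the integral; the piece `|z| < ξ'` is negligible. -/
lemma opF_le_zero_of_subAt [NeZero N] (J : JumpKernel Ω μ j σ Cj) {u φ : RN N → ℝ} {x : RN N}
    (hu : Adm Ω u) (hx : x ∈ closure Ω) (hφ : ContDiff ℝ 1 φ) {ξ : ℝ} (hξ : 0 < ξ)
    (hmax : IsMaxOn (fun y => u y - φ y) (Metric.closedBall x (Cj * ξ) ∩ closure Ω) x)
    (h : SubAt Ω μ j H u x (gradient φ x)) : opF Ω μ j H ξ u φ x ≤ 0 := by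
  obtain ⟨K, hK0, hK⟩ := J.exists_test_bound hφ hx ξ
  have hφm : Measurable ((closure Ω).indicator φ) :=
    JumpKernel.measurable_indicator_of_continuous hφ.continuous
  have hincr : ∀ z, ‖z‖ < ξ → J.incr u x z ≤ J.incr φ x z := by
    intro z hz
    unfold JumpKernel.incr
    refine indicator_le_indicator' fun hm => ?_
    refine mul_le_mul_of_nonneg_left ?_ (J.nonneg x hx z)
    have h1 : x + j x z ∈ Metric.closedBall x (Cj * ξ) := by
      have := (J.le_up x hx z).trans (mul_le_mul_of_nonneg_left hz.le J.Cj_pos.le)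
      simpa using this
    have h2 := hmax ⟨h1, hm⟩
    simp only [mem_ofPred_eq] at h2
    linarith
  refine le_of_forall_pos_le_add fun η hη => ?_
  have hη2 : 0 < η / 2 := by linarith
  have hlt : ∀ᶠ ξ' in 𝓝[>] (0 : ℝ), ξ' < ξ := nhdsWithin_le_nhds (Iio_mem_nhds hξ)
  obtain ⟨ξ', h1, h2, h3, h4⟩ := ((h (η / 2) hη2).and ((eventually_ballMoment_lt J K hη2).and
    (hlt.and self_mem_nhdsWithin))).exists
  have h4 : 0 < ξ' := h4
  have hinner := J.abs_innerPart_le hx hK0 fun z hz => hK z (hz.trans h3)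
  have hmono : outerPart Ω μ j ξ' u x + innerPart Ω μ j ξ' φ x ≤
      outerPart Ω μ j ξ u x + innerPart Ω μ j ξ φ x := by
    rw [J.outerPart_eq hx, J.outerPart_eq hx, J.innerPart_eq hx, J.innerPart_eq hx,
      ← integral_add (J.integrable_outer hu hx h4)
        (J.integrable_inner hφm hx hK0 fun z hz => hK z (hz.trans h3)),
      ← integral_add (J.integrable_outer hu hx hξ) (J.integrable_inner hφm hx hK0 hK)]
    refine integral_mono ((J.integrable_outer hu hx h4).add
      (J.integrable_inner hφm hx hK0 fun z hz => hK z (hz.trans h3)))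
      ((J.integrable_outer hu hx hξ).add (J.integrable_inner hφm hx hK0 hK)) fun z => ?_
    simp only [indicator, mem_ofPred_eq]
    split_ifs <;> first | linarith | (simp; done) | (simp only [add_zero, zero_add]; exact hincr z (by assumption))
  have h5 := (abs_le.1 hinner).1
  unfold opF
  linarith

theorem isSubsolution_of_jets [NeZero N] (J : JumpKernel Ω μ j σ Cj) {u : RN N → ℝ}
    (hb : BoundedOnClosure Ω u) (husc : UpperSemicontinuousOn u (closure Ω))
    (hjet : ∀ x ∈ closure Ω, ∀ φ : RN N → ℝ, ContDiff ℝ 1 φ →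
      (∀ᶠ y in 𝓝[closure Ω] x, u y - φ y ≤ u x - φ x) →
      (x ∈ Ω → SubAt Ω μ j H u x (gradient φ x)) ∧
      (x ∈ frontier Ω → normalDeriv Ω φ x ≤ 0 ∨ SubAt Ω μ j H u x (gradient φ x))) :
    IsSubsolution Ω μ j Cj H u := by
  refine ⟨hb, husc, fun φ ξ x hφ hξ hx hmax => ?_⟩
  have hloc : ∀ᶠ y in 𝓝[closure Ω] x, u y - φ y ≤ u x - φ x := by
    rw [eventually_nhdsWithin_iff]
    filter_upwards [Metric.closedBall_mem_nhds x (mul_pos J.Cj_pos hξ)] with y hy hyc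
    exact hmax ⟨hy, hyc⟩
  obtain ⟨h1, h2⟩ := hjet x hx φ hφ hloc
  have hadm := adm_of_usc hb husc
  refine ⟨fun hxΩ => opF_le_zero_of_subAt J hadm hx hφ hξ hmax (h1 hxΩ), fun hxf => ?_⟩
  rcases h2 hxf with h3 | h3
  · exact (min_le_right _ _).trans h3
  · exact (min_le_left _ _).trans (opF_le_zero_of_subAt J hadm hx hφ hξ hmax h3)

/-- Localization of the test functions of a supersolution. -/
theorem IsSupersolution.jet [NeZero N] (J : JumpKernel Ω μ j σ Cj)
    {v : RN N → ℝ} (hv : IsSupersolution Ω μ j Cj H v) {x : RN N} (hx : x ∈ closure Ω)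
    {φ : RN N → ℝ} (hφ : ContDiffAt ℝ 1 φ x)
    (hmin : ∀ᶠ y in 𝓝[closure Ω] x, v x - φ x ≤ v y - φ y) :
    (x ∈ Ω → SuperAt Ω μ j H v x (gradient φ x)) ∧
    (x ∈ frontier Ω → 0 ≤ normalDeriv Ω φ x ∨ SuperAt Ω μ j H v x (gradient φ x)) := by
  have h := hv.dual.jet J hx hφ.neg (hmin.mono fun y hy => by linarith)
  have e : gradient (fun y => -φ y) x = -gradient φ x := gradient_neg' φ x
  have e2 : normalDeriv Ω (fun y => -φ y) x = -normalDeriv Ω φ x := normalDeriv_neg φ x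
  rw [e, e2] at h
  rw [superAt_iff_dual]
  refine ⟨h.1, fun hxf => (h.2 hxf).imp_left fun h3 => by linarith⟩

theorem isSupersolution_of_jets [NeZero N] (J : JumpKernel Ω μ j σ Cj) {v : RN N → ℝ}
    (hb : BoundedOnClosure Ω v) (hlsc : LowerSemicontinuousOn v (closure Ω))
    (hjet : ∀ x ∈ closure Ω, ∀ φ : RN N → ℝ, ContDiff ℝ 1 φ →
      (∀ᶠ y in 𝓝[closure Ω] x, v x - φ x ≤ v y - φ y) →
      (x ∈ Ω → SuperAt Ω μ j H v x (gradient φ x)) ∧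
      (x ∈ frontier Ω → 0 ≤ normalDeriv Ω φ x ∨ SuperAt Ω μ j H v x (gradient φ x))) :
    IsSupersolution Ω μ j Cj H v := by
  refine isSupersolution_of_dual (isSubsolution_of_jets J hb.neg
    (LowerSemicontinuousOn.neg_usc hlsc) fun x hx φ hφ hmax => ?_)
  have h := hjet x hx (fun y => -φ y) hφ.neg (hmax.mono fun y hy => by linarith)
  rw [gradient_neg', normalDeriv_neg, superAt_iff_dual, neg_neg] at h
  exact ⟨h.1, fun hxf => (h.2 hxf).imp_left fun h3 => by linarith⟩

end Lemmas

end CensoredNeumann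

end


/-! ### Volume estimates and the gradient of the signed distance. -/

noncomputable section

namespace CensoredNeumann

open Set Filter Topology MeasureTheory

section Volume

variable {N : ℕ}

/-- Lebesgue measure is a multiple of the `N`-dimensional Hausdorff measure, which scales at most by
`K ^ N` under Lipschitz maps. -/
lemma volume_image_le_of_lipschitzOnWith {K : NNReal} {f : RN N → RN N} {s : Set (RN N)}
    (hf : LipschitzOnWith K f s) : volume (f '' s) ≤ (K : ENNReal) ^ N * volume s := by
  have h := Measure.isAddLeftInvariant_eq_smul (volume : Measure (RN N))
    (Measure.hausdorffMeasure (N : ℝ))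
  rw [h]
  simp only [Measure.smul_apply]
  rw [ENNReal.smul_def, ENNReal.smul_def, smul_eq_mul, smul_eq_mul, mul_left_comm]
  have := hf.hausdorffMeasure_image_le (d := (N : ℝ)) (Nat.cast_nonneg N)
  rw [ENNReal.rpow_natCast] at this
  exact mul_le_mul_right this _

/-- The volume of a slab of width `2h` in a box of size `2R`. -/
lemma volume_slab_le (c : RN N) (i₀ : Fin N) {R h : ℝ} (hR : 0 ≤ R) (hh : 0 ≤ h) :
    volume {y : RN N | ‖y - c‖ ≤ R ∧ |y i₀| ≤ h} ≤
      ENNReal.ofReal ((2 * R) ^ (N - 1) * (2 * h)) := by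
  set a : Fin N → ℝ := fun i => if i = i₀ then -h else c i - R
  set b : Fin N → ℝ := fun i => if i = i₀ then h else c i + R
  have hsub : {y : RN N | ‖y - c‖ ≤ R ∧ |y i₀| ≤ h} ⊆
      (WithLp.ofLp : RN N → (Fin N → ℝ)) ⁻¹' (Icc a b) := by
    rintro y ⟨h1, h2⟩
    have h3 : ∀ i, |y i - c i| ≤ R := fun i => by
      have := PiLp.norm_apply_le (y - c) i
      simp only [PiLp.sub_apply, Real.norm_eq_abs] at this
      exact this.trans h1
    refine ⟨fun i => ?_, fun i => ?_⟩
    · simp only [a]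
      split_ifs with hi
      · subst hi; exact (abs_le.1 h2).1
      · linarith [(abs_le.1 (h3 i)).1]
    · simp only [b]
      split_ifs with hi
      · subst hi; exact (abs_le.1 h2).2
      · linarith [(abs_le.1 (h3 i)).2]
  refine (measure_mono hsub).trans ?_
  rw [(PiLp.volume_preserving_ofLp (Fin N)).measure_preimage measurableSet_Icc.nullMeasurableSet,
    Real.volume_Icc_pi, ← Finset.mul_prod_erase Finset.univ _ (Finset.mem_univ i₀),
    mul_comm ((2 * R) ^ (N - 1)), ENNReal.ofReal_mul (by positivity)]
  have h1 : b i₀ - a i₀ = 2 * h := by simp [a, b]; ring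
  have h2 : ∀ i ∈ Finset.univ.erase i₀, ENNReal.ofReal (b i - a i) = ENNReal.ofReal (2 * R) := by
    intro i hi
    have hi' : i ≠ i₀ := Finset.ne_of_mem_erase hi
    have : b i - a i = 2 * R := by simp only [a, b, if_neg hi']; ring
    rw [this]
  rw [h1, Finset.prod_congr rfl h2, Finset.prod_const, Finset.card_erase_of_mem
    (Finset.mem_univ i₀), Finset.card_univ, Fintype.card_fin, ENNReal.ofReal_pow (by positivity)]

lemma lipschitzOnWith_of_fderiv_lipschitz {E F : Type*} [NormedAddCommGroup E] [NormedSpace ℝ E]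
    [NormedAddCommGroup F] [NormedSpace ℝ F] {f : E → F} {c : E} {r : ℝ} {K : NNReal}
    (hd : DifferentiableOn ℝ f (Metric.ball c r))
    (hK : LipschitzOnWith K (fderiv ℝ f) (Metric.ball c r)) :
    ∃ B : NNReal, LipschitzOnWith B f (Metric.ball c r) := by
  rcases le_or_gt r 0 with hr | hr
  · exact ⟨0, by rw [Metric.ball_eq_empty.2 hr]; simp⟩
  refine ⟨‖fderiv ℝ f c‖₊ + K * r.toNNReal, ?_⟩
  refine (convex_ball c r).lipschitzOnWith_of_nnnorm_fderiv_le (𝕜 := ℝ)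
    (fun x hx => hd.differentiableAt (Metric.isOpen_ball.mem_nhds hx)) fun x hx => ?_
  have h1 := hK.dist_le_mul x hx c (Metric.mem_ball_self hr)
  rw [← NNReal.coe_le_coe]
  push_cast
  rw [Real.coe_toNNReal _ hr.le]
  have h2 : ‖fderiv ℝ f x‖ ≤ ‖fderiv ℝ f c‖ + ‖fderiv ℝ f x - fderiv ℝ f c‖ := by
    have := norm_add_le (fderiv ℝ f c) (fderiv ℝ f x - fderiv ℝ f c)
    simpa using this
  rw [dist_eq_norm] at h1
  have h3 : (K : ℝ) * dist x c ≤ K * r :=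
    mul_le_mul_of_nonneg_left (le_of_lt hx) K.2
  linarith

end Volume

section SignedDistance

variable {N : ℕ} {Ω : Set (RN N)}

lemma signedDist_of_mem {x : RN N} (hx : x ∈ closure Ω) :
    signedDist Ω x = Metric.infDist x (frontier Ω) := if_pos hx

lemma signedDist_nonneg {x : RN N} (hx : x ∈ closure Ω) : 0 ≤ signedDist Ω x := by
  rw [signedDist_of_mem hx]; exact Metric.infDist_nonneg

lemma signedDist_nonpos {x : RN N} (hx : x ∉ closure Ω) : signedDist Ω x ≤ 0 := by
  unfold signedDist
  rw [if_neg hx]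
  exact neg_nonpos.2 Metric.infDist_nonneg

lemma signedDist_of_mem_frontier {x : RN N} (hx : x ∈ frontier Ω) : signedDist Ω x = 0 := by
  rw [signedDist_of_mem (frontier_subset_closure hx)]
  exact Metric.infDist_zero_of_mem hx

lemma signedDist_lip {x y : RN N} (hx : x ∈ closure Ω) (hy : y ∈ closure Ω) :
    |signedDist Ω x - signedDist Ω y| ≤ ‖x - y‖ := by
  rw [signedDist_of_mem hx, signedDist_of_mem hy]
  have h1 := Metric.infDist_le_infDist_add_dist (s := frontier Ω) (x := x) (y := y)
  have h2 := Metric.infDist_le_infDist_add_dist (s := frontier Ω) (x := y) (y := x)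
  rw [dist_comm] at h2
  rw [← dist_eq_norm, abs_le]
  constructor <;> linarith

lemma inner_gradient (f : RN N → ℝ) (x v : RN N) :
    inner ℝ (gradient f x) v = fderiv ℝ f x v := by
  unfold gradient
  rw [InnerProductSpace.toDual_symm_apply]

lemma norm_gradient (f : RN N → ℝ) (x : RN N) : ‖gradient f x‖ = ‖fderiv ℝ f x‖ := by
  unfold gradient
  rw [LinearIsometryEquiv.norm_map]

/-- The signed distance has a gradient of length one at each boundary point where it is
differentiable with nonzero derivative. -/
lemma norm_fderiv_signedDist {s : RN N} (hs : s ∈ frontier Ω)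
    (hd : DifferentiableAt ℝ (signedDist Ω) s) (hne : fderiv ℝ (signedDist Ω) s ≠ 0) :
    ‖fderiv ℝ (signedDist Ω) s‖ = 1 := by
  set G := gradient (signedDist Ω) s with hG
  set γ := ‖G‖ with hγ
  have hγe : ‖fderiv ℝ (signedDist Ω) s‖ = γ := (norm_gradient _ _).symm
  have hγ0 : 0 < γ := by
    rw [← hγe]; exact norm_pos_iff.2 hne
  have hds : signedDist Ω s = 0 := signedDist_of_mem_frontier hs
  -- first order expansion
  have hexp : ∀ ε > 0, ∃ δ > 0, ∀ w : RN N, ‖w‖ < δ →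
      |signedDist Ω (s + w) - inner ℝ G w| ≤ ε * ‖w‖ := by
    intro ε hε
    have h1 := (hasFDerivAt_iff_isLittleO_nhds_zero.1 hd.hasFDerivAt).def hε
    obtain ⟨δ, hδ, h2⟩ := Metric.eventually_nhds_iff_ball.1 h1
    refine ⟨δ, hδ, fun w hw => ?_⟩
    have := h2 w (by simpa using hw)
    rwa [hds, sub_zero, ← inner_gradient, Real.norm_eq_abs] at this
  set ν : RN N := γ⁻¹ • G
  have hν : ‖ν‖ = 1 := by
    simp only [ν, norm_smul, norm_inv, Real.norm_eq_abs, abs_of_pos hγ0, ← hγ]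
    field_simp
  have hGν : inner ℝ G ν = γ := by
    simp only [ν, inner_smul_right, real_inner_self_eq_norm_sq, ← hγ]
    field_simp
  -- the points `s + τ ν` belong to the domain
  have hmain : ∀ ε > 0, ε < γ → (γ - ε ≤ 1 ∧ (γ - ε) * (1 - γ) ≤ 3 * ε) := by
    intro ε hε hεγ
    obtain ⟨δ, hδ, h⟩ := hexp ε hε
    set τ := δ / 4
    have hτ : 0 < τ := by positivity
    have hw : ‖τ • ν‖ = τ := by rw [norm_smul, hν, mul_one, Real.norm_eq_abs, abs_of_pos hτ]
    have h1 := h (τ • ν) (by rw [hw]; simp only [τ]; linarith)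
    rw [inner_smul_right, hGν, hw] at h1
    have hpos : τ * (γ - ε) ≤ signedDist Ω (s + τ • ν) := by linarith [(abs_le.1 h1).1]
    have hpos' : 0 < signedDist Ω (s + τ • ν) :=
      lt_of_lt_of_le (mul_pos hτ (by linarith)) hpos
    have hmem : s + τ • ν ∈ closure Ω := by
      by_contra hn
      exact absurd (signedDist_nonpos hn) (not_le.2 hpos')
    have hdist : signedDist Ω (s + τ • ν) ≤ τ := by
      rw [signedDist_of_mem hmem]
      refine (Metric.infDist_le_dist_of_mem hs).trans ?_
      rw [dist_eq_norm, add_sub_cancel_left, hw]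
    refine ⟨?_, ?_⟩
    · have : τ * (γ - ε) ≤ τ * 1 := by linarith
      exact le_of_mul_le_mul_left this hτ
    -- At the nearest boundary point `y` the distance vanishes, so `⟨G, y - s⟩` is of order `ετ`.
    -- Hence `γρ ≥ ⟨G, s + τν - y⟩ ≥ γτ - 2ετ`, while the expansion gives `ρ ≤ γτ + ετ`. Together
    -- these force `γ ≥ 1` as `ε → 0`.
    obtain ⟨y, hy, hyd⟩ := (isClosed_frontier (s := Ω)).exists_infDist_eq_dist ⟨s, hs⟩ (s + τ • ν)
    rw [← signedDist_of_mem hmem, dist_eq_norm] at hyd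
    set ρ := signedDist Ω (s + τ • ν)
    have hys : ‖y - s‖ ≤ 2 * τ := by
      have : y - s = -(s + τ • ν - y) + τ • ν := by abel
      rw [this]
      refine (norm_add_le _ _).trans ?_
      rw [norm_neg, ← hyd, hw]; linarith
    have h2 := h (y - s) (by simp only [τ] at hys ⊢; linarith)
    rw [add_sub_cancel, signedDist_of_mem_frontier hy, zero_sub, abs_neg] at h2
    have h3 : inner ℝ G (s + τ • ν - y) ≤ γ * ρ := by
      rw [hyd]; exact real_inner_le_norm _ _
    have h4 : inner ℝ G (s + τ • ν - y) = τ * γ - inner ℝ G (y - s) := by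
      rw [← hGν, ← inner_smul_right, ← inner_sub_right]
      congr 1; abel
    have h5 : inner ℝ G (y - s) ≤ ε * (2 * τ) :=
      (le_abs_self _).trans (h2.trans (mul_le_mul_of_nonneg_left hys hε.le))
    have h6 := (abs_le.1 h1).2
    have h7 : ρ * (1 - γ) ≤ 3 * ε * τ := by nlinarith
    rcases le_or_gt γ 1 with hg | hg
    · have h8 : τ * (γ - ε) * (1 - γ) ≤ 3 * ε * τ :=
        (mul_le_mul_of_nonneg_right hpos (by linarith)).trans h7
      have : τ * ((γ - ε) * (1 - γ)) ≤ τ * (3 * ε) := by linarith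
      exact le_of_mul_le_mul_left this hτ
    · nlinarith
  rw [hγe]
  refine le_antisymm ?_ ?_
  · by_contra hlt
    have hlt := not_le.1 hlt
    have := (hmain ((γ - 1) / 2) (by linarith) (by linarith)).1
    linarith
  · by_contra hlt
    have hlt := not_le.1 hlt
    -- With this `ε` and `γ < 1` one has `(γ - ε)(1 - γ) ≥ 7γ(1 - γ)/8 > 3ε`.
    have hε : 0 < γ * (1 - γ) / 8 := by
      have : 0 < 1 - γ := by linarith
      positivity
    have := (hmain (γ * (1 - γ) / 8) hε (by nlinarith)).2
    nlinarith [mul_pos hγ0 (sub_pos.2 hlt)]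

end SignedDistance

end CensoredNeumann

end


/-! ### Local defining functions of the domain and the volume of boundary layers. -/

noncomputable section

namespace CensoredNeumann

open Set Filter Topology MeasureTheory

/-- A function describing `closure Ω` near the point `x₀`: the signed distance when `x₀` is on the
boundary, and the constant `1` when `x₀` is an interior point. -/
structure IsDefiningAt {N : ℕ} (Ω : Set (RN N)) (j : RN N → RN N → RN N) (x₀ : RN N)
    (D : RN N → ℝ) (r C : ℝ) : Prop where
  r_pos : 0 < r
  C_nonneg : 0 ≤ C
  meas : Measurable D
  diff : ∀ x ∈ Metric.ball x₀ r, DifferentiableAt ℝ D x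
  lip : ∀ x ∈ Metric.ball x₀ r, ∀ y ∈ Metric.ball x₀ r,
    ‖fderiv ℝ D x - fderiv ℝ D y‖ ≤ C * ‖x - y‖
  norm_le : ∀ x ∈ Metric.ball x₀ r, ‖fderiv ℝ D x‖ ≤ 2
  nonneg : ∀ x ∈ closure Ω, 0 ≤ D x
  lip_closure : ∀ x ∈ closure Ω, ∀ y ∈ closure Ω, |D x - D y| ≤ ‖x - y‖
  zero : ∀ x ∈ Metric.ball x₀ r, x ∈ frontier Ω → D x = 0
  normal : ∀ x ∈ Metric.ball x₀ r, x ∈ frontier Ω → outerNormal Ω x = -gradient D x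
  half_le : ∀ x ∈ Metric.ball x₀ r, x ∈ frontier Ω → 1 / 2 ≤ ‖gradient D x‖
  nonpos : ∀ x ∈ Metric.ball x₀ r, x ∉ closure Ω → D x ≤ 0
  layer : ∀ x ∈ Metric.ball x₀ r, x ∈ closure Ω → ∀ ρ h, 0 < ρ → ρ < r → 0 ≤ h → h < r →
    volume {z : RN N | ‖z‖ ≤ ρ ∧ |D (x + j x z)| ≤ h} ≤ ENNReal.ofReal (C * h * ρ ^ (N - 1))

section Existence

variable {N : ℕ} {Ω : Set (RN N)} {μ : RN N → Measure (RN N)} {j : RN N → RN N → RN N}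
  {σ Cj : ℝ}

lemma measurable_signedDist : Measurable (signedDist Ω) := by
  unfold signedDist
  exact Measurable.ite isClosed_closure.measurableSet (Metric.continuous_infDist_pt _).measurable
    (Metric.continuous_infDist_pt _).measurable.neg

lemma fderiv_component {f : RN N → RN N} {x : RN N} (h : DifferentiableAt ℝ f x) (i : Fin N) :
    HasFDerivAt (fun y => f y i) ((EuclideanSpace.proj i : RN N →L[ℝ] ℝ).comp (fderiv ℝ f x)) x :=
  (EuclideanSpace.proj i : RN N →L[ℝ] ℝ).hasFDerivAt.comp x h.hasFDerivAt

lemma norm_proj_le (i : Fin N) : ‖(EuclideanSpace.proj i : RN N →L[ℝ] ℝ)‖ ≤ 1 :=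
  ContinuousLinearMap.opNorm_le_bound _ zero_le_one fun x => by
    rw [one_mul]; exact PiLp.norm_apply_le x i

-- The landing map `z ↦ x + j x z` has a Lipschitz inverse by (J0), so volumes of sets of jumps are
-- controlled by volumes of the sets of landing points.
include σ μ Cj in
lemma JumpKernel.layer_of_layer (J : JumpKernel Ω μ j σ Cj) {D : RN N → ℝ} {x : RN N}
    (hx : x ∈ closure Ω) {ρ h B : ℝ}
    (hB : volume {w : RN N | ‖w - x‖ ≤ Cj * ρ ∧ |D w| ≤ h} ≤ ENNReal.ofReal B) :
    volume {z : RN N | ‖z‖ ≤ ρ ∧ |D (x + j x z)| ≤ h} ≤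
      ENNReal.ofReal (J.invBound ^ N * B) := by
  have hA : 0 ≤ J.invBound := (norm_nonneg _).trans (J.fderiv_inv_le x hx 0)
  have hlip : LipschitzWith ⟨J.invBound, hA⟩ (J.inv x) :=
    lipschitzWith_of_nnnorm_fderiv_le
      ((J.contDiff_inv x hx).differentiable one_ne_zero) fun w => J.fderiv_inv_le x hx w
  have hlip2 : LipschitzWith ⟨J.invBound, hA⟩ (fun w => J.inv x (w - x)) := by
    refine LipschitzWith.of_dist_le_mul fun w w' => ?_
    have := hlip.dist_le_mul (w - x) (w' - x)
    rwa [dist_sub_right] at this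
  have hsub : {z : RN N | ‖z‖ ≤ ρ ∧ |D (x + j x z)| ≤ h} ⊆
      (fun w => J.inv x (w - x)) '' {w : RN N | ‖w - x‖ ≤ Cj * ρ ∧ |D w| ≤ h} := by
    rintro z ⟨h1, h2⟩
    refine ⟨x + j x z, ⟨?_, h2⟩, ?_⟩
    · rw [add_sub_cancel_left]
      exact (J.le_up x hx z).trans (mul_le_mul_of_nonneg_left h1 J.Cj_pos.le)
    · simp only [add_sub_cancel_left]
      exact J.left_inv x hx z
  refine (measure_mono hsub).trans ?_
  refine (volume_image_le_of_lipschitzOnWith (hlip2.lipschitzOnWith (s := _))).trans ?_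
  rw [ENNReal.ofReal_mul (pow_nonneg hA N), ENNReal.ofReal_pow hA]
  refine mul_le_mul' (le_of_eq ?_) hB
  congr 1
  rw [ENNReal.ofReal_eq_coe_nnreal hA]
  rfl

/-- The boundary conditions are vacuous in a ball inside `Ω`, and with radius at most `1` the layers
`|1| ≤ h`, `h < r`, are empty. -/
lemma exists_isDefiningAt_interior (hΩ : IsOpen Ω) {x₀ : RN N} (hx₀ : x₀ ∈ Ω) :
    ∃ r C, IsDefiningAt Ω j x₀ (fun _ => 1) r C := by
  obtain ⟨r, hr, hb⟩ := Metric.isOpen_iff.1 hΩ x₀ hx₀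
  have hf : ∀ x ∈ Metric.ball x₀ r, x ∉ frontier Ω := fun x hx hxf => by
    rw [hΩ.frontier_eq] at hxf
    exact hxf.2 (hb hx)
  have hmin : Metric.ball x₀ (min r 1) ⊆ Metric.ball x₀ r := Metric.ball_subset_ball (min_le_left _ _)
  refine ⟨min r 1, 0, ⟨lt_min hr one_pos, le_rfl, measurable_const, fun _ _ => differentiableAt_const _, ?_, ?_, ?_,
    ?_, fun x hx h => absurd h (hf x (hmin hx)), fun x hx h => absurd h (hf x (hmin hx)),
    fun x hx h => absurd h (hf x (hmin hx)),
    fun x hx h => absurd (subset_closure (hb (hmin hx))) h, ?_⟩⟩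
  · intro x _ y _; simp
  · intro x _; simp
  · intro x _; exact zero_le_one
  · intro x _ y _; simp
  · intro x _ _ ρ h _ _ _ hh
    have : {z : RN N | ‖z‖ ≤ ρ ∧ |(1 : ℝ)| ≤ h} = ∅ := by
      ext z
      simp only [abs_one, mem_ofPred_eq, mem_empty_iff_false, iff_false, not_and, not_le]
      intro _
      exact hh.trans_le (min_le_right _ _)
    rw [this]; simp

/-- Differentiating `ψ ∘ ψ.symm = id` shows that the derivative of `ψ` is surjective, so none of its
components vanishes. -/
lemma fderiv_component_ne_zero {ψ : OpenPartialHomeomorph (RN N) (RN N)} {x : RN N}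
    (hx : x ∈ ψ.source) (h1 : DifferentiableAt ℝ ψ x) (h2 : DifferentiableAt ℝ ψ.symm (ψ x))
    (i : Fin N) : (EuclideanSpace.proj i : RN N →L[ℝ] ℝ).comp (fderiv ℝ ψ x) ≠ 0 := by
  intro h0
  have hcomp : HasFDerivAt (fun y => ψ (ψ.symm y))
      ((fderiv ℝ ψ x).comp (fderiv ℝ ψ.symm (ψ x))) (ψ x) := by
    have h3 : HasFDerivAt ψ (fderiv ℝ ψ x) (ψ.symm (ψ x)) := by
      rw [ψ.left_inv hx]; exact h1.hasFDerivAt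
    exact h3.comp (ψ x) h2.hasFDerivAt
  have hid : HasFDerivAt (fun y : RN N => y) ((fderiv ℝ ψ x).comp (fderiv ℝ ψ.symm (ψ x)))
      (ψ x) := by
    refine hcomp.congr_of_eventuallyEq ?_
    filter_upwards [ψ.open_target.mem_nhds (ψ.map_source hx)] with y hy
    exact (ψ.right_inv hy).symm
  have heq := hid.unique (hasFDerivAt_id (𝕜 := ℝ) (ψ x))
  have h4 := congrArg (fun L : RN N →L[ℝ] RN N =>
    (EuclideanSpace.proj i : RN N →L[ℝ] ℝ) (L (EuclideanSpace.single i 1))) heq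
  have h5 := DFunLike.congr_fun h0 (fderiv ℝ ψ.symm (ψ x) (EuclideanSpace.single i 1))
  simp at h4 h5
  rw [h5] at h4
  exact zero_ne_one h4

/-- The chart flattens the layer: since its last component is the signed distance, `{|d| ≤ h}`
becomes a slab of thickness `2h`, and the Lipschitz inverse chart carries the slab estimate back. -/
lemma exists_isDefiningAt_boundary [NeZero N] (J : JumpKernel Ω μ j σ Cj) (hO : AssumptionO Ω)
    {x₀ : RN N} (hx₀ : x₀ ∈ frontier Ω) :
    ∃ r C, IsDefiningAt Ω j x₀ (signedDist Ω) r C := by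
  obtain ⟨r₀, hr₀, ψ, hsrc, ⟨hd1, K1, hK1⟩, ⟨hd2, K2, hK2⟩, hψ⟩ := hO x₀ hx₀
  rw [hsrc] at hd1 hK1
  set i₀ : Fin N := Fin.rev 0
  set P : RN N →L[ℝ] ℝ := EuclideanSpace.proj i₀
  have hx₀s : x₀ ∈ ψ.source := by rw [hsrc]; exact Metric.mem_ball_self hr₀
  obtain ⟨B1, hB1⟩ := lipschitzOnWith_of_fderiv_lipschitz hd1 hK1
  -- The target of `ψ` need not be convex, so the Lipschitz bound for the inverse is taken on a ball
  -- inside it.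
  obtain ⟨ρ₁, hρ₁, hb1⟩ := Metric.isOpen_iff.1 ψ.open_target (ψ x₀) (ψ.map_source hx₀s)
  obtain ⟨B2, hB2⟩ := lipschitzOnWith_of_fderiv_lipschitz (hd2.mono hb1) (hK2.mono hb1)
  -- derivative of the signed distance
  have hder : ∀ x ∈ Metric.ball x₀ r₀,
      HasFDerivAt (signedDist Ω) (P.comp (fderiv ℝ ψ x)) x := by
    intro x hx
    have h1 := fderiv_component (hd1.differentiableAt (Metric.isOpen_ball.mem_nhds hx)) i₀
    refine h1.congr_of_eventuallyEq ?_
    filter_upwards [Metric.isOpen_ball.mem_nhds hx] with y hy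
    exact (hψ y hy).symm
  have hfd : ∀ x ∈ Metric.ball x₀ r₀, fderiv ℝ (signedDist Ω) x = P.comp (fderiv ℝ ψ x) :=
    fun x hx => (hder x hx).fderiv
  have hlipd : ∀ x ∈ Metric.ball x₀ r₀, ∀ y ∈ Metric.ball x₀ r₀,
      ‖fderiv ℝ (signedDist Ω) x - fderiv ℝ (signedDist Ω) y‖ ≤ K1 * ‖x - y‖ := by
    intro x hx y hy
    rw [hfd x hx, hfd y hy, ← ContinuousLinearMap.comp_sub]
    refine (ContinuousLinearMap.opNorm_comp_le _ _).trans ?_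
    have h1 := hK1.dist_le_mul x hx y hy
    rw [dist_eq_norm, dist_eq_norm] at h1
    calc ‖P‖ * ‖fderiv ℝ ψ x - fderiv ℝ ψ y‖ ≤ 1 * ‖fderiv ℝ ψ x - fderiv ℝ ψ y‖ :=
          mul_le_mul_of_nonneg_right (norm_proj_le i₀) (norm_nonneg _)
      _ ≤ _ := by rwa [one_mul]
  have hx₀b := Metric.mem_ball_self (x := x₀) hr₀
  have hne : fderiv ℝ (signedDist Ω) x₀ ≠ 0 := by
    rw [hfd x₀ hx₀b]
    exact fderiv_component_ne_zero hx₀s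
      (hd1.differentiableAt (Metric.isOpen_ball.mem_nhds hx₀b))
      (hd2.differentiableAt (ψ.open_target.mem_nhds (ψ.map_source hx₀s))) i₀
  have hone := norm_fderiv_signedDist hx₀ (hder x₀ hx₀b).differentiableAt hne
  have hCj := J.Cj_pos
  -- choice of the radius
  obtain ⟨r, hr, hrr₀, hrB, hrK, hrC⟩ : ∃ r : ℝ, 0 < r ∧ r ≤ r₀ ∧ B1 * (r + Cj * r) < ρ₁ ∧
      K1 * r ≤ 1 / 2 ∧ r + Cj * r < r₀ := by
    have hev : ∀ᶠ r : ℝ in 𝓝[>] 0, r ≤ r₀ ∧ B1 * (r + Cj * r) < ρ₁ ∧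
        K1 * r ≤ 1 / 2 ∧ r + Cj * r < r₀ := by
      refine nhdsWithin_le_nhds ?_
      have c1 : Continuous fun r : ℝ => (B1 : ℝ) * (r + Cj * r) := by fun_prop
      have c2 : Continuous fun r : ℝ => (K1 : ℝ) * r := by fun_prop
      have c3 : Continuous fun r : ℝ => r + Cj * r := by fun_prop
      filter_upwards [Iic_mem_nhds hr₀,
        c1.continuousAt.eventually_lt_const (show _ < ρ₁ by simpa using hρ₁),
        c2.continuousAt.eventually_lt_const (show _ < (1 / 2 : ℝ) by simp),
        c3.continuousAt.eventually_lt_const (show _ < r₀ by simpa using hr₀)] with r h1 h2 h3 h4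
      exact ⟨h1, h2, h3.le, h4⟩
    obtain ⟨r, h1, h2⟩ := (hev.and self_mem_nhdsWithin).exists
    exact ⟨r, h2, h1⟩
  have hball : Metric.ball x₀ r ⊆ Metric.ball x₀ r₀ := Metric.ball_subset_ball hrr₀
  have hnear : ∀ x ∈ Metric.ball x₀ r,
      |‖fderiv ℝ (signedDist Ω) x‖ - 1| ≤ 1 / 2 := by
    intro x hx
    have h1 := abs_norm_sub_norm_le (fderiv ℝ (signedDist Ω) x) (fderiv ℝ (signedDist Ω) x₀)
    rw [hone] at h1
    refine h1.trans ((hlipd x (hball hx) x₀ hx₀b).trans ?_)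
    refine le_trans (mul_le_mul_of_nonneg_left ?_ K1.2) hrK
    rw [← dist_eq_norm]; exact le_of_lt hx
  have hA : 0 ≤ J.invBound :=
    (norm_nonneg _).trans (J.fderiv_inv_le x₀ (frontier_subset_closure hx₀) 0)
  -- The factors come from inverting the jump map, inverting the chart, and the slab volume with the
  -- powers of `ρ` and `h` removed.
  set L : ℝ := J.invBound ^ N * (B2 ^ N * ((2 * (B1 * Cj)) ^ (N - 1) * 2)) with hL
  have hL0 : 0 ≤ L := by positivity
  refine ⟨r, K1 + L, ⟨hr, by positivity, measurable_signedDist, fun x hx => (hder x (hball hx)).differentiableAt,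
    fun x hx y hy => (hlipd x (hball hx) y (hball hy)).trans
      (mul_le_mul_of_nonneg_right (by linarith) (norm_nonneg _)), ?_,
    fun x hx => signedDist_nonneg hx, fun x hx y hy => signedDist_lip hx hy,
    fun x _ hxf => signedDist_of_mem_frontier hxf, fun x _ _ => rfl, ?_,
    fun x _ hxn => signedDist_nonpos hxn, ?_⟩⟩
  · intro x hx
    linarith [(abs_le.1 (hnear x hx)).2]
  · intro x hx _
    rw [norm_gradient]
    linarith [(abs_le.1 (hnear x hx)).1]
  · intro x hx hxc ρ h hρ hρr hh hhr
    have hball2 : ∀ w : RN N, ‖w - x‖ ≤ Cj * ρ → ‖w - x₀‖ < r + Cj * r := by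
      intro w hw
      have h1 : ‖w - x₀‖ ≤ ‖w - x‖ + ‖x - x₀‖ := norm_sub_le_norm_sub_add_norm_sub _ _ _
      have h2 : ‖x - x₀‖ < r := by rw [← dist_eq_norm]; exact hx
      have h3 : Cj * ρ ≤ Cj * r := mul_le_mul_of_nonneg_left hρr.le hCj.le
      linarith
    have hlayer : volume {w : RN N | ‖w - x‖ ≤ Cj * ρ ∧ |signedDist Ω w| ≤ h} ≤
        ENNReal.ofReal (B2 ^ N * ((2 * (B1 * (Cj * ρ))) ^ (N - 1) * (2 * h))) := by
      have hsub : {w : RN N | ‖w - x‖ ≤ Cj * ρ ∧ |signedDist Ω w| ≤ h} ⊆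
          ψ.symm '' (Metric.ball (ψ x₀) ρ₁ ∩
            {y : RN N | ‖y - ψ x‖ ≤ B1 * (Cj * ρ) ∧ |y i₀| ≤ h}) := by
        rintro w ⟨h1, h2⟩
        have hwb : w ∈ Metric.ball x₀ r₀ := by
          rw [Metric.mem_ball, dist_eq_norm]; exact (hball2 w h1).trans hrC
        refine ⟨ψ w, ⟨?_, ?_, ?_⟩, ψ.left_inv (by rw [hsrc]; exact hwb)⟩
        · have h3 := hB1.dist_le_mul w hwb x₀ hx₀b
          rw [Metric.mem_ball]
          refine lt_of_le_of_lt (h3.trans (mul_le_mul_of_nonneg_left ?_ B1.2)) hrB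
          rw [dist_eq_norm]; exact (hball2 w h1).le
        · have h3 := hB1.dist_le_mul w hwb x (hball hx)
          rw [dist_eq_norm, dist_eq_norm] at h3
          exact h3.trans (mul_le_mul_of_nonneg_left h1 B1.2)
        · rw [hψ w hwb]; exact h2
      refine (measure_mono hsub).trans ((volume_image_le_of_lipschitzOnWith
        (hB2.mono inter_subset_left)).trans ?_)
      rw [ENNReal.ofReal_mul (by positivity), ENNReal.ofReal_pow (NNReal.coe_nonneg B2), ENNReal.ofReal_coe_nnreal]
      refine mul_le_mul_right ((measure_mono inter_subset_right).trans
        (volume_slab_le (ψ x) i₀ (by positivity) hh)) _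
    refine (J.layer_of_layer hxc hlayer).trans (ENNReal.ofReal_le_ofReal ?_)
    have e : J.invBound ^ N * (B2 ^ N * ((2 * (B1 * (Cj * ρ))) ^ (N - 1) * (2 * h))) =
        L * h * ρ ^ (N - 1) := by
      rw [hL, show 2 * ((B1 : ℝ) * (Cj * ρ)) = (2 * (B1 * Cj)) * ρ by ring, mul_pow]
      ring
    rw [e]
    have h1 : 0 ≤ h * ρ ^ (N - 1) := by positivity
    nlinarith [mul_nonneg K1.2 h1]

theorem exists_isDefiningAt [NeZero N] (J : JumpKernel Ω μ j σ Cj) (hΩ : IsOpen Ω)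
    (hO : AssumptionO Ω) {x₀ : RN N} (hx₀ : x₀ ∈ closure Ω) :
    ∃ D r C, IsDefiningAt Ω j x₀ D r C ∧ (x₀ ∈ Ω → D = fun _ => 1) := by
  by_cases h : x₀ ∈ Ω
  · obtain ⟨r, C, h1⟩ := exists_isDefiningAt_interior (j := j) hΩ h
    exact ⟨_, r, C, h1, fun _ => rfl⟩
  · obtain ⟨r, C, h1⟩ := exists_isDefiningAt_boundary J hO (x₀ := x₀)
      (by rw [hΩ.frontier_eq]; exact ⟨hx₀, h⟩)
    exact ⟨_, r, C, h1, fun h2 => absurd h2 h⟩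

end Existence

end CensoredNeumann

end


/-! ### First moment of the kernel over thin layers. -/

noncomputable section

namespace CensoredNeumann

open Set Filter Topology MeasureTheory

section LayerIntegral

variable {N : ℕ} {Ω : Set (RN N)} {μ : RN N → Measure (RN N)} {j : RN N → RN N → RN N}
  {σ Cj : ℝ}

/-- As `N + σ > 1`, the weight `|z|^(1-N-σ)` decreases radially, so its superlevel sets are
punctured balls. -/
lemma lt_norm_mul_kern_iff [NeZero N] (hσ : 0 < σ) {s : ℝ} (hs : 0 < s) {z : RN N} (hz : z ≠ 0) :
    s < ‖z‖ * kern σ z ↔ ‖z‖ < s ^ (-((N : ℝ) + σ - 1))⁻¹ := by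
  have hN : (1 : ℝ) ≤ N := by exact_mod_cast Nat.one_le_iff_ne_zero.mpr (NeZero.ne N)
  have hz0 := norm_pos_iff.2 hz
  have h1 : ‖z‖ * kern σ z = ‖z‖ ^ ((-((N : ℝ) + σ - 1))⁻¹)⁻¹ := by
    unfold kern
    rw [inv_inv]
    nth_rewrite 1 [← Real.rpow_one ‖z‖]
    rw [← Real.rpow_add hz0]
    ring_nf
  rw [h1]
  exact Real.lt_rpow_inv_iff_of_neg hs hz0 (inv_lt_zero.2 (by linarith))

/-- Integral of the first moment of the kernel over thin layers around the zero set. -/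
lemma lintegral_layer_le [NeZero N] (hσ : 0 < σ) {D : RN N → ℝ} {r C : ℝ} {x₀ : RN N}
    (hD : IsDefiningAt Ω j x₀ D r C) {r₀ : ℝ} (hr₀ : 0 < r₀) (hr₀r : r₀ < r) {x : RN N}
    (hx : x ∈ Metric.ball x₀ r) (hxc : x ∈ closure Ω) {a : ℝ} (ha : 0 ≤ a) (ha1 : a ≤ 1) :
    ∫⁻ z in {z : RN N | ‖z‖ < r₀ ∧ |D (x + j x z)| ≤ a * ‖z‖},
        ENNReal.ofReal (‖z‖ * kern σ z) ≤
      ENNReal.ofReal (C * a) / volume (Metric.ball (0 : RN N) 1) *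
        ∫⁻ z in {z : RN N | ‖z‖ < r₀}, ENNReal.ofReal (‖z‖ * kern σ z) := by
  have hN : 1 ≤ N := Nat.one_le_iff_ne_zero.mpr (NeZero.ne N)
  have hnn : ∀ z : RN N, 0 ≤ ‖z‖ * kern σ z := fun z => mul_nonneg (norm_nonneg _) (kern_nonneg z)
  have hm : Measurable fun z : RN N => ‖z‖ * kern σ z := measurable_norm.mul measurable_kern
  set v := volume (Metric.ball (0 : RN N) 1) with hv
  have hv0 : v ≠ 0 := (Metric.measure_ball_pos volume _ one_pos).ne'
  have hvt : v ≠ ⊤ := measure_ball_lt_top.ne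
  have hcne : ENNReal.ofReal (C * a) / v ≠ ⊤ := ENNReal.div_ne_top ENNReal.ofReal_ne_top hv0
  -- Layer-cake formula: it suffices to compare, at each level, the superlevel set inside the layer
  -- with the superlevel set inside the ball. Both live in a ball of radius `ρ`, where `|D| ≤ a|z|`
  -- implies `|D| ≤ aρ`; the layer bound gives volume `Caρ^N`, a fixed fraction of the volume of
  -- that ball.
  rw [lintegral_eq_lintegral_meas_lt _ (ae_of_all _ hnn) hm.aemeasurable,
    lintegral_eq_lintegral_meas_lt _ (ae_of_all _ hnn) hm.aemeasurable,
    ← lintegral_const_mul' _ _ hcne]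
  refine setLIntegral_mono' measurableSet_Ioi fun s hs => ?_
  have hs0 : 0 < s := hs
  have hms : MeasurableSet {z : RN N | s < ‖z‖ * kern σ z} := measurableSet_lt measurable_const hm
  rw [Measure.restrict_apply hms, Measure.restrict_apply hms]
  set q : ℝ := s ^ (-((N : ℝ) + σ - 1))⁻¹
  have hq : 0 < q := Real.rpow_pos_of_pos hs0 _
  set ρ := min q r₀
  have hρ : 0 < ρ := lt_min hq hr₀
  have hρr : ρ < r := (min_le_right _ _).trans_lt hr₀r
  have hr0 := hD.r_pos
  have h0 : ¬ s < ‖(0 : RN N)‖ * kern σ (0 : RN N) := by simp [hs0.le]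
  have h1 : volume ({z : RN N | s < ‖z‖ * kern σ z} ∩
      {z : RN N | ‖z‖ < r₀ ∧ |D (x + j x z)| ≤ a * ‖z‖}) ≤ ENNReal.ofReal (C * a * ρ ^ N) := by
    have haρ : a * ρ < r := lt_of_le_of_lt (by nlinarith) hρr
    refine le_trans (measure_mono ?_) ((hD.layer x hx hxc ρ (a * ρ) hρ hρr
      (by positivity) haρ).trans (ENNReal.ofReal_le_ofReal ?_))
    · rintro z ⟨hz1, hz2, hz3⟩
      have hz0 : z ≠ 0 := fun h => h0 (h ▸ hz1)
      have hzρ : ‖z‖ ≤ ρ := le_min ((lt_norm_mul_kern_iff hσ hs0 hz0).1 hz1).le hz2.le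
      exact ⟨hzρ, hz3.trans (mul_le_mul_of_nonneg_left hzρ ha)⟩
    · have : ρ ^ N = ρ * ρ ^ (N - 1) := by
        rw [← pow_succ']; congr 1; omega
      rw [this]
      exact le_of_eq (by ring)
  have h2 : ENNReal.ofReal (ρ ^ N) * v ≤ volume ({z : RN N | s < ‖z‖ * kern σ z} ∩
      {z : RN N | ‖z‖ < r₀}) := by
    have h3 : volume (Metric.ball (0 : RN N) ρ) = ENNReal.ofReal (ρ ^ N) * v := by
      rw [Measure.addHaar_ball _ _ hρ.le]
      simp
      rfl
    rw [← h3, ← measure_sdiff_null (measure_singleton (0 : RN N))]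
    refine measure_mono fun z hz => ?_
    have hz0 : z ≠ 0 := fun h => hz.2 h
    have hzρ : ‖z‖ < ρ := by simpa using hz.1
    exact ⟨(lt_norm_mul_kern_iff hσ hs0 hz0).2 (hzρ.trans_le (min_le_left _ _)),
      hzρ.trans_le (min_le_right _ _)⟩
  refine h1.trans ?_
  rw [ENNReal.ofReal_mul (mul_nonneg hD.C_nonneg ha)]
  calc ENNReal.ofReal (C * a) * ENNReal.ofReal (ρ ^ N)
      = ENNReal.ofReal (C * a) / v * (ENNReal.ofReal (ρ ^ N) * v) := by
        rw [mul_comm (ENNReal.ofReal (ρ ^ N)), ← mul_assoc, ENNReal.div_mul_cancel hv0 hvt]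
    _ ≤ _ := mul_le_mul_right h2 _

/-- Linear dependence on the opening `a`, uniformly in the base point: this is the rate used for
mismatched jumps away from the innermost ball. -/
lemma exists_integral_layer_le [NeZero N] (J : JumpKernel Ω μ j σ Cj) {D : RN N → ℝ} {r C : ℝ}
    {x₀ : RN N} (hD : IsDefiningAt Ω j x₀ D r C) {r₀ : ℝ} (hr₀ : 0 < r₀) (hr₀r : r₀ < r) :
    ∃ C' : ℝ, 0 ≤ C' ∧ ∀ x ∈ Metric.ball x₀ r, x ∈ closure Ω → ∀ a, 0 ≤ a → a ≤ 1 →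
      ∫ z, {z : RN N | ‖z‖ < r₀ ∧ |D (x + j x z)| ≤ a * ‖z‖}.indicator (fun z => ‖z‖) z *
        kern σ z ≤ C' * a := by
  set v := volume (Metric.ball (0 : RN N) 1) with hv
  have hv0 : v ≠ 0 := (Metric.measure_ball_pos volume _ one_pos).ne'
  have hnn : ∀ z : RN N, 0 ≤ ‖z‖ * kern σ z := fun z => mul_nonneg (norm_nonneg _) (kern_nonneg z)
  have hm : Measurable fun z : RN N => ‖z‖ * kern σ z := measurable_norm.mul measurable_kern
  have hmove : ∀ S : Set (RN N), MeasurableSet S →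
      ∫ z, S.indicator (fun z => ‖z‖) z * kern σ z =
        (∫⁻ z in S, ENNReal.ofReal (‖z‖ * kern σ z)).toReal := by
    intro S hS
    rw [← integral_eq_lintegral_of_nonneg_ae (ae_of_all _ hnn) hm.aestronglyMeasurable,
      ← integral_indicator hS]
    congr 1
    ext z
    by_cases hz : z ∈ S <;> simp [hz]
  have hball : MeasurableSet {z : RN N | ‖z‖ < r₀} := measurableSet_lt measurable_norm measurable_const
  have hfin : ∫⁻ z in {z : RN N | ‖z‖ < r₀}, ENNReal.ofReal (‖z‖ * kern σ z) ≠ ⊤ := by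
    have h1 : Integrable (fun z : RN N => ‖z‖ * kern σ z)
        (volume.restrict {z : RN N | ‖z‖ < r₀}) := by
      rw [← IntegrableOn, ← integrable_indicator_iff hball]
      refine (integrable_indicator_norm_mul_kern J.σ_pos J.σ_lt_one r₀).congr
        (ae_of_all _ fun z => ?_)
      by_cases hz : z ∈ {z : RN N | ‖z‖ < r₀}
      · simp only [indicator_of_mem hz]
      · simp only [indicator_of_notMem hz, zero_mul]
    have h2 := h1.2
    rw [hasFiniteIntegral_iff_ofReal (ae_of_all _ hnn)] at h2
    exact h2.ne
  refine ⟨C / v.toReal * ballMoment N σ r₀, mul_nonneg (div_nonneg hD.C_nonneg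
    ENNReal.toReal_nonneg) (ballMoment_nonneg _), fun x hx hxc a ha ha1 => ?_⟩
  have hS : MeasurableSet {z : RN N | ‖z‖ < r₀ ∧ |D (x + j x z)| ≤ a * ‖z‖} := by
    refine hball.inter (measurableSet_le ?_ (measurable_norm.const_mul a))
    exact (hD.meas.comp ((J.measurable_j hxc).const_add x)).abs
  rw [hmove _ hS, ballMoment, hmove _ hball]
  have h := lintegral_layer_le J.σ_pos hD hr₀ hr₀r hx hxc ha ha1
  have h2 := ENNReal.toReal_mono (ENNReal.mul_ne_top
    (ENNReal.div_ne_top ENNReal.ofReal_ne_top hv0) hfin) h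
  refine h2.trans (le_of_eq ?_)
  rw [ENNReal.toReal_mul, ENNReal.toReal_div,
    ENNReal.toReal_ofReal (mul_nonneg hD.C_nonneg ha)]
  ring

end LayerIntegral

/-! ### The boundary is negligible for the jumps; normal derivatives at boundary maxima. -/

section Frontier

variable {N : ℕ} {Ω : Set (RN N)} {μ : RN N → Measure (RN N)} {j : RN N → RN N → RN N}
  {σ Cj : ℝ}

/-- The layer estimate with `h = 0` shows that the jumps from `s` landing in `{D = 0}` form a null
set. Its image under the differentiable landing map is null as well, and by (J1) it covers the
boundary near `s`. -/
lemma volume_frontier [NeZero N] (J : JumpKernel Ω μ j σ Cj) (hΩ : IsOpen Ω)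
    (hO : AssumptionO Ω) : volume (frontier Ω) = 0 := by
  refine measure_null_of_locally_null _ fun s hs => ?_
  have hsc := frontier_subset_closure hs
  obtain ⟨D, r, C, hD, -⟩ := exists_isDefiningAt J hΩ hO hsc
  have hr := hD.r_pos
  have hlow := J.low_pos
  set ε := min r (J.low * (r / 2))
  have hε : 0 < ε := lt_min hr (by positivity)
  refine ⟨Metric.ball s ε ∩ frontier Ω, ?_, ?_⟩
  · exact inter_mem (nhdsWithin_le_nhds (Metric.ball_mem_nhds s hε)) self_mem_nhdsWithin
  have hnull : volume {z : RN N | ‖z‖ ≤ r / 2 ∧ |D (s + j s z)| ≤ 0} = 0 := by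
    have := hD.layer s (Metric.mem_ball_self hr) hsc (r / 2) 0 (by linarith) (by linarith) le_rfl hr
    simpa using this
  have him := addHaar_image_eq_zero_of_differentiableOn_of_addHaar_eq_zero (volume)
    (f := fun z => s + j s z) (s := {z : RN N | ‖z‖ ≤ r / 2 ∧ |D (s + j s z)| ≤ 0})
    ((((J.contDiff s hsc).differentiable one_ne_zero).const_add s).differentiableOn) hnull
  refine measure_mono_null ?_ him
  rintro w ⟨hw1, hw2⟩
  have hj : j s (J.inv s (w - s)) = w - s := J.right_inv s hsc _
  have hws : ‖w - s‖ < ε := by rw [← dist_eq_norm]; exact hw1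
  refine ⟨J.inv s (w - s), ⟨?_, ?_⟩, ?_⟩
  · have h1 := J.low_le s hsc (J.inv s (w - s))
    rw [hj] at h1
    have h2 : J.low * ‖J.inv s (w - s)‖ ≤ J.low * (r / 2) :=
      h1.trans (hws.le.trans (min_le_right _ _))
    exact le_of_mul_le_mul_left h2 hlow
  · rw [hj, add_sub_cancel, hD.zero w (Metric.ball_subset_ball (min_le_left _ _) hw1) hw2, abs_zero]
  · simp only [hj, add_sub_cancel]

/-- Almost every jump lands either in `Ω` or off `closure Ω`, so its admissibility does not change
under small perturbations of the base point. -/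
lemma ae_notMem_frontier [NeZero N] (J : JumpKernel Ω μ j σ Cj) (hΩ : IsOpen Ω)
    (hO : AssumptionO Ω) {x : RN N} (hx : x ∈ closure Ω) :
    ∀ᵐ z : RN N, x + j x z ∉ frontier Ω := by
  have h1 : volume ((fun z => -x + z) '' frontier Ω) = 0 := by
    rw [image_add_left, measure_preimage_add]; exact volume_frontier J hΩ hO
  have h2 := addHaar_image_eq_zero_of_differentiableOn_of_addHaar_eq_zero volume
    (f := J.inv x) (((J.contDiff_inv x hx).differentiable one_ne_zero).differentiableOn) h1
  rw [ae_iff]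
  refine measure_mono_null (fun z hz => ?_) h2
  simp only [not_not, mem_ofPred_eq] at hz
  exact ⟨j x z, ⟨x + j x z, hz, by simp⟩, J.left_inv x hx z⟩

lemma nonpos_of_hasDerivAt_of_eventually_le {g : ℝ → ℝ} {g' : ℝ} (h : HasDerivAt g g' 0)
    (hle : ∀ᶠ s in 𝓝[>] (0 : ℝ), g s ≤ g 0) : g' ≤ 0 := by
  have h1 := (hasDerivWithinAt_iff_tendsto_slope' (by simp)).1 (h.hasDerivWithinAt (s := Ioi 0))
  refine le_of_tendsto h1 ?_
  filter_upwards [hle, self_mem_nhdsWithin] with s hs hs0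
  rw [slope_def_field]
  exact div_nonpos_of_nonpos_of_nonneg (by linarith) (by simpa using le_of_lt (show 0 < s from hs0))

lemma eventually_lt_of_hasDerivAt_pos {g : ℝ → ℝ} {g' : ℝ} (h : HasDerivAt g g' 0)
    (hg' : 0 < g') : ∀ᶠ s in 𝓝[>] (0 : ℝ), g 0 < g s := by
  have h1 := (hasDerivWithinAt_iff_tendsto_slope' (by simp)).1 (h.hasDerivWithinAt (s := Ioi 0))
  filter_upwards [h1.eventually (lt_mem_nhds hg'), self_mem_nhdsWithin] with s hs hs0
  rw [slope_def_field, sub_zero] at hs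
  have := (div_pos_iff_of_pos_right (show (0:ℝ) < s from hs0)).1 hs
  linarith

lemma hasDerivAt_along {f : RN N → ℝ} {x : RN N} (hf : DifferentiableAt ℝ f x) (v : RN N) :
    HasDerivAt (fun s : ℝ => f (x + s • v)) (inner ℝ (gradient f x) v) 0 := by
  rw [inner_gradient]
  have h1 : HasDerivAt (fun s : ℝ => x + s • v) v 0 := by
    simpa using ((hasDerivAt_id (0 : ℝ)).smul_const v).const_add x
  have h2 : HasFDerivAt f (fderiv ℝ f x) (x + (0 : ℝ) • v) := by simpa using hf.hasFDerivAt
  exact h2.comp_hasDerivAt (0 : ℝ) h1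

/-- At a boundary maximum the exterior normal derivative is nonnegative. -/
lemma normalDeriv_nonneg_of_max [NeZero N] (J : JumpKernel Ω μ j σ Cj) (hΩ : IsOpen Ω)
    (hO : AssumptionO Ω) {f : RN N → ℝ} {x : RN N} (hx : x ∈ frontier Ω)
    (hf : DifferentiableAt ℝ f x) (hmax : ∀ᶠ y in 𝓝[closure Ω] x, f y ≤ f x) :
    0 ≤ normalDeriv Ω f x := by
  obtain ⟨D, r, C, hD, -⟩ := exists_isDefiningAt J hΩ hO (frontier_subset_closure hx)
  have hxb := Metric.mem_ball_self (x := x) hD.r_pos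
  -- Moving from a boundary point in the direction `G` increases `D` from zero, hence stays in
  -- `closure Ω`; the maximum property may be tested along this ray.
  set G := gradient D x with hG
  have hG0 : 0 < ‖G‖ := lt_of_lt_of_le (by norm_num) (hD.half_le x hxb hx)
  have hcont : Tendsto (fun s : ℝ => x + s • G) (𝓝[>] 0) (𝓝 x) := by
    have : Continuous fun s : ℝ => x + s • G := by fun_prop
    have h := this.tendsto 0
    simp only [zero_smul, add_zero] at h
    exact h.mono_left nhdsWithin_le_nhds
  have h1 := eventually_lt_of_hasDerivAt_pos (hasDerivAt_along (hD.diff x hxb) G)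
    (by rw [← hG, real_inner_self_eq_norm_sq]; positivity)
  have h2 : ∀ᶠ s in 𝓝[>] (0 : ℝ), x + s • G ∈ closure Ω := by
    filter_upwards [h1, hcont.eventually (Metric.ball_mem_nhds x hD.r_pos)] with s hs hb
    by_contra hn
    have h3 := hD.nonpos _ hb hn
    rw [zero_smul, add_zero, hD.zero x hxb hx] at hs
    linarith
  have h3 : ∀ᶠ s in 𝓝[>] (0 : ℝ), f (x + s • G) ≤ f x :=
    (tendsto_nhdsWithin_iff.2 ⟨hcont, h2⟩).eventually hmax
  have h4 := nonpos_of_hasDerivAt_of_eventually_le (hasDerivAt_along hf G)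
    (h3.mono fun s hs => by simpa using hs)
  unfold normalDeriv
  rw [hD.normal x hxb hx, inner_neg_right]
  linarith

end Frontier

end CensoredNeumann

end


/-! ### Limits of the nonlocal operator. -/

noncomputable section

namespace CensoredNeumann

open Set Filter Topology MeasureTheory

section Limits

variable {N : ℕ} {Ω : Set (RN N)} {μ : RN N → Measure (RN N)} {j : RN N → RN N → RN N}
  {σ Cj : ℝ} (J : JumpKernel Ω μ j σ Cj)

/-- The outer part with the value at the center replaced by `c`. -/
def JumpKernel.outerC (ξ : ℝ) (f : RN N → ℝ) (c : ℝ) (x : RN N) : ℝ :=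
  ∫ z, {z : RN N | ξ ≤ ‖z‖}.indicator
    ((jumpSet Ω j x).indicator (fun z => J.g x z * (f (x + j x z) - c))) z

lemma JumpKernel.outerPart_eq_outerC {x : RN N} (hx : x ∈ closure Ω) (ξ : ℝ) (u : RN N → ℝ) :
    outerPart Ω μ j ξ u x = J.outerC ξ u (u x) x :=
  J.outerPart_eq hx ξ u

lemma JumpKernel.abs_outerC_integrand_le {f : RN N → ℝ} {c M : ℝ} (hM : 0 ≤ M)
    (hf : ∀ x ∈ closure Ω, |f x| ≤ M) (hc : |c| ≤ M) {x : RN N} (hx : x ∈ closure Ω) {ξ : ℝ}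
    (hξ : 0 < ξ) (z : RN N) :
    |{z : RN N | ξ ≤ ‖z‖}.indicator
      ((jumpSet Ω j x).indicator (fun z => J.g x z * (f (x + j x z) - c))) z| ≤
      J.C * (2 * M / min 1 ξ) * (min 1 ‖z‖ * kern σ z) := by
  have hC := J.C_pos
  have hm1 : 0 < min 1 ξ := lt_min one_pos hξ
  have hr : 0 ≤ J.C * (2 * M / min 1 ξ) * (min 1 ‖z‖ * kern σ z) :=
    mul_nonneg (by positivity) (mul_nonneg (le_min zero_le_one (norm_nonneg _)) (kern_nonneg z))
  by_cases hz : z ∈ {z : RN N | ξ ≤ ‖z‖}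
  · rw [indicator_of_mem hz]
    by_cases hm : z ∈ jumpSet Ω j x
    · rw [indicator_of_mem hm, abs_mul, abs_of_nonneg (J.nonneg x hx z)]
      have hz0 : z ≠ 0 := norm_pos_iff.1 (hξ.trans_le hz)
      calc J.g x z * |f (x + j x z) - c| ≤ (J.C * kern σ z) * (2 * M) :=
            mul_le_mul (J.g_le x hx z hz0) (abs_sub_le_two_mul (hf _ hm) hc) (abs_nonneg _)
              (mul_nonneg hC.le (kern_nonneg z))
        _ = J.C * (2 * M * kern σ z) := by ring
        _ ≤ J.C * (2 * M / min 1 ξ * (min 1 ‖z‖ * kern σ z)) :=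
            mul_le_mul_of_nonneg_left (indicator_norm_ge_kern_le hξ (by positivity) z hz) hC.le
        _ = _ := by ring
    · rwa [indicator_of_notMem hm, abs_zero]
  · rwa [indicator_of_notMem hz, abs_zero]

lemma JumpKernel.measurable_outerC_integrand {f : RN N → ℝ}
    (hf : Measurable ((closure Ω).indicator f)) (c : ℝ) {x : RN N} (hx : x ∈ closure Ω) (ξ : ℝ) :
    Measurable ({z : RN N | ξ ≤ ‖z‖}.indicator
      ((jumpSet Ω j x).indicator (fun z => J.g x z * (f (x + j x z) - c)))) := by
  refine Measurable.indicator ?_ (measurableSet_le measurable_const measurable_norm)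
  have h : (jumpSet Ω j x).indicator (fun z => J.g x z * (f (x + j x z) - c)) =
      (jumpSet Ω j x).indicator
        (fun z => J.g x z * ((closure Ω).indicator f (x + j x z) - c)) := by
    ext z
    by_cases hz : z ∈ jumpSet Ω j x
    · rw [indicator_of_mem hz, indicator_of_mem hz, indicator_of_mem (by exact hz)]
    · rw [indicator_of_notMem hz, indicator_of_notMem hz]
  rw [h]
  exact Measurable.indicator ((J.meas x hx).mul
    ((hf.comp ((J.measurable_j hx).const_add x)).sub_const _)) (J.measurableSet_jumpSet hx)

lemma JumpKernel.integrable_outerC [NeZero N] {f : RN N → ℝ} (hf : Adm Ω f) (c : ℝ) {x : RN N}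
    (hx : x ∈ closure Ω) {ξ : ℝ} (hξ : 0 < ξ) :
    Integrable ({z : RN N | ξ ≤ ‖z‖}.indicator
      ((jumpSet Ω j x).indicator (fun z => J.g x z * (f (x + j x z) - c)))) := by
  obtain ⟨K, hK0, hK⟩ := hf.exists_bound
  refine ((integrable_min_mul_kern J.σ_pos J.σ_lt_one).const_mul
    (J.C * (2 * max K |c| / min 1 ξ))).mono'
    (J.measurable_outerC_integrand hf.2 c hx ξ).aestronglyMeasurable (ae_of_all _ fun z => ?_)
  exact J.abs_outerC_integrand_le (hK0.trans (le_max_left _ _))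
    (fun x hx => (hK x hx).trans (le_max_left _ _)) (le_max_right _ _) hx hξ z

lemma JumpKernel.outerC_mono [NeZero N] {f f' : RN N → ℝ} (hf : Adm Ω f) (hf' : Adm Ω f')
    (h : ∀ y ∈ closure Ω, f y ≤ f' y) (c : ℝ) {x : RN N} (hx : x ∈ closure Ω) {ξ : ℝ}
    (hξ : 0 < ξ) : J.outerC ξ f c x ≤ J.outerC ξ f' c x := by
  refine integral_mono (J.integrable_outerC hf c hx hξ) (J.integrable_outerC hf' c hx hξ)
    fun z => ?_
  refine indicator_le_indicator ?_
  refine indicator_le_indicator' fun hm => ?_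
  exact mul_le_mul_of_nonneg_left (by linarith [h _ hm]) (J.nonneg x hx z)

lemma JumpKernel.outerC_neg (ξ : ℝ) (f : RN N → ℝ) (c : ℝ) (x : RN N) :
    J.outerC ξ (fun y => -f y) (-c) x = -J.outerC ξ f c x := by
  unfold JumpKernel.outerC
  rw [← integral_neg]
  congr 1
  ext z
  simp only [indicator]
  split_ifs <;> ring

include J in
lemma JumpKernel.tendsto_jump {x : ℕ → RN N} {x₀ : RN N} (hx : ∀ k, x k ∈ closure Ω)
    (hx₀ : x₀ ∈ closure Ω) (hlim : Tendsto x atTop (𝓝 x₀)) (z : RN N) :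
    Tendsto (fun k => x k + j (x k) z) atTop (𝓝 (x₀ + j x₀ z)) := by
  refine hlim.add (tendsto_iff_norm_sub_tendsto_zero.2 ?_)
  have h1 := (tendsto_iff_norm_sub_tendsto_zero.1 hlim).const_mul (J.jlip * ‖z‖)
  rw [mul_zero] at h1
  exact squeeze_zero (fun _ => norm_nonneg _) (fun k => J.j_lip _ (hx k) _ hx₀ z) h1

/-- Upper semicontinuity of the outer part along sequences. -/
lemma JumpKernel.eventually_outerC_le [NeZero N] (hΩ : IsOpen Ω) (hO : AssumptionO Ω)
    {x : ℕ → RN N} {x₀ : RN N} (hx : ∀ k, x k ∈ closure Ω) (hx₀ : x₀ ∈ closure Ω)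
    (hlim : Tendsto x atTop (𝓝 x₀)) {c : ℕ → ℝ} {c₀ : ℝ} (hc : Tendsto c atTop (𝓝 c₀))
    {f : ℕ → RN N → ℝ} {f₀ : RN N → ℝ} {M : ℝ} (hM : 0 ≤ M)
    (hf : ∀ k, Adm Ω (f k)) (hf₀ : Adm Ω f₀)
    (hfM : ∀ k, ∀ y ∈ closure Ω, |f k y| ≤ M) (hf₀M : ∀ y ∈ closure Ω, |f₀ y| ≤ M)
    (hcM : ∀ k, |c k| ≤ M) (hc₀M : |c₀| ≤ M)
    (hpt : ∀ z, x₀ + j x₀ z ∈ closure Ω → ∀ ε > 0, ∀ᶠ k in atTop,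
      x k + j (x k) z ∈ closure Ω → f k (x k + j (x k) z) ≤ f₀ (x₀ + j x₀ z) + ε)
    {ξ : ℝ} (hξ : 0 < ξ) {ε : ℝ} (hε : 0 < ε) :
    ∀ᶠ k in atTop, J.outerC ξ (f k) (c k) (x k) ≤ J.outerC ξ f₀ c₀ x₀ + ε := by
  set h : ℕ → RN N → ℝ := fun k => {z : RN N | ξ ≤ ‖z‖}.indicator
      ((jumpSet Ω j (x k)).indicator (fun z => J.g (x k) z * (f k (x k + j (x k) z) - c k)))
    with hh
  set h₀ : RN N → ℝ := {z : RN N | ξ ≤ ‖z‖}.indicator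
      ((jumpSet Ω j x₀).indicator (fun z => J.g x₀ z * (f₀ (x₀ + j x₀ z) - c₀))) with hh₀
  have hi : ∀ k, Integrable (h k) := fun k => J.integrable_outerC (hf k) _ (hx k) hξ
  have hi₀ : Integrable h₀ := J.integrable_outerC hf₀ _ hx₀ hξ
  -- Only a one-sided limit is claimed, so dominated convergence is applied to the positive part of
  -- the difference.
  have hlim0 : Tendsto (fun k => ∫ z, max (h k z - h₀ z) 0) atTop (𝓝 (∫ _ : RN N, (0 : ℝ))) := by
    refine tendsto_integral_of_dominated_convergence
      (fun z => 2 * (J.C * (2 * M / min 1 ξ) * (min 1 ‖z‖ * kern σ z))) ?_ ?_ ?_ ?_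
    · exact fun k => ((hi k).sub hi₀).aestronglyMeasurable.sup aestronglyMeasurable_const
    · exact ((integrable_min_mul_kern J.σ_pos J.σ_lt_one).const_mul _).const_mul 2
    · refine fun k => ae_of_all _ fun z => ?_
      have h1 := J.abs_outerC_integrand_le hM (hfM k) (hcM k) (hx k) hξ z
      have h2 := J.abs_outerC_integrand_le hM hf₀M hc₀M hx₀ hξ z
      have h3 : |h k z - h₀ z| ≤ 2 * (J.C * (2 * M / min 1 ξ) * (min 1 ‖z‖ * kern σ z)) :=
        abs_sub_le_two_mul h1 h2
      rw [Real.norm_eq_abs, abs_of_nonneg (le_max_right _ _)]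
      exact max_le ((le_abs_self _).trans h3) ((abs_nonneg _).trans h3)
    · filter_upwards [ae_notMem_frontier J hΩ hO hx₀] with z hz
      by_cases hzξ : ξ ≤ ‖z‖
      swap
      · have e1 : ∀ k, h k z = 0 := fun k => indicator_of_notMem (by exact hzξ) _
        have e2 : h₀ z = 0 := indicator_of_notMem (by exact hzξ) _
        simp [e1, e2]
      have hz0 : z ≠ 0 := norm_pos_iff.1 (hξ.trans_le hzξ)
      have htj := J.tendsto_jump hx hx₀ hlim z
      by_cases hzc : x₀ + j x₀ z ∈ closure Ω
      · have hzΩ : x₀ + j x₀ z ∈ Ω := by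
          rw [hΩ.frontier_eq] at hz
          by_contra hn
          exact hz ⟨hzc, hn⟩
        have hev : ∀ᶠ k in atTop, x k + j (x k) z ∈ closure Ω :=
          (htj.eventually (hΩ.mem_nhds hzΩ)).mono fun k hk => subset_closure hk
        have hf1 : Tendsto (fun k => max (f k (x k + j (x k) z) - f₀ (x₀ + j x₀ z)) 0) atTop
            (𝓝 0) := by
          rw [tendsto_order]
          refine ⟨fun a ha => Eventually.of_forall fun k => ha.trans_le (le_max_right _ _),
            fun a ha => ?_⟩
          filter_upwards [hev, hpt z hzc (a / 2) (by linarith)] with k hk1 hk2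
          exact max_lt (by linarith [hk2 hk1]) ha
        have hc1 : Tendsto (fun k => |c k - c₀|) atTop (𝓝 0) := by
          have := (hc.sub_const c₀).abs
          simpa using this
        have hx1 := tendsto_iff_norm_sub_tendsto_zero.1 hlim
        have hr : Tendsto (fun k => J.C * kern σ z *
            (max (f k (x k + j (x k) z) - f₀ (x₀ + j x₀ z)) 0 + |c k - c₀|) +
            J.D * ‖x k - x₀‖ * kern σ z * (2 * M)) atTop (𝓝 0) := by
          have := ((hf1.add hc1).const_mul (J.C * kern σ z)).add
            (((hx1.const_mul J.D).mul_const (kern σ z)).mul_const (2 * M))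
          simpa using this
        refine squeeze_zero' (Eventually.of_forall fun k => le_max_right _ _) ?_ hr
        filter_upwards [hev] with k hk
        have e1 : h k z = J.g (x k) z * (f k (x k + j (x k) z) - c k) := by
          simp only [hh]
          rw [indicator_of_mem (by exact hzξ), indicator_of_mem (by exact hk)]
        have e2 : h₀ z = J.g x₀ z * (f₀ (x₀ + j x₀ z) - c₀) := by
          simp only [hh₀]
          rw [indicator_of_mem (by exact hzξ), indicator_of_mem (by exact hzc)]
        have g0 := J.nonneg (x k) (hx k) z
        have g1 := J.g_le (x k) (hx k) z hz0
        have g2 := J.g_lip (x k) (hx k) x₀ hx₀ z hz0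
        have hk0 := kern_nonneg (σ := σ) z
        set A := max (f k (x k + j (x k) z) - f₀ (x₀ + j x₀ z)) 0
        have hA0 : 0 ≤ A := le_max_right _ _
        have hA1 : f k (x k + j (x k) z) - f₀ (x₀ + j x₀ z) ≤ A := le_max_left _ _
        have hfc : |f₀ (x₀ + j x₀ z) - c₀| ≤ 2 * M := abs_sub_le_two_mul (hf₀M _ hzc) hc₀M
        -- The difference of the integrands splits into a change of increments with the density at
        -- `x k` (`s1`) and a change of density with the limit increment (`s2`).
        have s1 : J.g (x k) z * (f k (x k + j (x k) z) - f₀ (x₀ + j x₀ z) - (c k - c₀)) ≤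
            J.C * kern σ z * (A + |c k - c₀|) := by
          have t1 : f k (x k + j (x k) z) - f₀ (x₀ + j x₀ z) - (c k - c₀) ≤ A + |c k - c₀| := by
            linarith [neg_abs_le (c k - c₀)]
          exact (mul_le_mul_of_nonneg_left t1 g0).trans
            (mul_le_mul_of_nonneg_right g1 (add_nonneg hA0 (abs_nonneg _)))
        have s2 : (J.g (x k) z - J.g x₀ z) * (f₀ (x₀ + j x₀ z) - c₀) ≤
            J.D * ‖x k - x₀‖ * kern σ z * (2 * M) := by
          refine (le_abs_self _).trans ?_
          rw [abs_mul]
          exact mul_le_mul g2 hfc (abs_nonneg _) ((abs_nonneg _).trans g2)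
        refine max_le ?_ ?_
        · rw [e1, e2]; linarith
        · have := J.C_pos
          have := J.D_pos
          positivity
      · have hev : ∀ᶠ k in atTop, x k + j (x k) z ∉ closure Ω :=
          htj.eventually (isClosed_closure.isOpen_compl.mem_nhds hzc)
        refine tendsto_const_nhds.congr' ?_
        filter_upwards [hev] with k hk
        have e1 : h k z = 0 := by
          simp only [hh]
          rw [indicator_of_mem (by exact hzξ), indicator_of_notMem (by exact hk)]
        have e2 : h₀ z = 0 := by
          simp only [hh₀]
          rw [indicator_of_mem (by exact hzξ), indicator_of_notMem (by exact hzc)]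
        simp [e1, e2]
  rw [integral_zero] at hlim0
  filter_upwards [hlim0.eventually (Iio_mem_nhds hε)] with k hk
  have h1 : J.outerC ξ (f k) (c k) (x k) - J.outerC ξ f₀ c₀ x₀ = ∫ z, (h k z - h₀ z) :=
    (integral_sub (hi k) hi₀).symm
  have h2 : ∫ z, (h k z - h₀ z) ≤ ∫ z, max (h k z - h₀ z) 0 :=
    integral_mono ((hi k).sub hi₀) ((hi k).sub hi₀).pos_part fun z => le_max_left _ _
  have h3 : ∫ z, max (h k z - h₀ z) 0 < ε := hk
  linarith

end Limits

/-! ### Semicontinuous envelopes. -/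

section Envelope

variable {X : Type*} [TopologicalSpace X]

/-- The upper semicontinuous envelope relative to the set `s`. -/
def upperEnv (s : Set X) (W : X → ℝ) (x : X) : ℝ := sInf {c | ∀ᶠ y in 𝓝[s] x, W y ≤ c}

variable {s : Set X} {W : X → ℝ} {K : ℝ}

lemma upperEnv_set_lower {x : X} (hx : x ∈ s) {c : ℝ} (hc : ∀ᶠ y in 𝓝[s] x, W y ≤ c) :
    W x ≤ c := hc.self_of_nhdsWithin hx

lemma le_upperEnv (hK : ∀ x ∈ s, |W x| ≤ K) {x : X} (hx : x ∈ s) : W x ≤ upperEnv s W x := by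
  refine le_csInf ⟨K, ?_⟩ fun c hc => upperEnv_set_lower hx hc
  filter_upwards [self_mem_nhdsWithin] with y hy
  exact (le_abs_self _).trans (hK y hy)

lemma upperEnv_le {x : X} (hx : x ∈ s) {c : ℝ} (hc : ∀ᶠ y in 𝓝[s] x, W y ≤ c) :
    upperEnv s W x ≤ c := csInf_le ⟨W x, fun _ h => upperEnv_set_lower hx h⟩ hc

lemma abs_upperEnv_le (hK : ∀ x ∈ s, |W x| ≤ K) {x : X} (hx : x ∈ s) : |upperEnv s W x| ≤ K := by
  refine abs_le.2 ⟨(neg_le_of_abs_le (hK x hx)).trans (le_upperEnv hK hx), upperEnv_le hx ?_⟩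
  filter_upwards [self_mem_nhdsWithin] with y hy
  exact (le_abs_self _).trans (hK y hy)

lemma eventually_le_of_upperEnv_lt (hK : ∀ x ∈ s, |W x| ≤ K) {x : X} {c : ℝ}
    (hc : upperEnv s W x < c) : ∀ᶠ y in 𝓝[s] x, W y ≤ c := by
  have hne : {c | ∀ᶠ y in 𝓝[s] x, W y ≤ c}.Nonempty := by
    refine ⟨K, ?_⟩
    filter_upwards [self_mem_nhdsWithin] with y hy
    exact (le_abs_self _).trans (hK y hy)
  obtain ⟨c', hc', hlt⟩ := exists_lt_of_csInf_lt hne hc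
  have hev : ∀ᶠ y in 𝓝[s] x, W y ≤ c' := hc'
  exact hev.mono fun y hy => hy.trans hlt.le

lemma frequently_lt_of_lt_upperEnv {x : X} (hx : x ∈ s) {c : ℝ} (hc : c < upperEnv s W x) :
    ∃ᶠ y in 𝓝[s] x, c < W y := by
  intro h
  refine not_lt.2 (upperEnv_le hx ?_) hc
  exact h.mono fun y hy => not_lt.1 hy

lemma upperSemicontinuousOn_upperEnv (hK : ∀ x ∈ s, |W x| ≤ K) :
    UpperSemicontinuousOn (upperEnv s W) s := by
  intro x hx c hc
  obtain ⟨c', h1, h2⟩ := exists_between hc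
  have h3 := eventually_eventually_nhdsWithin.2 (eventually_le_of_upperEnv_lt hK h1)
  filter_upwards [h3, self_mem_nhdsWithin] with y hy hys
  exact (upperEnv_le hys hy).trans_lt h2

end Envelope

end CensoredNeumann

end


/-! ### Suprema of subsolutions. -/

noncomputable section

namespace CensoredNeumann

open Set Filter Topology MeasureTheory

section Perron

variable {N : ℕ} {Ω : Set (RN N)} {μ : RN N → Measure (RN N)} {j : RN N → RN N → RN N}
  {σ Cj : ℝ} {H : RN N → RN N → ℝ}

lemma tendsto_outerNormal [NeZero N] (J : JumpKernel Ω μ j σ Cj) (hΩ : IsOpen Ω)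
    (hO : AssumptionO Ω) {x : RN N} (hx : x ∈ frontier Ω) :
    Tendsto (outerNormal Ω) (𝓝[frontier Ω] x) (𝓝 (outerNormal Ω x)) := by
  obtain ⟨D, r, C, hD, -⟩ := exists_isDefiningAt J hΩ hO (frontier_subset_closure hx)
  have hxb := Metric.mem_ball_self (x := x) hD.r_pos
  rw [tendsto_iff_norm_sub_tendsto_zero]
  have h1 : Tendsto (fun y => C * ‖y - x‖) (𝓝[frontier Ω] x) (𝓝 0) := by
    have : Continuous fun y : RN N => C * ‖y - x‖ := by fun_prop
    simpa using (this.tendsto x).mono_left nhdsWithin_le_nhds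
  refine squeeze_zero' (Eventually.of_forall fun _ => norm_nonneg _) ?_ h1
  filter_upwards [self_mem_nhdsWithin,
    nhdsWithin_le_nhds (Metric.ball_mem_nhds x hD.r_pos)] with y hy hyb
  rw [hD.normal y hyb hy, hD.normal x hxb hx, neg_sub_neg]
  unfold gradient
  rw [← map_sub, LinearIsometryEquiv.norm_map]
  rw [norm_sub_rev y x]
  exact hD.lip x hxb y hyb

lemma continuous_gradient {φ : RN N → ℝ} (hφ : ContDiff ℝ 1 φ) : Continuous (gradient φ) :=
  (LinearIsometryEquiv.continuous _).comp (hφ.continuous_fderiv one_ne_zero)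

lemma tendsto_normalDeriv [NeZero N] (J : JumpKernel Ω μ j σ Cj) (hΩ : IsOpen Ω)
    (hO : AssumptionO Ω) {x : RN N} (hx : x ∈ frontier Ω) {φ : RN N → ℝ} (hφ : ContDiff ℝ 1 φ) :
    Tendsto (normalDeriv Ω φ) (𝓝[frontier Ω] x) (𝓝 (normalDeriv Ω φ x)) :=
  (((continuous_gradient hφ).tendsto x).mono_left nhdsWithin_le_nhds).inner
    (tendsto_outerNormal J hΩ hO hx)

/-- It trades the limit over vanishing cutoffs for one fixed cutoff, with an error depending only on
the slope bound; in this form the inequality passes to limits along sequences of functions. -/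
lemma SubAt.le_of_incr [NeZero N] (J : JumpKernel Ω μ j σ Cj) {u : RN N → ℝ} {x p : RN N}
    (hu : Adm Ω u) (hx : x ∈ closure Ω) (h : SubAt Ω μ j H u x p) {ξ K : ℝ} (hξ : 0 < ξ)
    (hK : 0 ≤ K) (hincr : ∀ z, ‖z‖ < ξ → x + j x z ∈ closure Ω → u (x + j x z) - u x ≤ K * ‖z‖) :
    u x - outerPart Ω μ j ξ u x + H x p ≤ J.C * K * ballMoment N σ ξ := by
  refine le_of_forall_pos_le_add fun η hη => ?_
  have hlt : ∀ᶠ ξ' in 𝓝[>] (0 : ℝ), ξ' < ξ := nhdsWithin_le_nhds (Iio_mem_nhds hξ)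
  obtain ⟨ξ', h1, h2, h3⟩ := ((h η hη).and (hlt.and self_mem_nhdsWithin)).exists
  have h4 := J.outerPart_le_outerPart_add hu hx h3 h2.le hK hincr
  linarith

lemma contDiff_normSq (x : RN N) : ContDiff ℝ 1 fun y : RN N => ‖y - x‖ ^ 2 :=
  (contDiff_id.sub contDiff_const).norm_sq ℝ

lemma gradient_normSq (x y : RN N) :
    gradient (fun y : RN N => ‖y - x‖ ^ 2) y = (2 : ℝ) • (y - x) := by
  refine HasGradientAt.gradient ?_
  rw [hasGradientAt_iff_hasFDerivAt]
  have h := ((hasFDerivAt_id (𝕜 := ℝ) y).sub_const x).norm_sq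
  refine h.congr_fderiv ?_
  ext v
  simp

lemma gradient_add' {f g : RN N → ℝ} {x : RN N} (hf : DifferentiableAt ℝ f x)
    (hg : DifferentiableAt ℝ g x) :
    gradient (fun y => f y + g y) x = gradient f x + gradient g x := by
  unfold gradient
  rw [fderiv_fun_add hf hg, map_add]

lemma gradient_sub' {f g : RN N → ℝ} {x : RN N} (hf : DifferentiableAt ℝ f x)
    (hg : DifferentiableAt ℝ g x) :
    gradient (fun y => f y - g y) x = gradient f x - gradient g x := by
  unfold gradient
  rw [fderiv_fun_sub hf hg, map_sub]

lemma exists_lipschitz_closedBall {φ : RN N → ℝ} (hφ : ContDiff ℝ 1 φ) (x : RN N) (r : ℝ) :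
    ∃ K, 0 ≤ K ∧ ∀ y ∈ Metric.closedBall x r, ∀ y' ∈ Metric.closedBall x r,
      |φ y' - φ y| ≤ K * ‖y' - y‖ := by
  obtain ⟨K, hK⟩ := (isCompact_closedBall x r).exists_bound_of_continuousOn
    ((hφ.continuous_fderiv one_ne_zero).continuousOn)
  refine ⟨max K 0, le_max_right _ _, fun y hy y' hy' => ?_⟩
  exact (convex_closedBall x r).norm_image_sub_le_of_norm_fderiv_le (𝕜 := ℝ) (f := φ)
    (fun y _ => (hφ.differentiable one_ne_zero).differentiableAt)
    (fun y hy => (hK y hy).trans (le_max_left K 0)) hy hy'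

include σ Cj in
lemma JumpKernel.norm_jump_le (J : JumpKernel Ω μ j σ Cj) {x₀ x z : RN N} {ρ ξ r : ℝ}
    (hx : x ∈ closure Ω) (hxρ : ‖x - x₀‖ ≤ ρ) (hz : ‖z‖ < ξ) (h : ρ + Cj * ξ ≤ r) :
    x + j x z ∈ Metric.closedBall x₀ r := by
  rw [Metric.mem_closedBall, dist_eq_norm, add_sub_right_comm]
  have h1 := J.le_up x hx z
  have h2 := mul_le_mul_of_nonneg_left hz.le J.Cj_pos.le
  have h3 := norm_add_le (x - x₀) (j x z)
  linarith

/-- The upper semicontinuous envelope of a supremum of subsolutions is a subsolution. -/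
theorem isSubsolution_upperEnv [NeZero N] (J : JumpKernel Ω μ j σ Cj) (hΩ : IsOpen Ω)
    (hO : AssumptionO Ω)
    (hH : ContinuousOn (fun q : RN N × RN N => H q.1 q.2) (closure Ω ×ˢ univ))
    {S : Set (RN N → ℝ)} {W : RN N → ℝ} {K : ℝ} (hK0 : 0 ≤ K)
    (hS : ∀ w ∈ S, IsSubsolution Ω μ j Cj H w ∧ ∀ x ∈ closure Ω, |w x| ≤ K)
    (hW : ∀ x ∈ closure Ω, |W x| ≤ K)
    (hle : ∀ w ∈ S, ∀ x ∈ closure Ω, w x ≤ W x)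
    (hlub : ∀ x ∈ closure Ω, ∀ c < W x, ∃ w ∈ S, c < w x) :
    IsSubsolution Ω μ j Cj H (upperEnv (closure Ω) W) := by
  set U := upperEnv (closure Ω) W with hU
  have hUK : ∀ x ∈ closure Ω, |U x| ≤ K := fun x hx => abs_upperEnv_le hW hx
  have husc : UpperSemicontinuousOn U (closure Ω) := upperSemicontinuousOn_upperEnv hW
  have hWU : ∀ x ∈ closure Ω, W x ≤ U x := fun x hx => le_upperEnv hW hx
  have hUadm : Adm Ω U := adm_of_usc ⟨K, hUK⟩ husc
  refine isSubsolution_of_jets J ⟨K, hUK⟩ husc fun x hx φ hφ hmax => ?_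
  suffices key : (x ∈ Ω ∨ 0 < normalDeriv Ω φ x) → SubAt Ω μ j H U x (gradient φ x) by
    refine ⟨fun h => key (Or.inl h), fun _ => ?_⟩
    rcases le_or_gt (normalDeriv Ω φ x) 0 with h | h
    · exact Or.inl h
    · exact Or.inr (key (Or.inr h))
  intro hcase
  -- The quadratic term makes the maximum strict without changing the gradient at `x`, so maximum
  -- points of the approximating subsolutions are forced to converge to `x`.
  set ψ : RN N → ℝ := fun y => φ y + ‖y - x‖ ^ 2 with hψdef
  have hψ : ContDiff ℝ 1 ψ := hφ.add (contDiff_normSq x)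
  have hgrad : gradient ψ x = gradient φ x := by
    rw [hψdef, gradient_add' (hφ.differentiable one_ne_zero x)
      ((contDiff_normSq x).differentiable one_ne_zero x), gradient_normSq]
    simp
  obtain ⟨r, hr, hb⟩ := Metric.eventually_nhds_iff_ball.1 (eventually_nhdsWithin_iff.1 hmax)
  set r₁ := r / 2
  have hr₁ : 0 < r₁ := by positivity
  have hb1 : ∀ y ∈ Metric.closedBall x r₁, y ∈ closure Ω → U y - φ y ≤ U x - φ x :=
    fun y hy => hb y (Metric.closedBall_subset_ball (by simp only [r₁]; linarith) hy)
  -- near optimal subsolutions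
  have hseq : ∀ k : ℕ, ∃ w ∈ S, ∃ y ∈ closure Ω, ‖y - x‖ < min (1 / ((k : ℝ) + 1)) r₁ ∧
      U x - 1 / ((k : ℝ) + 1) < w y := by
    intro k
    have hk : 0 < 1 / ((k : ℝ) + 1) := by positivity
    have h1 := frequently_lt_of_lt_upperEnv (W := W) hx
      (show U x - 1 / ((k : ℝ) + 1) < upperEnv (closure Ω) W x by rw [← hU]; linarith)
    have h2 : ∀ᶠ y in 𝓝[closure Ω] x, y ∈ closure Ω ∧ ‖y - x‖ < min (1 / ((k : ℝ) + 1)) r₁ := by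
      filter_upwards [self_mem_nhdsWithin,
        nhdsWithin_le_nhds (Metric.ball_mem_nhds x (lt_min hk hr₁))] with y hy hyb
      exact ⟨hy, by rw [← dist_eq_norm]; exact hyb⟩
    obtain ⟨y, hy1, hy2, hy3⟩ := (h1.and_eventually h2).exists
    obtain ⟨w, hw, hwy⟩ := hlub y hy2 _ hy1
    exact ⟨w, hw, y, hy2, hy3, hwy⟩
  choose w hwS a ha hax hwa using hseq
  have hmaxk : ∀ k, ∃ y ∈ Metric.closedBall x r₁ ∩ closure Ω,
      IsMaxOn (fun y => w k y - ψ y) (Metric.closedBall x r₁ ∩ closure Ω) y := by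
    intro k
    refine UpperSemicontinuousOn.exists_isMaxOn ⟨a k, ?_, ha k⟩
      ((isCompact_closedBall x r₁).inter_right isClosed_closure) ?_
    · rw [Metric.mem_closedBall, dist_eq_norm]
      exact (hax k).le.trans (min_le_right _ _)
    · have h1 : UpperSemicontinuousOn (fun y => -ψ y) (Metric.closedBall x r₁ ∩ closure Ω) :=
        (hψ.continuous.neg).upperSemicontinuous.upperSemicontinuousOn _
      have h2 := (((hS _ (hwS k)).1.2.1).mono inter_subset_right).add h1
      simpa [sub_eq_add_neg] using h2
  choose y hy hymax using hmaxk
  have hyc : ∀ k, y k ∈ closure Ω := fun k => (hy k).2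
  have htk : Tendsto (fun k : ℕ => 1 / ((k : ℝ) + 1)) atTop (𝓝 0) :=
    tendsto_one_div_add_atTop_nhds_zero_nat
  have hatend : Tendsto a atTop (𝓝 x) := by
    rw [tendsto_iff_norm_sub_tendsto_zero]
    exact squeeze_zero (fun _ => norm_nonneg _)
      (fun k => (hax k).le.trans (min_le_left _ _)) htk
  have hψa : Tendsto (fun k => ψ (a k)) atTop (𝓝 (φ x)) := by
    have := (hψ.continuous.tendsto x).comp hatend
    simpa [hψdef, Function.comp_def] using this
  have hineq1 : ∀ k, w k (a k) - ψ (a k) ≤ w k (y k) - ψ (y k) := fun k =>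
    hymax k ⟨by
      rw [Metric.mem_closedBall, dist_eq_norm]
      exact (hax k).le.trans (min_le_right _ _), ha k⟩
  have hineq2 : ∀ k, w k (y k) ≤ φ (y k) + (U x - φ x) := fun k => by
    have h1 := hb1 (y k) (hy k).1 (hyc k)
    have h2 := hle _ (hwS k) _ (hyc k)
    have h3 := hWU _ (hyc k)
    linarith
  have hsq : ∀ k, ‖y k - x‖ ^ 2 ≤ ψ (a k) - φ x + 1 / ((k : ℝ) + 1) := fun k => by
    have h1 := hineq1 k
    have h2 := hineq2 k
    have h3 := hwa k
    simp only [hψdef] at h1 ⊢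
    linarith
  have hytend : Tendsto y atTop (𝓝 x) := by
    rw [tendsto_iff_norm_sub_tendsto_zero]
    have h1 : Tendsto (fun k => ‖y k - x‖ ^ 2) atTop (𝓝 0) := by
      refine squeeze_zero (fun _ => by positivity) hsq ?_
      have := (hψa.sub_const (φ x)).add htk
      simpa using this
    have h2 := h1.sqrt
    simpa using h2
  have hφy : Tendsto (fun k => φ (y k)) atTop (𝓝 (φ x)) :=
    (hφ.continuous.tendsto x).comp hytend
  have hψy : Tendsto (fun k => ψ (y k)) atTop (𝓝 (φ x)) := by
    have := (hψ.continuous.tendsto x).comp hytend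
    simpa [hψdef, Function.comp_def] using this
  have hwy : Tendsto (fun k => w k (y k)) atTop (𝓝 (U x)) := by
    refine tendsto_of_tendsto_of_tendsto_of_le_of_le
      (g := fun k : ℕ => U x - 1 / ((k : ℝ) + 1) - ψ (a k) + ψ (y k))
      (h := fun k : ℕ => φ (y k) + (U x - φ x)) ?_ ?_ (fun k => ?_) (fun k => hineq2 k)
    · have := ((tendsto_const_nhds (x := U x)).sub htk).sub hψa |>.add hψy
      simpa using this
    · have := hφy.add_const (U x - φ x)
      simpa using this
    · have h1 := hineq1 k
      have h2 := hwa k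
      simp only
      linarith
  -- the subsolution inequality at `y k`
  have hsub : ∀ᶠ k in atTop, SubAt Ω μ j H (w k) (y k) (gradient ψ (y k)) := by
    have hloc : ∀ᶠ k in atTop, ∀ᶠ q in 𝓝[closure Ω] (y k),
        w k q - ψ q ≤ w k (y k) - ψ (y k) := by
      filter_upwards [hytend.eventually (Metric.ball_mem_nhds x hr₁)] with k hk
      rw [eventually_nhdsWithin_iff]
      filter_upwards [Metric.isOpen_ball.mem_nhds hk] with q hq hqc
      exact hymax k ⟨Metric.ball_subset_closedBall hq, hqc⟩
    rcases hcase with hxΩ | hnd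
    · filter_upwards [hloc, hytend.eventually (hΩ.mem_nhds hxΩ)] with k hk hkΩ
      exact ((hS _ (hwS k)).1.jet J (hyc k) hψ.contDiffAt hk).1 hkΩ
    -- The normal derivative is continuous along the boundary, so the Neumann alternative is also
    -- excluded at the nearby points `y k`.
    · have hev : ∀ᶠ q in 𝓝 x, q ∈ frontier Ω → 0 < normalDeriv Ω ψ q := by
        by_cases hxf : x ∈ frontier Ω
        · have hnd' : 0 < normalDeriv Ω ψ x := by
            unfold normalDeriv at hnd ⊢; rwa [hgrad]
          exact eventually_nhdsWithin_iff.1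
            ((tendsto_normalDeriv J hΩ hO hxf hψ).eventually (lt_mem_nhds hnd'))
        · filter_upwards [isClosed_frontier.isOpen_compl.mem_nhds hxf] with q hq hqf
          exact absurd hqf hq
      filter_upwards [hloc, hytend.eventually hev] with k hk hkn
      have hjet := (hS _ (hwS k)).1.jet J (hyc k) hψ.contDiffAt hk
      by_cases hkΩ : y k ∈ Ω
      · exact hjet.1 hkΩ
      · have hkf : y k ∈ frontier Ω := by rw [hΩ.frontier_eq]; exact ⟨hyc k, hkΩ⟩
        rcases hjet.2 hkf with h | h
        · exact absurd h (not_le.2 (hkn hkf))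
        · exact h
  -- passage to the limit
  obtain ⟨L, hL0, hL⟩ := exists_lipschitz_closedBall hψ x r₁
  have hCj := J.Cj_pos
  intro η hη
  have hsmall : ∀ᶠ ξ in 𝓝[>] (0 : ℝ), Cj * ξ ≤ r₁ / 2 := by
    have hc : Continuous fun ξ : ℝ => Cj * ξ := by fun_prop
    exact nhdsWithin_le_nhds ((hc.continuousAt.eventually_lt_const
      (show _ < r₁ / 2 by simp; positivity)).mono fun _ h => h.le)
  filter_upwards [eventually_ballMoment_lt J (L * Cj) (half_pos hη), hsmall,
    self_mem_nhdsWithin] with ξ hξ1 hξ2 hξ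
  have hξ : 0 < ξ := hξ
  have hgr : Tendsto (fun k => gradient ψ (y k)) atTop (𝓝 (gradient φ x)) := by
    rw [← hgrad]; exact ((continuous_gradient hψ).tendsto x).comp hytend
  have hHk : Tendsto (fun k => H (y k) (gradient ψ (y k))) atTop (𝓝 (H x (gradient φ x))) := by
    have h1 : Tendsto (fun k => (y k, gradient ψ (y k))) atTop
        (𝓝[closure Ω ×ˢ univ] (x, gradient φ x)) :=
      tendsto_nhdsWithin_iff.2 ⟨hytend.prodMk_nhds hgr,
        Eventually.of_forall fun k => ⟨hyc k, mem_univ _⟩⟩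
    exact (hH (x, gradient φ x) ⟨hx, mem_univ _⟩).tendsto.comp h1
  have hη4 : 0 < η / 4 := by linarith
  -- All functions `w k` lie below the upper semicontinuous `U`, which supplies the pointwise upper
  -- bound at the landing points.
  have hfat := J.eventually_outerC_le hΩ hO hyc hx hytend hwy (M := K) hK0
    (fun k => adm_of_usc (hS _ (hwS k)).1.1 (hS _ (hwS k)).1.2.1) hUadm
    (fun k => (hS _ (hwS k)).2) hUK (fun k => (hS _ (hwS k)).2 _ (hyc k)) (hUK x hx)
    (fun z hz ε hε => by
      have h1 := husc _ hz (U (x + j x z) + ε) (by linarith)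
      rw [eventually_nhdsWithin_iff] at h1
      filter_upwards [(J.tendsto_jump hyc hx hytend z).eventually h1] with k hk hkc
      exact ((hle _ (hwS k) _ hkc).trans (hWU _ hkc)).trans (hk hkc).le) hξ hη4
  have hfin : ∀ᶠ k in atTop, w k (y k) + H (y k) (gradient ψ (y k)) ≤
      outerPart Ω μ j ξ U x + η / 4 + η / 2 := by
    filter_upwards [hfat, hsub, hytend.eventually
      (Metric.closedBall_mem_nhds x (half_pos hr₁))] with k h1 h2 h3
    have h4 := h2.le_of_incr J (adm_of_usc (hS _ (hwS k)).1.1 (hS _ (hwS k)).1.2.1) (hyc k) hξ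
      (K := L * Cj) (by positivity) fun z hz hzc => by
        have h5 : y k + j (y k) z ∈ Metric.closedBall x r₁ :=
          J.norm_jump_le (ρ := r₁ / 2) (hyc k) (by rw [← dist_eq_norm]; exact h3) hz (by linarith)
        have h6 := hymax k ⟨h5, hzc⟩
        simp only [mem_ofPred_eq] at h6
        have h7 := (le_abs_self _).trans (hL _ (hy k).1 _ h5)
        rw [add_sub_cancel_left] at h7
        have h8 := mul_le_mul_of_nonneg_left (J.le_up _ (hyc k) z) hL0
        linarith
    rw [J.outerPart_eq_outerC (hyc k)] at h4
    rw [J.outerPart_eq_outerC hx]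
    linarith
  have hlimit := le_of_tendsto (hwy.add hHk) hfin
  linarith

/-- Raising the function away from `x` while keeping its value at `x` increases the nonlocal term,
which enters with a minus sign. -/
lemma SubAt.mono [NeZero N] (J : JumpKernel Ω μ j σ Cj) {W w : RN N → ℝ} {x p : RN N}
    (hW : Adm Ω W) (hw : Adm Ω w) (hx : x ∈ closure Ω) (hle : ∀ y ∈ closure Ω, W y ≤ w y)
    (heq : w x = W x) (h : SubAt Ω μ j H W x p) : SubAt Ω μ j H w x p := by
  intro η hη
  filter_upwards [h η hη, self_mem_nhdsWithin] with ξ h1 hξ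
  have h2 := J.outerC_mono hW hw hle (W x) hx (show 0 < ξ from hξ)
  rw [J.outerPart_eq_outerC hx] at h1
  rw [J.outerPart_eq_outerC hx, heq]
  linarith

end Perron

end CensoredNeumann

end


/-! ### The bump construction. -/

noncomputable section

namespace CensoredNeumann

open Set Filter Topology MeasureTheory

section Bump

variable {N : ℕ} {Ω : Set (RN N)} {μ : RN N → Measure (RN N)} {j : RN N → RN N → RN N}
  {σ Cj : ℝ} {H : RN N → RN N → ℝ}

/-- The lower semicontinuous envelope. -/
def lowerEnv (s : Set (RN N)) (W : RN N → ℝ) (x : RN N) : ℝ := -upperEnv s (fun y => -W y) x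

lemma lowerEnv_le {s : Set (RN N)} {W : RN N → ℝ} {K : ℝ} (hK : ∀ x ∈ s, |W x| ≤ K) {x : RN N}
    (hx : x ∈ s) : lowerEnv s W x ≤ W x := by
  have := le_upperEnv (W := fun y => -W y) (K := K) (by simpa using hK) hx
  unfold lowerEnv
  linarith

lemma abs_lowerEnv_le {s : Set (RN N)} {W : RN N → ℝ} {K : ℝ} (hK : ∀ x ∈ s, |W x| ≤ K)
    {x : RN N} (hx : x ∈ s) : |lowerEnv s W x| ≤ K := by
  unfold lowerEnv
  rw [abs_neg]
  exact abs_upperEnv_le (by simpa using hK) hx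

lemma lowerSemicontinuousOn_lowerEnv {s : Set (RN N)} {W : RN N → ℝ} {K : ℝ}
    (hK : ∀ x ∈ s, |W x| ≤ K) : LowerSemicontinuousOn (lowerEnv s W) s :=
  UpperSemicontinuousOn.neg_lsc
    (upperSemicontinuousOn_upperEnv (W := fun y => -W y) (K := K) (by simpa using hK))

/-- Lower semicontinuity of the operator at a test point. -/
lemma JumpKernel.exists_strict_nhd [NeZero N] (J : JumpKernel Ω μ j σ Cj) (hΩ : IsOpen Ω)
    (hO : AssumptionO Ω)
    (hH : ContinuousOn (fun q : RN N × RN N => H q.1 q.2) (closure Ω ×ˢ univ))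
    {v : RN N → ℝ} {K : ℝ} (hK0 : 0 ≤ K) (hv : ∀ x ∈ closure Ω, |v x| ≤ K)
    (hlsc : LowerSemicontinuousOn v (closure Ω)) {x₀ : RN N} (hx₀ : x₀ ∈ closure Ω)
    {φ : RN N → ℝ} (hφ : ContDiff ℝ 1 φ) {ξ η : ℝ} (hξ : 0 < ξ) (hη : 0 < η)
    (hlt : v x₀ - outerPart Ω μ j ξ v x₀ + H x₀ (gradient φ x₀) < -η) :
    ∃ ρ > 0, ∀ x ∈ closure Ω, ∀ c, ‖x - x₀‖ < ρ → |c - v x₀| < ρ →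
      c - J.outerC ξ v c x + H x (gradient φ x) ≤ -(η / 2) := by
  by_contra hcon
  push Not at hcon
  have htk : Tendsto (fun k : ℕ => 1 / ((k : ℝ) + 1)) atTop (𝓝 0) :=
    tendsto_one_div_add_atTop_nhds_zero_nat
  choose x hx c hxk hck hgt using fun k : ℕ => hcon (1 / ((k : ℝ) + 1)) (by positivity)
  have hxt : Tendsto x atTop (𝓝 x₀) := by
    rw [tendsto_iff_norm_sub_tendsto_zero]
    exact squeeze_zero (fun _ => norm_nonneg _) (fun k => (hxk k).le) htk
  have hct : Tendsto c atTop (𝓝 (v x₀)) := by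
    rw [tendsto_iff_norm_sub_tendsto_zero]
    exact squeeze_zero (fun _ => norm_nonneg _) (fun k => (hck k).le) htk
  have hvadm : Adm Ω v := adm_of_lsc ⟨K, hv⟩ hlsc
  have hcK : ∀ k, |c k| ≤ K + 1 := fun k => by
    have h1 : 1 / ((k : ℝ) + 1) ≤ 1 := by
      rw [div_le_one (by positivity)]; linarith [(Nat.cast_nonneg k : (0 : ℝ) ≤ k)]
    have h2 := abs_sub_abs_le_abs_sub (c k) (v x₀)
    linarith [hv x₀ hx₀, hck k]
  -- Upper semicontinuity of the outer part, applied to `-v`, is lower semicontinuity for `v`.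
  have hfat := J.eventually_outerC_le hΩ hO hx hx₀ hxt (c := fun k => -c k) (c₀ := -v x₀) hct.neg
    (f := fun _ y => -v y) (f₀ := fun y => -v y) (M := K + 1) (by linarith)
    (fun _ => hvadm.neg) hvadm.neg (fun _ y hy => by rw [abs_neg]; linarith [hv y hy])
    (fun y hy => by rw [abs_neg]; linarith [hv y hy]) (fun k => by rw [abs_neg]; exact hcK k)
    (by rw [abs_neg]; linarith [hv x₀ hx₀])
    (fun z hz ε hε => by
      have h1 := hlsc _ hz (v (x₀ + j x₀ z) - ε) (by linarith)
      rw [eventually_nhdsWithin_iff] at h1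
      filter_upwards [(J.tendsto_jump hx hx₀ hxt z).eventually h1] with k hk hkc
      linarith [hk hkc]) hξ (show 0 < η / 4 by linarith)
  have hHk : Tendsto (fun k => H (x k) (gradient φ (x k))) atTop (𝓝 (H x₀ (gradient φ x₀))) := by
    have h1 : Tendsto (fun k => (x k, gradient φ (x k))) atTop
        (𝓝[closure Ω ×ˢ univ] (x₀, gradient φ x₀)) :=
      tendsto_nhdsWithin_iff.2 ⟨hxt.prodMk_nhds
        (((continuous_gradient hφ).tendsto x₀).comp hxt),
        Eventually.of_forall fun k => ⟨hx k, mem_univ _⟩⟩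
    exact (hH (x₀, gradient φ x₀) ⟨hx₀, mem_univ _⟩).tendsto.comp h1
  have hge : ∀ᶠ k in atTop, outerPart Ω μ j ξ v x₀ - η / 4 - η / 2 ≤
      c k + H (x k) (gradient φ (x k)) := by
    filter_upwards [hfat] with k hk
    rw [J.outerC_neg, J.outerC_neg, ← J.outerPart_eq_outerC hx₀] at hk
    linarith [hgt k]
  have := ge_of_tendsto (hct.add hHk) hge
  linarith

/-- If the lower envelope of a subsolution fails to be a supersolution, then the subsolution is
not maximal. -/
theorem exists_larger_subsolution [NeZero N] (J : JumpKernel Ω μ j σ Cj) (hΩ : IsOpen Ω)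
    (hO : AssumptionO Ω)
    (hH : ContinuousOn (fun q : RN N × RN N => H q.1 q.2) (closure Ω ×ˢ univ))
    {W : RN N → ℝ} {K : ℝ} (hK0 : 0 ≤ K) (hW : IsSubsolution Ω μ j Cj H W)
    (hWK : ∀ x ∈ closure Ω, |W x| ≤ K) {x₀ : RN N} (hx₀ : x₀ ∈ closure Ω)
    {φ : RN N → ℝ} (hφ : ContDiff ℝ 1 φ)
    (hmin : ∀ᶠ y in 𝓝[closure Ω] x₀,
      lowerEnv (closure Ω) W x₀ - φ x₀ ≤ lowerEnv (closure Ω) W y - φ y)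
    (hcase : x₀ ∈ Ω ∨ normalDeriv Ω φ x₀ < 0)
    (hnot : ¬ SuperAt Ω μ j H (lowerEnv (closure Ω) W) x₀ (gradient φ x₀)) :
    ∃ w, IsSubsolution Ω μ j Cj H w ∧ (∀ y ∈ closure Ω, W y ≤ w y) ∧
      ∃ y ∈ closure Ω, W y < w y := by
  set v := lowerEnv (closure Ω) W with hvdef
  have hvW : ∀ x ∈ closure Ω, v x ≤ W x := fun x hx => lowerEnv_le hWK hx
  have hvK : ∀ x ∈ closure Ω, |v x| ≤ K := fun x hx => abs_lowerEnv_le hWK hx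
  have hlsc : LowerSemicontinuousOn v (closure Ω) := lowerSemicontinuousOn_lowerEnv hWK
  have hvadm : Adm Ω v := adm_of_lsc ⟨K, hvK⟩ hlsc
  have hWadm : Adm Ω W := adm_of_usc hW.1 hW.2.1
  -- Normalized to touch `v` at `x₀`, with `v - ψ ≥ ‖y - x₀‖²` nearby.
  set ψ : RN N → ℝ := fun y => φ y - ‖y - x₀‖ ^ 2 + (v x₀ - φ x₀) with hψdef
  have hψ : ContDiff ℝ 1 ψ := (hφ.sub (contDiff_normSq x₀)).add contDiff_const
  have hψ0 : ψ x₀ = v x₀ := by simp [hψdef]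
  have hgrad : gradient ψ x₀ = gradient φ x₀ := by
    rw [hψdef, gradient_add' ((hφ.sub (contDiff_normSq x₀)).differentiable one_ne_zero x₀)
      (differentiableAt_const _), gradient_sub' (hφ.differentiable one_ne_zero x₀)
      ((contDiff_normSq x₀).differentiable one_ne_zero x₀), gradient_normSq]
    simp
  obtain ⟨r, hr, hb⟩ := Metric.eventually_nhds_iff_ball.1 (eventually_nhdsWithin_iff.1 hmin)
  set r₁ := r / 2 with hr₁def
  have hr₁ : 0 < r₁ := by positivity
  have hb1 : ∀ y ∈ Metric.closedBall x₀ r₁, y ∈ closure Ω → ψ y + ‖y - x₀‖ ^ 2 ≤ v y := by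
    intro y hy hyc
    have := hb y (Metric.closedBall_subset_ball (by linarith) hy) hyc
    simp only [hψdef]
    linarith
  obtain ⟨L, hL0, hL⟩ := exists_lipschitz_closedBall hψ x₀ r₁
  have hCj := J.Cj_pos
  unfold SuperAt at hnot
  push Not at hnot
  obtain ⟨η, hη, hfreq⟩ := hnot
  have hsmall : ∀ᶠ ξ in 𝓝[>] (0 : ℝ), Cj * ξ ≤ r₁ / 2 := by
    have hc : Continuous fun ξ : ℝ => Cj * ξ := by fun_prop
    exact nhdsWithin_le_nhds ((hc.continuousAt.eventually_lt_const
      (show _ < r₁ / 2 by simp; positivity)).mono fun _ h => h.le)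
  obtain ⟨ξ, hξ1, hξ2, hξ3, hξ⟩ := (hfreq.and_eventually
    ((eventually_ballMoment_lt J (L * Cj) (show 0 < η / 4 by linarith)).and
      (hsmall.and self_mem_nhdsWithin))).exists
  have hξ : 0 < ξ := hξ
  rw [← hgrad] at hξ1
  obtain ⟨ρ, hρ, hstrict⟩ := J.exists_strict_nhd hΩ hO hH hK0 hvK hlsc hx₀ hψ hξ hη hξ1
  have hev : ∀ᶠ q in 𝓝 x₀, q ∈ frontier Ω → normalDeriv Ω ψ q < 0 := by
    by_cases hxf : x₀ ∈ frontier Ω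
    · rcases hcase with h | hnd
      · rw [hΩ.frontier_eq] at hxf; exact absurd h hxf.2
      · have hnd' : normalDeriv Ω ψ x₀ < 0 := by
          unfold normalDeriv at hnd ⊢; rwa [hgrad]
        exact eventually_nhdsWithin_iff.1
          ((tendsto_normalDeriv J hΩ hO hxf hψ).eventually (gt_mem_nhds hnd'))
    · filter_upwards [isClosed_frontier.isOpen_compl.mem_nhds hxf] with q hq hqf
      exact absurd hqf hq
  obtain ⟨ρ₂, hρ₂, hnd⟩ := Metric.eventually_nhds_iff_ball.1 hev
  -- On the ball of radius `s` the strict inequality `hstrict` and the sign of the normal derivative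
  -- hold; `L s ≤ ρ/4` together with `κ ≤ ρ/4` keeps the value `ψ + κ` within `ρ` of `v x₀`.
  obtain ⟨s, hs, hsρ, hsr, hsρ₂, hsL⟩ : ∃ s > 0, s ≤ ρ ∧ s ≤ r₁ / 2 ∧ s ≤ ρ₂ ∧ L * s ≤ ρ / 4 := by
    refine ⟨min (min ρ (r₁ / 2)) (min ρ₂ (ρ / (4 * (L + 1)))), by positivity,
      (min_le_left _ _).trans (min_le_left _ _), (min_le_left _ _).trans (min_le_right _ _),
      (min_le_right _ _).trans (min_le_left _ _), ?_⟩
    have h1 : min (min ρ (r₁ / 2)) (min ρ₂ (ρ / (4 * (L + 1)))) ≤ ρ / (4 * (L + 1)) :=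
      (min_le_right _ _).trans (min_le_right _ _)
    refine (mul_le_mul_of_nonneg_left h1 hL0).trans ?_
    rw [mul_div_assoc', div_le_div_iff₀ (by positivity) (by positivity)]
    nlinarith
  -- Lifting `ψ` by at most `(s/2)²` leaves it below `W` at distance between `s/2` and `s`, so the
  -- glued function coincides with `W` near the sphere of radius `s` and is upper semicontinuous.
  obtain ⟨κ, hκ, hκs, hκρ, hκ1⟩ : ∃ κ > 0, κ ≤ (s / 2) ^ 2 ∧ κ ≤ ρ / 4 ∧ κ ≤ 1 :=
    ⟨min (min ((s / 2) ^ 2) (ρ / 4)) 1, by positivity, (min_le_left _ _).trans (min_le_left _ _),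
      (min_le_left _ _).trans (min_le_right _ _), min_le_right _ _⟩
  classical
  set w : RN N → ℝ := fun y => if ‖y - x₀‖ < s then max (W y) (ψ y + κ) else W y with hw
  have hWw : ∀ y, W y ≤ w y := fun y => by
    simp only [hw]; split_ifs
    · exact le_max_left _ _
    · exact le_rfl
  have hfar : ∀ y ∈ closure Ω, s / 2 ≤ ‖y - x₀‖ → y ∈ Metric.closedBall x₀ r₁ →
      ψ y + κ ≤ W y := fun y hyc hy hyb => by
    have h1 := hb1 y hyb hyc
    have h2 : (s / 2) ^ 2 ≤ ‖y - x₀‖ ^ 2 := by gcongr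
    linarith [hvW y hyc]
  have hwfar : ∀ y ∈ closure Ω, s / 2 ≤ ‖y - x₀‖ → w y = W y := fun y hyc hy => by
    simp only [hw]; split_ifs with h
    · exact max_eq_left (hfar y hyc hy
        (by rw [mem_closedBall_iff_norm]; linarith))
    · rfl
  have hwψ : ∀ y ∈ closure Ω, y ∈ Metric.closedBall x₀ r₁ → ψ y + κ ≤ w y := fun y hyc hyb => by
    by_cases h : ‖y - x₀‖ < s
    · simp only [hw, if_pos h]; exact le_max_right _ _
    · exact (hfar y hyc (by linarith) hyb).trans (hWw y)
  have hwK : ∀ y ∈ closure Ω, |w y| ≤ K + 1 := fun y hyc => by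
    have h1 := abs_le.1 (hWK y hyc)
    refine abs_le.2 ⟨by linarith [hWw y], ?_⟩
    simp only [hw]; split_ifs with h
    · refine max_le (by linarith) ?_
      have := hb1 y (by rw [mem_closedBall_iff_norm]; linarith) hyc
      linarith [hvW y hyc, sq_nonneg ‖y - x₀‖]
    · linarith
  have hcn : Continuous fun y : RN N => ‖y - x₀‖ := by fun_prop
  have hwusc : UpperSemicontinuousOn w (closure Ω) := by
    intro y hyc c hc
    by_cases h : ‖y - x₀‖ < s
    · have hc' : max (W y) (ψ y + κ) < c := by simpa only [hw, if_pos h] using hc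
      have h1 := hW.2.1 y hyc c ((le_max_left _ _).trans_lt hc')
      have h2 : ∀ᶠ q in 𝓝[closure Ω] y, ψ q + κ < c := nhdsWithin_le_nhds
        ((hψ.continuous.add continuous_const).continuousAt.eventually_lt_const
          ((le_max_right _ _).trans_lt hc'))
      filter_upwards [h1, h2] with q h1 h2
      simp only [hw]; split_ifs
      · exact max_lt h1 h2
      · exact h1
    · have h1 := hW.2.1 y hyc c ((hWw y).trans_lt hc)
      have h2 : ∀ᶠ q in 𝓝[closure Ω] y, s / 2 < ‖q - x₀‖ := nhdsWithin_le_nhds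
        (hcn.continuousAt.eventually_const_lt (by linarith))
      filter_upwards [h1, h2, self_mem_nhdsWithin] with q h1 h2 h3
      rw [hwfar q h3 h2.le]
      exact h1
  have hwadm : Adm Ω w := adm_of_usc ⟨K + 1, hwK⟩ hwusc
  refine ⟨w, isSubsolution_of_jets J ⟨K + 1, hwK⟩ hwusc fun x hx f hf hmax => ?_,
    fun y _ => hWw y, ?_⟩
  · by_cases hxw : w x = W x
    · have hjet := hW.jet J hx hf.contDiffAt (hmax.mono fun y hy => by linarith [hWw y])
      exact ⟨fun h => (hjet.1 h).mono J hWadm hwadm hx (fun y _ => hWw y) hxw,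
        fun h => (hjet.2 h).imp_right fun h' =>
          h'.mono J hWadm hwadm hx (fun y _ => hWw y) hxw⟩
    · have hxs : ‖x - x₀‖ < s / 2 := by
        by_contra h
        exact hxw (hwfar x hx (not_lt.1 h))
      have hxw' : w x = ψ x + κ := by
        have h1 : ‖x - x₀‖ < s := by linarith
        simp only [hw, if_pos h1] at hxw ⊢
        rcases max_choice (W x) (ψ x + κ) with h | h
        · exact absurd h hxw
        · exact h
      have hxb : x ∈ Metric.closedBall x₀ r₁ := by rw [mem_closedBall_iff_norm]; linarith
      -- At a raised point a function touching `w` from above also touches the smooth `ψ + κ` from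
      -- above. Hence the gradients agree in the interior, and on the boundary the normal derivative
      -- of `f` is at most the negative one of `ψ`.
      have hmax' : ∀ᶠ y in 𝓝[closure Ω] x, ψ y - f y ≤ ψ x - f x := by
        have h1 : ∀ᶠ q in 𝓝[closure Ω] x, ‖q - x₀‖ < s := nhdsWithin_le_nhds
          (hcn.continuousAt.eventually_lt_const (by linarith))
        filter_upwards [hmax, h1, self_mem_nhdsWithin] with y h1 h2 h3
        have := hwψ y h3 (by rw [mem_closedBall_iff_norm]; linarith)
        linarith
      have hdψ := hψ.differentiable one_ne_zero x
      have hdf := hf.differentiable one_ne_zero x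
      refine ⟨fun hxΩ => ?_, fun hxf => Or.inl ?_⟩
      · have hloc : IsLocalMax (fun y => ψ y - f y) x := by
          rwa [IsLocalMax, IsMaxFilter, ← nhdsWithin_eq_nhds.2
            (mem_of_superset (hΩ.mem_nhds hxΩ) subset_closure)]
        have hg : gradient f x = gradient ψ x := by
          have h1 : gradient (fun y => ψ y - f y) x = 0 := by
            unfold gradient
            rw [hloc.fderiv_eq_zero, map_zero]
          rw [gradient_sub' hdψ hdf] at h1
          exact (sub_eq_zero.1 h1).symm
        rw [hg]
        intro ε hε
        have hle : ∀ᶠ ξ' in 𝓝[>] (0 : ℝ), ξ' < ξ := nhdsWithin_le_nhds (Iio_mem_nhds hξ)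
        filter_upwards [hle, self_mem_nhdsWithin] with ξ' h1 h2
        -- As `w ≥ ψ + κ` with equality at `x`, increments of `w` on small jumps are bounded below
        -- by those of `ψ`; passing from cutoff `ξ'` to `ξ` therefore costs less than `η/4`.
        have h3 := J.outerPart_le_outerPart_add hwadm.neg hx (show 0 < ξ' from h2) h1.le
          (K := L * Cj) (by positivity) fun z hz hzc => by
            have h5 : x + j x z ∈ Metric.closedBall x₀ r₁ :=
              J.norm_jump_le hx hxs.le hz (by linarith)
            have h6 := hwψ _ hzc h5
            have h7 := (neg_le_abs _).trans (hL _ hxb _ h5)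
            rw [add_sub_cancel_left] at h7
            have h8 := mul_le_mul_of_nonneg_left (J.le_up _ hx z) hL0
            linarith
        rw [outerPart_neg, outerPart_neg, J.outerPart_eq_outerC hx (ξ := ξ)] at h3
        have h4 := J.outerC_mono hvadm hwadm (fun y hy => (hvW y hy).trans (hWw y)) (w x) hx hξ
        have h5 := hstrict x hx (w x) (by linarith) (by
          have h6 := hL x₀ (Metric.mem_closedBall_self hr₁.le) x hxb
          have h7 : L * ‖x - x₀‖ ≤ L * s := by gcongr; linarith
          rw [hxw', ← hψ0, add_sub_right_comm]
          refine (abs_add_le _ _).trans_lt ?_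
          rw [abs_of_pos hκ]
          linarith)
        linarith
      · have h1 := normalDeriv_nonneg_of_max J hΩ hO hxf (hdψ.sub hdf) hmax'
        have h2 := hnd x (by rw [mem_ball_iff_norm]; linarith) hxf
        have h3 : normalDeriv Ω (ψ - f) x = normalDeriv Ω ψ x - normalDeriv Ω f x := by
          unfold normalDeriv
          rw [← inner_sub_left, ← gradient_sub' hdψ hdf]
          rfl
        rw [h3] at h1
        linarith
  -- By definition of the lower envelope `W` comes below `v x₀ + κ/2` arbitrarily near `x₀`, where
  -- `ψ + κ` exceeds this value.
  · have h1 : ∃ᶠ y in 𝓝[closure Ω] x₀, -v x₀ - κ / 2 < -W y :=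
      frequently_lt_of_lt_upperEnv hx₀ (by simp only [hvdef, lowerEnv]; linarith)
    have h2 : ∀ᶠ y in 𝓝[closure Ω] x₀, v x₀ - κ / 2 < ψ y := nhdsWithin_le_nhds
      (hψ.continuous.continuousAt.eventually_const_lt (by linarith))
    have h3 : ∀ᶠ q in 𝓝[closure Ω] x₀, ‖q - x₀‖ < s := nhdsWithin_le_nhds
      (hcn.continuousAt.eventually_lt_const (by simpa using hs))
    obtain ⟨y, h1, h2, h3, h4⟩ :=
      (h1.and_eventually (h2.and (h3.and self_mem_nhdsWithin))).exists
    exact ⟨y, h4, lt_of_lt_of_le (by linarith)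
      (hwψ y h4 (by rw [mem_closedBall_iff_norm]; linarith))⟩

end Bump

end CensoredNeumann

end


/-! ### Perron's method. -/

noncomputable section

namespace CensoredNeumann

open Set Filter Topology MeasureTheory

section Existence

variable {N : ℕ} {Ω : Set (RN N)} {μ : RN N → Measure (RN N)} {j : RN N → RN N → RN N}
  {σ Cj : ℝ} {H : RN N → RN N → ℝ}

lemma gradient_eq_zero_of_max [NeZero N] (hΩ : IsOpen Ω) {f : RN N → ℝ} {x : RN N} (hx : x ∈ Ω)
    (hmax : ∀ᶠ y in 𝓝[closure Ω] x, f y ≤ f x) : gradient f x = 0 := by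
  have hloc : IsLocalMax f x := by
    rwa [IsLocalMax, IsMaxFilter, ← nhdsWithin_eq_nhds.2
      (mem_of_superset (hΩ.mem_nhds hx) subset_closure)]
  unfold gradient
  rw [hloc.fderiv_eq_zero, map_zero]

lemma outerPart_const (Ω : Set (RN N)) (μ : RN N → Measure (RN N)) (j : RN N → RN N → RN N)
    (ξ c : ℝ) (x : RN N) : outerPart Ω μ j ξ (fun _ => c) x = 0 := by
  simp [outerPart]

lemma isSubsolution_const [NeZero N] (J : JumpKernel Ω μ j σ Cj) (hΩ : IsOpen Ω)
    (hO : AssumptionO Ω) {c : ℝ} (hc : ∀ x ∈ closure Ω, c + H x 0 ≤ 0) :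
    IsSubsolution Ω μ j Cj H (fun _ => c) := by
  refine isSubsolution_of_jets J ⟨|c|, fun _ _ => le_rfl⟩
    (upperSemicontinuous_const.upperSemicontinuousOn _) fun x hx φ hφ hmax => ?_
  have hmax' : ∀ᶠ y in 𝓝[closure Ω] x, (fun y => -φ y) y ≤ (fun y => -φ y) x :=
    hmax.mono fun y hy => by simp only; linarith
  have hd := hφ.differentiable one_ne_zero x
  refine ⟨fun hxΩ => ?_, fun hxf => Or.inl ?_⟩
  · have h1 := gradient_eq_zero_of_max hΩ hxΩ hmax'
    rw [gradient_neg', neg_eq_zero] at h1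
    intro η hη
    refine Eventually.of_forall fun ξ => ?_
    rw [outerPart_const, h1]
    linarith [hc x hx]
  · have h1 := normalDeriv_nonneg_of_max J hΩ hO hxf hd.neg hmax'
    have h2 : normalDeriv Ω (-φ) x = -normalDeriv Ω φ x := normalDeriv_neg φ x
    linarith

lemma isSupersolution_const [NeZero N] (J : JumpKernel Ω μ j σ Cj) (hΩ : IsOpen Ω)
    (hO : AssumptionO Ω) {c : ℝ} (hc : ∀ x ∈ closure Ω, 0 ≤ c + H x 0) :
    IsSupersolution Ω μ j Cj H (fun _ => c) := by
  refine isSupersolution_of_dual (isSubsolution_const J hΩ hO fun x hx => ?_)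
  have := hc x hx
  simp only [dualH, neg_zero]
  linarith

/-- Perron's method: existence, uniqueness and continuity of the solution follow from the
comparison principle. -/
theorem exists_unique_of_comparison [NeZero N] (J : JumpKernel Ω μ j σ Cj) (hΩ : IsOpen Ω)
    (hO : AssumptionO Ω)
    (hH : ContinuousOn (fun q : RN N × RN N => H q.1 q.2) (closure Ω ×ˢ univ))
    (hE : AssumptionE Ω H)
    (hcomp : ∀ u v, IsSubsolution Ω μ j Cj H u → IsSupersolution Ω μ j Cj H v →
      ∀ x ∈ closure Ω, u x ≤ v x) :
    ∃ u : RN N → ℝ, IsViscositySolution Ω μ j Cj H u ∧ ContinuousOn u (closure Ω) ∧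
      ∀ v : RN N → ℝ, IsViscositySolution Ω μ j Cj H v → EqOn v u (closure Ω) := by
  obtain ⟨K, hK, hHK⟩ := hE 0
  have hK0 : ∀ x ∈ closure Ω, |H x 0| ≤ K := hHK 0 (by simp)
  have hsub : IsSubsolution Ω μ j Cj H (fun _ => -K) :=
    isSubsolution_const J hΩ hO fun x hx => by linarith [(abs_le.1 (hK0 x hx)).2]
  have hsup : IsSupersolution Ω μ j Cj H (fun _ => K) :=
    isSupersolution_const J hΩ hO fun x hx => by linarith [(abs_le.1 (hK0 x hx)).1]
  set S : Set (RN N → ℝ) := {w | IsSubsolution Ω μ j Cj H w ∧ ∀ x ∈ closure Ω, |w x| ≤ K}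
    with hSdef
  have hmem : (fun _ => -K) ∈ S := ⟨hsub, fun x _ => by rw [abs_neg, abs_of_pos hK]⟩
  set W : RN N → ℝ := fun x => sSup ((fun w : RN N → ℝ => w x) '' S) with hWdef
  have hbdd : ∀ x ∈ closure Ω, ∀ c ∈ (fun w : RN N → ℝ => w x) '' S, c ≤ K := by
    rintro x hx c ⟨w, hw, rfl⟩
    exact (le_abs_self _).trans (hw.2 x hx)
  have hle : ∀ w ∈ S, ∀ x ∈ closure Ω, w x ≤ W x := fun w hw x hx =>
    le_csSup ⟨K, hbdd x hx⟩ ⟨w, hw, rfl⟩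
  have hne : ∀ x, ((fun w : RN N → ℝ => w x) '' S).Nonempty := fun x => ⟨_, _, hmem, rfl⟩
  have hWK : ∀ x ∈ closure Ω, |W x| ≤ K := fun x hx =>
    abs_le.2 ⟨hle _ hmem x hx, csSup_le (hne x) (hbdd x hx)⟩
  have hlub : ∀ x ∈ closure Ω, ∀ c < W x, ∃ w ∈ S, c < w x := fun x _ c hc => by
    obtain ⟨_, ⟨w, hw, rfl⟩, h⟩ := exists_lt_of_lt_csSup (hne x) hc
    exact ⟨w, hw, h⟩
  have hU := isSubsolution_upperEnv J hΩ hO hH hK.le (fun w hw => hw) hWK hle hlub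
  set U := upperEnv (closure Ω) W
  have hUK : ∀ x ∈ closure Ω, |U x| ≤ K := fun x hx => abs_upperEnv_le hWK hx
  have hUS : U ∈ S := ⟨hU, hUK⟩
  set V := lowerEnv (closure Ω) U with hV
  have hVU : ∀ x ∈ closure Ω, V x ≤ U x := fun x hx => lowerEnv_le hUK hx
  have hVsup : IsSupersolution Ω μ j Cj H V := by
    refine isSupersolution_of_jets J ⟨K, fun x hx => abs_lowerEnv_le hUK hx⟩
      (lowerSemicontinuousOn_lowerEnv hUK) fun x hx φ hφ hmin => ?_
    have key : (x ∈ Ω ∨ normalDeriv Ω φ x < 0) → SuperAt Ω μ j H V x (gradient φ x) := by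
      intro hcase
      by_contra hnot
      obtain ⟨w, hw, hUw, y, hy, hlt⟩ :=
        exists_larger_subsolution J hΩ hO hH hK.le hU hUK hx hφ hmin hcase hnot
      -- The larger subsolution may violate the bound `K` by construction; comparison with the
      -- constant supersolution `K` restores it, so that `w` belongs to the class.
      have hwS : w ∈ S := ⟨hw, fun x hx => abs_le.2
        ⟨(neg_le_of_abs_le (hUK x hx)).trans (hUw x hx), hcomp w _ hw hsup x hx⟩⟩
      have h1 := hle w hwS y hy
      have h2 := le_upperEnv hWK hy
      linarith
    refine ⟨fun h => key (Or.inl h), fun _ => ?_⟩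
    rcases le_or_gt 0 (normalDeriv Ω φ x) with h | h
    · exact Or.inl h
    · exact Or.inr (key (Or.inr h))
  have hEq : EqOn V U (closure Ω) := fun x hx =>
    le_antisymm (hVU x hx) (hcomp U V hU hVsup x hx)
  have hlsc := hVsup.2.1
  have hlscU : LowerSemicontinuousOn U (closure Ω) := by
    intro x hx c hc
    rw [← hEq hx] at hc
    filter_upwards [hlsc x hx c hc, self_mem_nhdsWithin] with y hy hyc
    rwa [← hEq hyc]
  -- `V` and `U` agree only on `closure Ω`, so the supersolution property is transferred through
  -- quantities that depend on those values alone.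
  have hUsup : IsSupersolution Ω μ j Cj H U := by
    refine isSupersolution_of_jets J ⟨K, hUK⟩ hlscU fun x hx φ hφ hmin => ?_
    have h := hVsup.jet J hx hφ.contDiffAt (by
      filter_upwards [hmin, self_mem_nhdsWithin] with y hy hyc
      rw [hEq hyc, hEq hx]
      exact hy)
    have hS : SuperAt Ω μ j H V x (gradient φ x) → SuperAt Ω μ j H U x (gradient φ x) := by
      intro h η hη
      filter_upwards [h η hη] with ξ hξ
      have e : outerPart Ω μ j ξ V x = outerPart Ω μ j ξ U x := by
        rw [J.outerPart_eq_outerC hx, J.outerPart_eq_outerC hx]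
        unfold JumpKernel.outerC
        congr 1
        ext z
        congr 1
        ext z
        simp only [indicator]
        split_ifs with hz
        · rw [hEq hz, hEq hx]
        · rfl
      rwa [hEq hx, e] at hξ
    exact ⟨fun hxΩ => hS (h.1 hxΩ), fun hxf => (h.2 hxf).imp_right hS⟩
  refine ⟨U, ⟨hU, hUsup⟩, ?_, fun v hv x hx =>
    le_antisymm (hcomp v U hv.1 hUsup x hx) (hcomp U v hU hv.2 x hx)⟩
  intro x hx
  exact continuousWithinAt_iff_lower_upperSemicontinuousWithinAt.2 ⟨hlscU x hx, hU.2.1 x hx⟩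

end Existence

end CensoredNeumann

end


/-! ### Double increments of `C^{1,1}` functions. -/

noncomputable section

namespace CensoredNeumann

open Set Filter Topology MeasureTheory

section DoubleIncrement

variable {N : ℕ} {F : Type*} [NormedAddCommGroup F] [NormedSpace ℝ F]

/-- `e` is of class `C^{1,1}` on the ball of radius `r` about `x₀`. -/
structure IsC11Near (e : RN N → F) (x₀ : RN N) (r C : ℝ) : Prop where
  diff : ∀ x ∈ Metric.ball x₀ r, DifferentiableAt ℝ e x
  lip : ∀ x ∈ Metric.ball x₀ r, ∀ y ∈ Metric.ball x₀ r,
    ‖fderiv ℝ e x - fderiv ℝ e y‖ ≤ C * ‖x - y‖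
  norm_le : ∀ x ∈ Metric.ball x₀ r, ‖fderiv ℝ e x‖ ≤ 2

lemma IsDefiningAt.isC11Near {Ω : Set (RN N)} {j : RN N → RN N → RN N} {x₀ : RN N}
    {D : RN N → ℝ} {r C : ℝ} (hD : IsDefiningAt Ω j x₀ D r C) : IsC11Near D x₀ r C :=
  ⟨hD.diff, hD.lip, hD.norm_le⟩

variable {e : RN N → F} {x₀ : RN N} {r C : ℝ}

lemma IsC11Near.contDiffAt (he : IsC11Near e x₀ r C) {x : RN N} (hx : x ∈ Metric.ball x₀ r) :
    ContDiffAt ℝ 1 e x := by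
  have h : ContDiffOn ℝ 1 e (Metric.ball x₀ r) := by
    rw [show (1 : WithTop ℕ∞) = 0 + 1 by simp,
      contDiffOn_succ_iff_fderiv_of_isOpen Metric.isOpen_ball]
    refine ⟨fun y hy => (he.diff y hy).differentiableWithinAt, by simp, contDiffOn_zero.2 ?_⟩
    have : LipschitzOnWith (Real.toNNReal C) (fderiv ℝ e) (Metric.ball x₀ r) :=
      LipschitzOnWith.of_dist_le_mul fun y hy y' hy' => by
        rw [dist_eq_norm, dist_eq_norm]
        exact (he.lip y hy y' hy').trans
          (mul_le_mul_of_nonneg_right (Real.le_coe_toNNReal C) (norm_nonneg _))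
    exact this.continuousOn
  exact h.contDiffAt (Metric.isOpen_ball.mem_nhds hx)

lemma IsC11Near.norm_sub_le (he : IsC11Near e x₀ r C) {x y : RN N} (hx : x ∈ Metric.ball x₀ r)
    (hy : y ∈ Metric.ball x₀ r) : ‖e x - e y‖ ≤ 2 * ‖x - y‖ :=
  (convex_ball x₀ r).norm_image_sub_le_of_norm_fderiv_le he.diff he.norm_le hy hx

lemma add_mem_ball_of_half {x w : RN N} (hx : x ∈ Metric.ball x₀ (r / 2)) (hw : ‖w‖ < r / 2) :
    x + w ∈ Metric.ball x₀ r := by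
  rw [mem_ball_iff_norm] at hx ⊢
  rw [add_sub_right_comm]
  linarith [norm_add_le (x - x₀) w]

/-- The mean value inequality applied to `h ↦ e (h + w) - e h`, whose derivative is `O(|w|)` because
that of `e` is Lipschitz. The product `|w||x - y|` is small enough to survive multiplication by `ν`.
-/
lemma IsC11Near.norm_double_incr_le (he : IsC11Near e x₀ r C) {x y w w' : RN N}
    (hx : x ∈ Metric.ball x₀ (r / 2)) (hy : y ∈ Metric.ball x₀ (r / 2)) (hw : ‖w‖ < r / 2)
    (hw' : ‖w'‖ < r / 2) :
    ‖(e (x + w) - e x) - (e (y + w') - e y)‖ ≤ C * ‖w‖ * ‖x - y‖ + 2 * ‖w - w'‖ := by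
  have hr : 0 < r := by linarith [norm_nonneg w]
  have hsub : ∀ h ∈ Metric.ball x₀ (r / 2), h ∈ Metric.ball x₀ r := fun h hh =>
    Metric.ball_subset_ball (by linarith) hh
  have hfd : ∀ h ∈ Metric.ball x₀ (r / 2), HasFDerivAt (fun h => e (h + w) - e h)
      (fderiv ℝ e (h + w) - fderiv ℝ e h) h := fun h hh =>
    ((hasFDerivAt_comp_add_right w).2 (he.diff _ (add_mem_ball_of_half hh hw)).hasFDerivAt).sub
      (he.diff _ (hsub h hh)).hasFDerivAt
  have h1 : ‖(e (x + w) - e x) - (e (y + w) - e y)‖ ≤ C * ‖w‖ * ‖x - y‖ := by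
    refine (convex_ball x₀ (r / 2)).norm_image_sub_le_of_norm_hasFDerivWithin_le
      (f := fun h => e (h + w) - e h) (fun h hh => (hfd h hh).hasFDerivWithinAt)
      (fun h hh => ?_) hy hx
    have := he.lip _ (add_mem_ball_of_half hh hw) _ (hsub h hh)
    rwa [add_sub_cancel_left] at this
  have h2 : ‖e (y + w) - e (y + w')‖ ≤ 2 * ‖w - w'‖ := by
    have := he.norm_sub_le (add_mem_ball_of_half hy hw) (add_mem_ball_of_half hy hw')
    rwa [add_sub_add_left_eq_sub] at this
  calc ‖(e (x + w) - e x) - (e (y + w') - e y)‖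
      = ‖((e (x + w) - e x) - (e (y + w) - e y)) + (e (y + w) - e (y + w'))‖ := by
        congr 1; abel
    _ ≤ _ := (norm_add_le _ _).trans (add_le_add h1 h2)

end DoubleIncrement

/-! ### Comparison of the operator at two points and the mismatched jumps. -/

section TwoPoint

variable {N : ℕ} {Ω : Set (RN N)} {μ : RN N → Measure (RN N)} {j : RN N → RN N → RN N}
  {σ Cj : ℝ} {H : RN N → RN N → ℝ}

/-- The jumps which are admissible at exactly one of two points. -/
def mismatch (Ω : Set (RN N)) (j : RN N → RN N → RN N) (x y : RN N) : Set (RN N) :=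
  {z | ¬(x + j x z ∈ closure Ω ↔ y + j y z ∈ closure Ω)}

lemma JumpKernel.measurableSet_mismatch (J : JumpKernel Ω μ j σ Cj) {x y : RN N}
    (hx : x ∈ closure Ω) (hy : y ∈ closure Ω) : MeasurableSet (mismatch Ω j x y) := by
  have h : mismatch Ω j x y = (jumpSet Ω j x \ jumpSet Ω j y) ∪ (jumpSet Ω j y \ jumpSet Ω j x) := by
    ext z
    simp only [mismatch, jumpSet, mem_ofPred_eq, mem_union, Set.mem_sdiff]
    tauto
  rw [h]
  exact ((J.measurableSet_jumpSet hx).diff (J.measurableSet_jumpSet hy)).union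
    ((J.measurableSet_jumpSet hy).diff (J.measurableSet_jumpSet hx))

lemma JumpKernel.integrable_mismatch [NeZero N] (J : JumpKernel Ω μ j σ Cj) {x y : RN N}
    (hx : x ∈ closure Ω) (hy : y ∈ closure Ω) {B L : ℝ} (hB : 0 ≤ B) (hL : 0 ≤ L) :
    Integrable fun z => (mismatch Ω j x y).indicator (fun z => min B (L * ‖z‖)) z * kern σ z := by
  refine integrable_mul_kern_of_le (C := max B L) J.σ_pos J.σ_lt_one
    ((measurable_const.min (measurable_norm.const_mul L)).indicator
      (J.measurableSet_mismatch hx hy)).aestronglyMeasurable fun z => ?_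
  by_cases h : z ∈ mismatch Ω j x y
  · rw [indicator_of_mem h]
    exact abs_min_le_max_mul_min (norm_nonneg z) hB hL
  · rw [indicator_of_notMem h, abs_zero]
    exact mul_nonneg (le_max_of_le_left hB) (le_min zero_le_one (norm_nonneg _))

/-- The censored operators at two points, in terms of the increments. -/
lemma JumpKernel.outerPart_add_outerPart_le [NeZero N] (J : JumpKernel Ω μ j σ Cj)
    {U V : RN N → ℝ} (hU : Adm Ω U) (hV : Adm Ω V) {x y : RN N} (hx : x ∈ closure Ω)
    (hy : y ∈ closure Ω) {B B' L θ : ℝ} (hB : 0 ≤ B) (hB' : 0 ≤ B') (hL : 0 ≤ L) (hθ : 0 ≤ θ)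
    (hpair : ∀ z, x + j x z ∈ closure Ω → y + j y z ∈ closure Ω →
      U (x + j x z) - U x + (V (y + j y z) - V y) ≤ min B' (θ * (‖z‖ + ‖z‖ ^ 2)))
    (hincU : ∀ z, x + j x z ∈ closure Ω → U (x + j x z) - U x ≤ min B (L * ‖z‖))
    (hincV : ∀ z, y + j y z ∈ closure Ω → V (y + j y z) - V y ≤ min B (L * ‖z‖))
    {ξ : ℝ} (hξ : 0 < ξ) :
    outerPart Ω μ j ξ U x + outerPart Ω μ j ξ V y ≤
      J.C * (∫ z : RN N, min B' (θ * (‖z‖ + ‖z‖ ^ 2)) * kern σ z) +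
      J.D * ‖x - y‖ * (∫ z : RN N, min B (L * ‖z‖) * kern σ z) +
      J.C * (∫ z, (mismatch Ω j x y).indicator (fun z => min B (L * ‖z‖)) z * kern σ z) := by
  have i1 := (integrable_min_quad_kern (N := N) J.σ_pos J.σ_lt_one hB' hθ).const_mul J.C
  have i2 := (integrable_min_lin_kern (N := N) J.σ_pos J.σ_lt_one hB hL).const_mul (J.D * ‖x - y‖)
  have i3 := (J.integrable_mismatch hx hy hB hL).const_mul J.C
  have i12 : Integrable fun z : RN N => J.C * (min B' (θ * (‖z‖ + ‖z‖ ^ 2)) * kern σ z) +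
      J.D * ‖x - y‖ * (min B (L * ‖z‖) * kern σ z) := i1.add i2
  rw [J.outerPart_eq hx, J.outerPart_eq hy,
    ← integral_add (J.integrable_outer hU hx hξ) (J.integrable_outer hV hy hξ),
    ← integral_const_mul, ← integral_const_mul, ← integral_const_mul,
    ← integral_add i1 i2, ← integral_add i12 i3]
  refine integral_mono ((J.integrable_outer hU hx hξ).add (J.integrable_outer hV hy hξ))
    (i12.add i3) fun z => ?_
  simp only
  have hk := kern_nonneg (N := N) (σ := σ) z
  have hq : 0 ≤ min B' (θ * (‖z‖ + ‖z‖ ^ 2)) := le_min hB' (by positivity)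
  have hl : 0 ≤ min B (L * ‖z‖) := le_min hB (by positivity)
  have n1 : 0 ≤ J.C * (min B' (θ * (‖z‖ + ‖z‖ ^ 2)) * kern σ z) :=
    mul_nonneg J.C_pos.le (mul_nonneg hq hk)
  have n2 : 0 ≤ J.D * ‖x - y‖ * (min B (L * ‖z‖) * kern σ z) :=
    mul_nonneg (mul_nonneg J.D_pos.le (norm_nonneg _)) (mul_nonneg hl hk)
  have n3 : 0 ≤ J.C * ((mismatch Ω j x y).indicator (fun z => min B (L * ‖z‖)) z * kern σ z) :=
    mul_nonneg J.C_pos.le (mul_nonneg (indicator_nonneg (fun z _ => le_min hB (by positivity)) _) hk)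
  by_cases hz : z ∈ {z : RN N | ξ ≤ ‖z‖}
  swap
  · rw [indicator_of_notMem hz, indicator_of_notMem hz]
    linarith
  rw [indicator_of_mem hz, indicator_of_mem hz]
  have hz0 : z ≠ 0 := by
    rintro rfl
    have : ξ ≤ ‖(0 : RN N)‖ := hz
    rw [norm_zero] at this
    linarith
  by_cases h1 : x + j x z ∈ closure Ω <;> by_cases h2 : y + j y z ∈ closure Ω
  · have e1 : J.incr U x z = J.g x z * (U (x + j x z) - U x) := indicator_of_mem (by exact h1) _
    have e2 : J.incr V y z = J.g y z * (V (y + j y z) - V y) := indicator_of_mem (by exact h2) _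
    have hp := hpair z h1 h2
    have hu := hincU z h1
    have hv := hincV z h2
    have hlip := abs_le.1 (J.g_lip x hx y hy z hz0)
    have gx0 := J.nonneg x hx z
    have gy0 := J.nonneg y hy z
    have gx := J.g_le x hx z hz0
    have gy := J.g_le y hy z hz0
    rw [e1, e2]
    set a := U (x + j x z) - U x
    set b := V (y + j y z) - V y
    -- The joint increment is paired with the smaller density; the excess of the larger density
    -- multiplies a single increment and is controlled by the Lipschitz bound of (M).
    rcases le_total (J.g x z) (J.g y z) with h | h
    · have f1 : J.g x z * (a + b) ≤ (J.C * kern σ z) * min B' (θ * (‖z‖ + ‖z‖ ^ 2)) :=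
        (mul_le_mul_of_nonneg_left hp gx0).trans (mul_le_mul_of_nonneg_right gx hq)
      have f2 : (J.g y z - J.g x z) * b ≤ (J.D * ‖x - y‖ * kern σ z) * min B (L * ‖z‖) :=
        (mul_le_mul_of_nonneg_left hv (by linarith)).trans
          (mul_le_mul_of_nonneg_right (by linarith) hl)
      nlinarith
    · have f1 : J.g y z * (a + b) ≤ (J.C * kern σ z) * min B' (θ * (‖z‖ + ‖z‖ ^ 2)) :=
        (mul_le_mul_of_nonneg_left hp gy0).trans (mul_le_mul_of_nonneg_right gy hq)
      have f2 : (J.g x z - J.g y z) * a ≤ (J.D * ‖x - y‖ * kern σ z) * min B (L * ‖z‖) :=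
        (mul_le_mul_of_nonneg_left hu (by linarith)).trans
          (mul_le_mul_of_nonneg_right (by linarith) hl)
      nlinarith
  · have e2 : J.incr V y z = 0 := indicator_of_notMem (by exact h2) _
    have hm : z ∈ mismatch Ω j x y := fun h => h2 (h.1 h1)
    have f := J.incr_le hx hl (hincU z)
    rw [e2, indicator_of_mem hm]
    linarith
  · have e1 : J.incr U x z = 0 := indicator_of_notMem (by exact h1) _
    have hm : z ∈ mismatch Ω j x y := fun h => h1 (h.2 h2)
    have f := J.incr_le hy hl (hincV z)
    rw [e1, indicator_of_mem hm]
    linarith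
  · have e1 : J.incr U x z = 0 := indicator_of_notMem (by exact h1) _
    have e2 : J.incr V y z = 0 := indicator_of_notMem (by exact h2) _
    rw [e1, e2]
    linarith

lemma JumpKernel.outerPart_le_of_incr [NeZero N] (J : JumpKernel Ω μ j σ Cj)
    {U : RN N → ℝ} (hU : Adm Ω U) {x : RN N} (hx : x ∈ closure Ω)
    {B L : ℝ} (hB : 0 ≤ B) (hL : 0 ≤ L)
    (hincU : ∀ z, x + j x z ∈ closure Ω → U (x + j x z) - U x ≤ min B (L * ‖z‖))
    {ξ : ℝ} (hξ : 0 < ξ) :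
    outerPart Ω μ j ξ U x ≤ J.C * (∫ z : RN N, min B (L * ‖z‖) * kern σ z) := by
  rw [J.outerPart_eq hx, ← integral_const_mul]
  refine integral_mono (J.integrable_outer hU hx hξ)
    ((integrable_min_lin_kern (N := N) J.σ_pos J.σ_lt_one hB hL).const_mul J.C) fun z => ?_
  have hl : 0 ≤ min B (L * ‖z‖) := le_min hB (by positivity)
  by_cases hz : z ∈ {z : RN N | ξ ≤ ‖z‖}
  · rw [indicator_of_mem hz]
    exact J.incr_le hx hl (hincU z)
  · rw [indicator_of_notMem hz]
    exact mul_nonneg J.C_pos.le (mul_nonneg hl (kern_nonneg z))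

/-- Away from the singularity the kernel is integrable and no rate is needed: for almost every `z`
the jumps from the two points are eventually admissible together or excluded together. -/
lemma JumpKernel.tendsto_mismatch_far [NeZero N] (J : JumpKernel Ω μ j σ Cj) (hΩ : IsOpen Ω)
    (hO : AssumptionO Ω) {x y : ℕ → RN N} {x₀ : RN N} (hx : ∀ k, x k ∈ closure Ω)
    (hy : ∀ k, y k ∈ closure Ω) (hx₀ : x₀ ∈ closure Ω) (hxl : Tendsto x atTop (𝓝 x₀))
    (hyl : Tendsto y atTop (𝓝 x₀)) {r : ℝ} (hr : 0 < r) :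
    Tendsto (fun k => ∫ z, ({z : RN N | r ≤ ‖z‖} ∩ mismatch Ω j (x k) (y k)).indicator 1 z *
      kern σ z) atTop (𝓝 0) := by
  have hms : ∀ k, MeasurableSet ({z : RN N | r ≤ ‖z‖} ∩ mismatch Ω j (x k) (y k)) := fun k =>
    (measurableSet_le measurable_const measurable_norm).inter
      (J.measurableSet_mismatch (hx k) (hy k))
  have h0 : (0 : ℝ) = ∫ _ : RN N, (0 : ℝ) := by simp
  rw [h0]
  refine tendsto_integral_of_dominated_convergence
    (fun z => {z : RN N | r ≤ ‖z‖}.indicator 1 z * kern σ z) (fun k => ?_) ?_ (fun k => ?_) ?_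
  · exact ((measurable_one.indicator (hms k)).mul measurable_kern).aestronglyMeasurable
  · refine integrable_mul_kern_of_le (C := 1 / min 1 r) J.σ_pos J.σ_lt_one
      (measurable_one.indicator
        (measurableSet_le measurable_const measurable_norm)).aestronglyMeasurable fun z => ?_
    have hm : 0 < min 1 r := lt_min one_pos hr
    by_cases hz : r ≤ ‖z‖
    · rw [indicator_of_mem (by exact hz), Pi.one_apply, abs_one, one_div, ← div_eq_inv_mul,
        le_div_iff₀ hm, one_mul]
      exact min_le_min_left _ hz
    · rw [indicator_of_notMem (by exact hz), abs_zero]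
      have := norm_nonneg z
      positivity
  · refine ae_of_all _ fun z => ?_
    refine (abs_of_nonneg (mul_nonneg (indicator_nonneg (fun _ _ => zero_le_one) _)
      (kern_nonneg z))).trans_le ?_
    exact mul_le_mul_of_nonneg_right (indicator_le_indicator_of_subset inter_subset_left
      (fun _ => zero_le_one) z) (kern_nonneg z)
  · filter_upwards [ae_notMem_frontier J hΩ hO hx₀] with z hz
    refine tendsto_const_nhds.congr' ?_
    have htx := J.tendsto_jump hx hx₀ hxl z
    have hty := J.tendsto_jump hy hx₀ hyl z
    have hev : ∀ᶠ k in atTop, z ∉ mismatch Ω j (x k) (y k) := by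
      by_cases hc : x₀ + j x₀ z ∈ closure Ω
      · have hin : x₀ + j x₀ z ∈ Ω := by
          by_contra h
          rw [hΩ.frontier_eq] at hz
          exact hz ⟨hc, h⟩
        filter_upwards [htx.eventually (hΩ.mem_nhds hin), hty.eventually (hΩ.mem_nhds hin)]
          with k h1 h2
        exact fun h => h (iff_of_true (subset_closure h1) (subset_closure h2))
      · have ho := isClosed_closure.isOpen_compl.mem_nhds hc
        filter_upwards [htx.eventually ho, hty.eventually ho] with k h1 h2
        exact fun h => h (iff_of_false h1 h2)
    filter_upwards [hev] with k hk
    rw [indicator_of_notMem (fun h => hk h.2), zero_mul]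

/-- Near the singularity the mismatch is contained in a thin layer about the boundary. -/
lemma IsDefiningAt.abs_le_of_mismatch (J : JumpKernel Ω μ j σ Cj) {D : RN N → ℝ} {r C : ℝ}
    {x₀ : RN N} (hD : IsDefiningAt Ω j x₀ D r C) {x y : RN N} (hx : x ∈ closure Ω)
    (hy : y ∈ closure Ω) (hxb : x ∈ Metric.ball x₀ (r / 2)) (hyb : y ∈ Metric.ball x₀ (r / 2))
    {η : ℝ} (hη : |D x - D y| ≤ η) {z : RN N} (hz : Cj * ‖z‖ < r / 2)
    (hm : z ∈ mismatch Ω j x y) :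
    |D (x + j x z)| ≤ η + (C * Cj + 2 * J.jlip) * ‖x - y‖ * ‖z‖ := by
  have hw := (J.le_up x hx z).trans_lt hz
  have hw' := (J.le_up y hy z).trans_lt hz
  have h1 := hD.isC11Near.norm_double_incr_le hxb hyb hw hw'
  rw [Real.norm_eq_abs] at h1
  have h2 : C * ‖j x z‖ * ‖x - y‖ ≤ C * (Cj * ‖z‖) * ‖x - y‖ :=
    mul_le_mul_of_nonneg_right (mul_le_mul_of_nonneg_left (J.le_up x hx z) hD.C_nonneg)
      (norm_nonneg _)
  have h3 := J.j_lip x hx y hy z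
  have h4 : |D (x + j x z) - D (y + j y z)| ≤
      η + (C * Cj + 2 * J.jlip) * ‖x - y‖ * ‖z‖ := by
    have h5 := abs_add_le (D (x + j x z) - D x - (D (y + j y z) - D y)) (D x - D y)
    rw [show D (x + j x z) - D x - (D (y + j y z) - D y) + (D x - D y) =
      D (x + j x z) - D (y + j y z) by ring] at h5
    nlinarith
  -- One landing point is inside and the other outside, so `D` has opposite weak signs there and
  -- each value is bounded by the difference.
  by_cases hxz : x + j x z ∈ closure Ω
  · have hyz : y + j y z ∉ closure Ω := fun h => hm (iff_of_true hxz h)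
    have h5 := hD.nonneg _ hxz
    have h6 := hD.nonpos _ (add_mem_ball_of_half hyb hw') hyz
    rw [abs_of_nonneg h5]
    linarith [le_abs_self (D (x + j x z) - D (y + j y z))]
  · have hyz : y + j y z ∈ closure Ω := by
      by_contra h
      exact hm (iff_of_false hxz h)
    have h5 := hD.nonneg _ hyz
    have h6 := hD.nonpos _ (add_mem_ball_of_half hxb hw) hxz
    rw [abs_of_nonpos h6]
    linarith [neg_le_abs (D (x + j x z) - D (y + j y z))]

/-- The contribution of the mismatched jumps vanishes in the limit. -/
lemma JumpKernel.tendsto_mismatch [NeZero N] (J : JumpKernel Ω μ j σ Cj) (hΩ : IsOpen Ω)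
    (hO : AssumptionO Ω) {x y : ℕ → RN N} {x₀ : RN N} (hx : ∀ k, x k ∈ closure Ω)
    (hy : ∀ k, y k ∈ closure Ω) (hx₀ : x₀ ∈ closure Ω) (hxl : Tendsto x atTop (𝓝 x₀))
    (hyl : Tendsto y atTop (𝓝 x₀)) {D : RN N → ℝ} {r C : ℝ} (hD : IsDefiningAt Ω j x₀ D r C)
    {L η s : ℕ → ℝ} (hL : ∀ k, 1 ≤ L k) (hη : ∀ k, 0 ≤ η k) (hs : ∀ k, 0 < s k)
    (hDxy : ∀ᶠ k in atTop, |D (x k) - D (y k)| ≤ η k)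
    (h1 : Tendsto (fun k => L k * ‖x k - y k‖) atTop (𝓝 0))
    (h2 : Tendsto (fun k => L k * ballMoment N σ (s k)) atTop (𝓝 0))
    (h3 : Tendsto (fun k => L k * (η k / s k)) atTop (𝓝 0)) {B : ℝ} (hB : 0 ≤ B) :
    Tendsto (fun k => ∫ z, (mismatch Ω j (x k) (y k)).indicator (fun z => min B (L k * ‖z‖)) z *
      kern σ z) atTop (𝓝 0) := by
  have hr := hD.r_pos
  have hCj := J.Cj_pos
  obtain ⟨ρ, hρ, hρr, hρ2⟩ : ∃ ρ > 0, ρ < r ∧ Cj * ρ < r / 2 := by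
    refine ⟨min (r / 2) (r / (4 * Cj)), by positivity, (min_le_left _ _).trans_lt (by linarith), ?_⟩
    calc Cj * min (r / 2) (r / (4 * Cj)) ≤ Cj * (r / (4 * Cj)) :=
          mul_le_mul_of_nonneg_left (min_le_right _ _) hCj.le
      _ = r / 4 := by field_simp
      _ < r / 2 := by linarith
  obtain ⟨C', hC', hlay⟩ := exists_integral_layer_le J hD hρ hρr
  set C₁ := C * Cj + 2 * J.jlip with hC₁
  have hC₁0 : 0 ≤ C₁ := by
    have := J.jlip_pos; have := hD.C_nonneg; positivity
  -- For `|z| ≥ s k` the constant width `η k` is at most `(η k / s k)|z|`, which turns the layer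
  -- into one of linear opening `a k`.
  set a : ℕ → ℝ := fun k => η k / s k + C₁ * ‖x k - y k‖ with ha
  have ha0 : ∀ k, 0 ≤ a k := fun k =>
    add_nonneg (div_nonneg (hη k) (hs k).le) (mul_nonneg hC₁0 (norm_nonneg _))
  have hLa : Tendsto (fun k => L k * a k) atTop (𝓝 0) := by
    have := h3.add (h1.const_mul C₁)
    simp only [mul_zero, add_zero] at this
    refine this.congr fun k => ?_
    simp only [ha]; ring
  have ha1 : ∀ᶠ k in atTop, a k ≤ 1 := by
    filter_upwards [hLa.eventually (gt_mem_nhds one_pos)] with k hk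
    have := mul_le_mul_of_nonneg_right (hL k) (ha0 k)
    linarith
  have hfar := (J.tendsto_mismatch_far hΩ hO hx hy hx₀ hxl hyl hρ).const_mul B
  have hup : Tendsto (fun k => L k * ballMoment N σ (s k) + C' * (L k * a k) +
      B * ∫ z, ({z : RN N | ρ ≤ ‖z‖} ∩ mismatch Ω j (x k) (y k)).indicator 1 z * kern σ z)
      atTop (𝓝 0) := by
    simpa using (h2.add (hLa.const_mul C')).add hfar
  have hball := Metric.ball_mem_nhds x₀ (half_pos hr)
  refine squeeze_zero' (Eventually.of_forall fun k => integral_nonneg fun z =>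
    mul_nonneg (indicator_nonneg (fun z _ => le_min hB
      (mul_nonneg (zero_le_one.trans (hL k)) (norm_nonneg _))) _) (kern_nonneg z)) ?_ hup
  filter_upwards [ha1, hDxy, hxl.eventually hball, hyl.eventually hball] with k hk1 hk2 hk3 hk4
  have hL0 : 0 ≤ L k := zero_le_one.trans (hL k)
  have hxr : x k ∈ Metric.ball x₀ r := Metric.ball_subset_ball (by linarith) hk3
  have hlk := hlay (x k) hxr (hx k) (a k) (ha0 k) hk1
  set S : Set (RN N) := {z : RN N | ‖z‖ < ρ ∧ |D (x k + j (x k) z)| ≤ a k * ‖z‖} with hS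
  have hSm : MeasurableSet S := by
    refine (measurableSet_lt measurable_norm measurable_const).inter
      (measurableSet_le ?_ (measurable_norm.const_mul _))
    exact (hD.meas.comp ((J.measurable_j (hx k)).const_add (x k))).abs
  have i1 := (integrable_indicator_norm_mul_kern (N := N) J.σ_pos J.σ_lt_one (s k)).const_mul (L k)
  have i2 : Integrable fun z : RN N => L k * (S.indicator (fun z => ‖z‖) z * kern σ z) := by
    refine (((integrable_indicator_norm_mul_kern (N := N) J.σ_pos J.σ_lt_one ρ).mono'
      ((measurable_norm.indicator hSm).mul measurable_kern).aestronglyMeasurable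
      (ae_of_all _ fun z => ?_))).const_mul (L k)
    refine (abs_of_nonneg (mul_nonneg (indicator_nonneg (fun _ _ => norm_nonneg _) _)
      (kern_nonneg z))).trans_le ?_
    exact mul_le_mul_of_nonneg_right (indicator_le_indicator_of_subset (fun z hz => hz.1)
      (fun z => norm_nonneg z) z) (kern_nonneg z)
  have i3 : Integrable fun z : RN N =>
      B * (({z : RN N | ρ ≤ ‖z‖} ∩ mismatch Ω j (x k) (y k)).indicator 1 z * kern σ z) := by
    refine (integrable_mul_kern_of_le (C := 1 / min 1 ρ) J.σ_pos J.σ_lt_one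
      (measurable_one.indicator
        ((measurableSet_le measurable_const measurable_norm).inter
          (J.measurableSet_mismatch (hx k) (hy k)))).aestronglyMeasurable fun z => ?_).const_mul B
    have hm : 0 < min 1 ρ := lt_min one_pos hρ
    by_cases hz : z ∈ {z : RN N | ρ ≤ ‖z‖} ∩ mismatch Ω j (x k) (y k)
    · rw [indicator_of_mem hz, Pi.one_apply, abs_one, one_div, ← div_eq_inv_mul,
        le_div_iff₀ hm, one_mul]
      exact min_le_min_left _ hz.1
    · rw [indicator_of_notMem hz, abs_zero]
      have := norm_nonneg z
      positivity
  have i12 : Integrable fun z : RN N =>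
      L k * ({z : RN N | ‖z‖ < s k}.indicator (fun z => ‖z‖) z * kern σ z) +
        L k * (S.indicator (fun z => ‖z‖) z * kern σ z) := i1.add i2
  -- Three regions: `|z| < s k`, where mismatch is ignored and the ball moment is small; `s k ≤ |z|
  -- < ρ`, where mismatched jumps land in the thin layer; and `|z| ≥ ρ`, where the far limit
  -- applies.
  calc ∫ z, (mismatch Ω j (x k) (y k)).indicator (fun z => min B (L k * ‖z‖)) z * kern σ z
      ≤ ∫ z, (L k * ({z : RN N | ‖z‖ < s k}.indicator (fun z => ‖z‖) z * kern σ z) +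
          L k * (S.indicator (fun z => ‖z‖) z * kern σ z)) +
          B * (({z : RN N | ρ ≤ ‖z‖} ∩ mismatch Ω j (x k) (y k)).indicator 1 z * kern σ z) := by
        refine integral_mono (J.integrable_mismatch (hx k) (hy k) hB hL0) (i12.add i3)
          fun z => ?_
        simp only
        have hkn := kern_nonneg (N := N) (σ := σ) z
        have p1 : 0 ≤ L k * ({z : RN N | ‖z‖ < s k}.indicator (fun z => ‖z‖) z * kern σ z) :=
          mul_nonneg hL0 (mul_nonneg (indicator_nonneg (fun _ _ => norm_nonneg _) _) hkn)
        have p2 : 0 ≤ L k * (S.indicator (fun z => ‖z‖) z * kern σ z) :=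
          mul_nonneg hL0 (mul_nonneg (indicator_nonneg (fun _ _ => norm_nonneg _) _) hkn)
        have p3 : 0 ≤ B * (({z : RN N | ρ ≤ ‖z‖} ∩ mismatch Ω j (x k) (y k)).indicator 1 z *
            kern σ z) :=
          mul_nonneg hB (mul_nonneg (indicator_nonneg (fun _ _ => zero_le_one) _) hkn)
        by_cases hm : z ∈ mismatch Ω j (x k) (y k)
        swap
        · rw [indicator_of_notMem hm, zero_mul]; linarith
        rw [indicator_of_mem hm]
        rcases le_or_gt ρ ‖z‖ with hz | hz
        · have : ({z : RN N | ρ ≤ ‖z‖} ∩ mismatch Ω j (x k) (y k)).indicator 1 z = (1 : ℝ) :=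
            indicator_of_mem (by exact ⟨hz, hm⟩) _
          rw [this] at p3 ⊢
          have := mul_le_mul_of_nonneg_right (min_le_left B (L k * ‖z‖)) hkn
          linarith
        · have h5 : min B (L k * ‖z‖) * kern σ z ≤ L k * (‖z‖ * kern σ z) := by
            rw [← mul_assoc]
            exact mul_le_mul_of_nonneg_right (min_le_right _ _) hkn
          rcases lt_or_ge ‖z‖ (s k) with hz' | hz'
          · have : {z : RN N | ‖z‖ < s k}.indicator (fun z => ‖z‖) z = ‖z‖ :=
              indicator_of_mem (by exact hz') _
            rw [this]
            linarith
          · have hzS : z ∈ S := by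
              refine ⟨hz, ?_⟩
              have h6 := hD.abs_le_of_mismatch J (hx k) (hy k) hk3 hk4 hk2
                ((mul_le_mul_of_nonneg_left hz.le hCj.le).trans_lt hρ2) hm
              have h7 : η k ≤ η k / s k * ‖z‖ := by
                rw [div_mul_eq_mul_div, le_div_iff₀ (hs k)]
                exact mul_le_mul_of_nonneg_left hz' (hη k)
              simp only [ha]
              linarith
            rw [indicator_of_mem hzS]
            linarith
    _ = L k * ballMoment N σ (s k) + L k * (∫ z, S.indicator (fun z => ‖z‖) z * kern σ z) +
        B * ∫ z, ({z : RN N | ρ ≤ ‖z‖} ∩ mismatch Ω j (x k) (y k)).indicator 1 z * kern σ z := by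
        rw [integral_add i12 i3, integral_add i1 i2, integral_const_mul,
          integral_const_mul, integral_const_mul, ballMoment]
    _ ≤ _ := by
        have := mul_le_mul_of_nonneg_left hlk hL0
        linarith

end TwoPoint

end CensoredNeumann

end


/-! ### Regularized norm and bounded boundary correction. -/

noncomputable section

namespace CensoredNeumann

open Set Filter Topology MeasureTheory

section Regularization

variable {E : Type*} [NormedAddCommGroup E] [InnerProductSpace ℝ E]

/-- The smooth regularization `√(‖s‖² + c²)` of the norm. -/
def regNorm (c : ℝ) (s : E) : ℝ := √(‖s‖ ^ 2 + c ^ 2)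

lemma norm_le_regNorm (c : ℝ) (s : E) : ‖s‖ ≤ regNorm c s :=
  Real.le_sqrt_of_sq_le (by nlinarith [sq_nonneg c])

lemma le_regNorm (c : ℝ) (s : E) : c ≤ regNorm c s :=
  Real.le_sqrt_of_sq_le (by nlinarith [sq_nonneg ‖s‖])

lemma regNorm_le_add (c : ℝ) (s s' : E) : regNorm c s ≤ regNorm c s' + ‖s - s'‖ := by
  have h0 : 0 ≤ regNorm c s' := Real.sqrt_nonneg _
  refine Real.sqrt_le_iff.2 ⟨add_nonneg h0 (norm_nonneg _), ?_⟩
  have h1 : regNorm c s' ^ 2 = ‖s'‖ ^ 2 + c ^ 2 := Real.sq_sqrt (by positivity)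
  have h2 := norm_le_regNorm c s'
  have h3 : ‖s‖ ≤ ‖s'‖ + ‖s - s'‖ := by simpa using norm_add_le s' (s - s')
  have h4 : ‖s‖ ^ 2 ≤ (‖s'‖ + ‖s - s'‖) ^ 2 := by gcongr
  nlinarith [mul_le_mul_of_nonneg_right h2 (norm_nonneg (s - s'))]

lemma abs_regNorm_sub_le (c : ℝ) (s s' : E) : |regNorm c s - regNorm c s'| ≤ ‖s - s'‖ :=
  abs_sub_le_iff.2 ⟨by linarith [regNorm_le_add c s s'],
    by rw [norm_sub_rev]; linarith [regNorm_le_add c s' s]⟩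

lemma regNorm_neg (c : ℝ) (s : E) : regNorm c (-s) = regNorm c s := by simp [regNorm]

lemma regNorm_pos {c : ℝ} (hc : 0 < c) (s : E) : 0 < regNorm c s := hc.trans_le (le_regNorm c s)

lemma regNorm_zero {c : ℝ} (hc : 0 ≤ c) : regNorm c (0 : E) = c := by
  simp [regNorm, Real.sqrt_sq hc]

lemma contDiff_regNorm {c : ℝ} (hc : 0 < c) : ContDiff ℝ 1 (regNorm c : E → ℝ) :=
  ((contDiff_id.norm_sq ℝ).add contDiff_const).sqrt fun s => by positivity

lemma continuous_regNorm (c : ℝ) : Continuous (regNorm c : E → ℝ) := by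
  unfold regNorm; fun_prop

lemma hasFDerivAt_regNorm {c : ℝ} (hc : 0 < c) (s : E) :
    HasFDerivAt (regNorm c) ((regNorm c s)⁻¹ • innerSL ℝ s) s := by
  have h := ((hasFDerivAt_id (𝕜 := ℝ) s).norm_sq.add_const (c ^ 2)).sqrt (by
    simp only [id]; positivity)
  refine h.congr_fderiv ?_
  ext v
  have hp := (regNorm_pos hc s).ne'
  unfold regNorm at hp ⊢
  simp only [id, one_div, mul_inv, ContinuousLinearMap.smul_apply, smul_eq_mul]
  simp
  ring

/-- The bounded increasing function `s / (1 + ν s)`. -/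
def flat (ν s : ℝ) : ℝ := s / (1 + ν * s)

lemma flat_nonneg {ν s : ℝ} (hν : 0 ≤ ν) (hs : 0 ≤ s) : 0 ≤ flat ν s := by
  unfold flat; positivity

lemma flat_le {ν s : ℝ} (hν : 0 < ν) (hs : 0 ≤ s) : flat ν s ≤ 1 / ν := by
  unfold flat
  rw [div_le_div_iff₀ (by positivity) hν]
  linarith

lemma hasDerivAt_flat {ν s : ℝ} (hν : 0 ≤ ν) (hs : 0 ≤ s) :
    HasDerivAt (flat ν) (1 / (1 + ν * s) ^ 2) s := by
  have h := (hasDerivAt_id s).div (((hasDerivAt_id s).const_mul ν).const_add 1)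
    (by simp only [id]; positivity)
  refine h.congr_deriv ?_
  simp only [id]
  ring

lemma abs_flat_sub_le {ν s s' : ℝ} (hν : 0 ≤ ν) (hs : 0 ≤ s) (hs' : 0 ≤ s') :
    |flat ν s - flat ν s'| ≤ |s - s'| := by
  have h : flat ν s - flat ν s' = (s - s') / ((1 + ν * s) * (1 + ν * s')) := by
    unfold flat
    rw [div_sub_div _ _ (by positivity) (by positivity)]
    ring
  rw [h, abs_div, abs_of_pos (show 0 < (1 + ν * s) * (1 + ν * s') by positivity)]
  refine div_le_self (abs_nonneg _) ?_
  nlinarith [mul_nonneg hν hs, mul_nonneg hν hs', mul_nonneg (mul_nonneg hν hs) (mul_nonneg hν hs')]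

end Regularization

/-! ### The penalization and its effect at maximum points. -/

section Penalization

variable {N : ℕ} {F : Type*} [NormedAddCommGroup F] [InnerProductSpace ℝ F]

/-- The part of the penalization which depends on one variable: it confines the maximum points
and, through the defining function `D`, makes the Neumann condition inactive. -/
def sidePen (δ ν : ℝ) (x₀ : RN N) (D : RN N → ℝ) (x : RN N) : ℝ :=
  δ * (regNorm 1 x + regNorm 1 (x - x₀)) - 8 * δ * flat ν (D x)

/-- The part of the penalization which couples the two variables. -/
def linkPen (ν η : ℝ) (e : RN N → F) (x y : RN N) : ℝ :=
  ν ^ 2 * ‖x - y‖ ^ 2 + ν * regNorm η (e x - e y)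

lemma linkPen_comm (ν η : ℝ) (e : RN N → F) (x y : RN N) :
    linkPen ν η e x y = linkPen ν η e y x := by
  unfold linkPen
  rw [norm_sub_rev, ← neg_sub (e y), regNorm_neg]

/-- `(x, y)` is a maximum point of the penalized doubling of variables. -/
structure IsMaxPair (Ω : Set (RN N)) (U V : RN N → ℝ) (δ ν η : ℝ) (x₀ : RN N) (D : RN N → ℝ)
    (e : RN N → F) (x y : RN N) : Prop where
  left_mem : x ∈ closure Ω
  right_mem : y ∈ closure Ω
  max : ∀ x' ∈ closure Ω, ∀ y' ∈ closure Ω,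
    U x' + V y' - sidePen δ ν x₀ D x' - sidePen δ ν x₀ D y' - linkPen ν η e x' y' ≤
      U x + V y - sidePen δ ν x₀ D x - sidePen δ ν x₀ D y - linkPen ν η e x y

/-- The map `e` through which the points are coupled: either the identity or the defining
function. -/
structure IsCoupling (Ω : Set (RN N)) (j : RN N → RN N → RN N) (D : RN N → ℝ) (x₀ : RN N)
    (r C : ℝ) (e : RN N → F) : Prop where
  c11 : IsC11Near e x₀ r C
  lip_closure : ∀ x ∈ closure Ω, ∀ y ∈ closure Ω, ‖e x - e y‖ ≤ ‖x - y‖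
  double : ∀ x ∈ closure Ω, ∀ y ∈ closure Ω, x ∈ Metric.ball x₀ (r / 2) →
    y ∈ Metric.ball x₀ (r / 2) → ∀ z, x + j x z ∈ closure Ω → y + j y z ∈ closure Ω →
    ‖(e (x + j x z) - e x) - (e (y + j y z) - e y)‖ ≤ C * ‖x - y‖ * ‖z‖
  neumann : ∀ x ∈ Metric.ball x₀ r, x ∈ frontier Ω → ∀ y ∈ Metric.ball x₀ r, y ∈ closure Ω →
    -(C * ‖e x - e y‖ * ‖x - y‖) ≤ inner ℝ (e x - e y) (fderiv ℝ e x (outerNormal Ω x))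
  control : ∀ x ∈ closure Ω, ∀ y ∈ closure Ω, |D x - D y| ≤ ‖e x - e y‖

variable {Ω : Set (RN N)} {μ : RN N → Measure (RN N)} {j : RN N → RN N → RN N}
  {σ Cj : ℝ} {D : RN N → ℝ} {x₀ : RN N} {r C C' δ ν η : ℝ} {e : RN N → F} {U V : RN N → ℝ}
  {x y : RN N}

lemma IsMaxPair.symm (h : IsMaxPair Ω U V δ ν η x₀ D e x y) :
    IsMaxPair Ω V U δ ν η x₀ D e y x :=
  ⟨h.right_mem, h.left_mem, fun x' hx' y' hy' => by
    rw [linkPen_comm ν η e y x, linkPen_comm ν η e x' y']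
    linarith [h.max y' hy' x' hx']⟩

/-- The derivative of the confining part. -/
lemma hasFDerivAt_sidePen (hD : IsDefiningAt Ω j x₀ D r C) (hδ : 0 ≤ δ) (hν : 0 ≤ ν)
    (hx : x ∈ closure Ω) (hxb : x ∈ Metric.ball x₀ r) :
    ∃ β : RN N →L[ℝ] ℝ, ‖β‖ ≤ 2 * δ ∧
      HasFDerivAt (sidePen δ ν x₀ D)
        (β - (8 * δ * (1 / (1 + ν * D x) ^ 2)) • fderiv ℝ D x) x := by
  have h1 : ContDiff ℝ 1 fun x : RN N => δ * (regNorm 1 x + regNorm 1 (x - x₀)) :=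
    contDiff_const.mul ((contDiff_regNorm one_pos).add
      ((contDiff_regNorm one_pos).comp (contDiff_id.sub contDiff_const)))
  refine ⟨fderiv ℝ (fun x : RN N => δ * (regNorm 1 x + regNorm 1 (x - x₀))) x, ?_, ?_⟩
  · have hlip : LipschitzWith (Real.toNNReal (2 * δ))
        (fun x : RN N => δ * (regNorm 1 x + regNorm 1 (x - x₀))) :=
      LipschitzWith.of_dist_le_mul fun y y' => by
        rw [Real.dist_eq, dist_eq_norm, Real.coe_toNNReal _ (by positivity), ← mul_sub, abs_mul,
          abs_of_nonneg hδ]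
        have h2 := abs_regNorm_sub_le 1 y y'
        have h3 := abs_regNorm_sub_le 1 (y - x₀) (y' - x₀)
        rw [sub_sub_sub_cancel_right] at h3
        have h4 := abs_add_le (regNorm 1 y - regNorm 1 y')
          (regNorm 1 (y - x₀) - regNorm 1 (y' - x₀))
        rw [show regNorm 1 y - regNorm 1 y' + (regNorm 1 (y - x₀) - regNorm 1 (y' - x₀)) =
          regNorm 1 y + regNorm 1 (y - x₀) - (regNorm 1 y' + regNorm 1 (y' - x₀)) by ring] at h4
        nlinarith
    have := norm_fderiv_le_of_lipschitz ℝ hlip (x₀ := x)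
    rwa [Real.coe_toNNReal _ (by positivity)] at this
  · have h2 := ((hasDerivAt_flat hν (hD.nonneg x hx)).comp_hasFDerivAt x
      (hD.diff x hxb).hasFDerivAt).const_mul (8 * δ)
    refine ((h1.differentiable one_ne_zero x).hasFDerivAt.sub h2).congr_fderiv ?_
    rw [smul_smul]

lemma hasFDerivAt_linkPen (hη : 0 < η) (he : DifferentiableAt ℝ e x) :
    HasFDerivAt (fun x => linkPen ν η e x y)
      ((2 * ν ^ 2) • innerSL ℝ (x - y) +
        (ν * (regNorm η (e x - e y))⁻¹) • (innerSL ℝ (e x - e y)).comp (fderiv ℝ e x)) x := by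
  have h1 := (((hasFDerivAt_id (𝕜 := ℝ) x).sub_const y).norm_sq).const_mul (ν ^ 2)
  have h2 := ((hasFDerivAt_regNorm hη (e x - e y)).comp x
    (he.hasFDerivAt.sub_const (e y))).const_mul ν
  refine (h1.add h2).congr_fderiv ?_
  ext v
  simp
  ring

lemma contDiffAt_sidePen_add_linkPen (hD : IsDefiningAt Ω j x₀ D r C) (hν : 0 ≤ ν) (hη : 0 < η)
    (he : IsC11Near e x₀ r C') (hx : x ∈ closure Ω) (hxb : x ∈ Metric.ball x₀ r) :
    ContDiffAt ℝ 1 (fun x => sidePen δ ν x₀ D x + linkPen ν η e x y) x := by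
  have h1 : ContDiff ℝ 1 fun x : RN N => δ * (regNorm 1 x + regNorm 1 (x - x₀)) :=
    contDiff_const.mul ((contDiff_regNorm one_pos).add
      ((contDiff_regNorm one_pos).comp (contDiff_id.sub contDiff_const)))
  have hDx := hD.isC11Near.contDiffAt hxb
  have h2 : ContDiffAt ℝ 1 (fun x => flat ν (D x)) x := by
    unfold flat
    refine hDx.div (contDiffAt_const.add (contDiffAt_const.mul hDx)) ?_
    have := hD.nonneg x hx
    positivity
  have h3 : ContDiffAt ℝ 1 (fun x => regNorm η (e x - e y)) x :=
    (contDiff_regNorm hη).contDiffAt.comp x ((he.contDiffAt hxb).sub contDiffAt_const)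
  exact (h1.contDiffAt.sub (contDiffAt_const.mul h2)).add
    ((contDiffAt_const.mul (contDiff_normSq y).contDiffAt).add (contDiffAt_const.mul h3))

/-- The gradient of the penalization at a point near `x₀`. -/
lemma exists_inner_gradient_pen (hD : IsDefiningAt Ω j x₀ D r C) (hδ : 0 ≤ δ) (hν : 0 ≤ ν)
    (hη : 0 < η) (he : IsC11Near e x₀ r C') (hx : x ∈ closure Ω) (hxb : x ∈ Metric.ball x₀ r) :
    ∃ β : RN N →L[ℝ] ℝ, ‖β‖ ≤ 2 * δ ∧ ∀ v,
      inner ℝ (gradient (fun x => sidePen δ ν x₀ D x + linkPen ν η e x y) x) v =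
        β v - 8 * δ * (1 / (1 + ν * D x) ^ 2) * fderiv ℝ D x v + 2 * ν ^ 2 * inner ℝ (x - y) v +
          ν * (regNorm η (e x - e y))⁻¹ * inner ℝ (e x - e y) (fderiv ℝ e x v) := by
  obtain ⟨β, hβ, h1⟩ := hasFDerivAt_sidePen hD hδ hν hx hxb
  refine ⟨β, hβ, fun v => ?_⟩
  have h2 : HasFDerivAt (fun x => sidePen δ ν x₀ D x + linkPen ν η e x y) _ x :=
    h1.add (hasFDerivAt_linkPen (y := y) (ν := ν) hη (he.diff x hxb))
  rw [inner_gradient, h2.fderiv]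
  simp [inner_sub_left]
  ring

/-- A first-order expansion of `D` at the boundary point, where it vanishes, against `D y ≥ 0`. It
replaces convexity: the domain lies on one side of its tangent plane up to a quadratic error, as the
term `ν²|x - y|²` requires. -/
lemma IsDefiningAt.le_fderiv_of_frontier (hD : IsDefiningAt Ω j x₀ D r C)
    (hxb : x ∈ Metric.ball x₀ r) (hx : x ∈ frontier Ω) (hyb : y ∈ Metric.ball x₀ r)
    (hy : y ∈ closure Ω) : -(C * ‖x - y‖ * ‖x - y‖) ≤ fderiv ℝ D x (y - x) := by
  have hseg : segment ℝ x y ⊆ Metric.ball x₀ r := (convex_ball x₀ r).segment_subset hxb hyb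
  have h1 := (convex_segment x y).norm_image_sub_le_of_norm_hasFDerivWithin_le' (𝕜 := ℝ) (f := D)
    (f' := fderiv ℝ D) (φ := fderiv ℝ D x) (C := C * ‖x - y‖)
    (fun h hh => (hD.diff h (hseg hh)).hasFDerivAt.hasFDerivWithinAt)
    (fun h hh => (hD.lip h (hseg hh) x hxb).trans (mul_le_mul_of_nonneg_left (by
      have := norm_sub_le_of_mem_segment hh
      rwa [norm_sub_rev y x] at this) hD.C_nonneg))
    (left_mem_segment ℝ x y) (right_mem_segment ℝ x y)
  rw [hD.zero x hxb hx, sub_zero, norm_sub_rev y x] at h1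
  have h2 := hD.nonneg y hy
  have h3 := (abs_le.1 h1).2
  linarith

/-- The Neumann condition is not active at the maximum points of the penalized doubling. -/
theorem IsMaxPair.subAt [NeZero N] (J : JumpKernel Ω μ j σ Cj) (hΩ : IsOpen Ω)
    {G : RN N → RN N → ℝ}
    (hU : IsSubsolution Ω μ j Cj G U) (hD : IsDefiningAt Ω j x₀ D r C)
    (he : IsCoupling Ω j D x₀ r C' e) (hC' : 0 ≤ C') (hδ : 0 < δ) (hν : 0 ≤ ν) (hη : 0 < η)
    (h : IsMaxPair Ω U V δ ν η x₀ D e x y) (hxb : x ∈ Metric.ball x₀ r)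
    (hyb : y ∈ Metric.ball x₀ r)
    (hsmall : 2 * C * (ν * ‖x - y‖) ^ 2 + C' * (ν * ‖x - y‖) < δ) :
    SubAt Ω μ j G U x (gradient (fun x => sidePen δ ν x₀ D x + linkPen ν η e x y) x) := by
  have hx := h.left_mem
  have hjet := hU.jet J hx
    (contDiffAt_sidePen_add_linkPen (δ := δ) (y := y) hD hν hη he.c11 hx hxb) (by
      filter_upwards [self_mem_nhdsWithin] with x' hx'
      linarith [h.max x' hx' y h.right_mem])
  by_cases hxΩ : x ∈ Ω
  · exact hjet.1 hxΩ
  have hxf : x ∈ frontier Ω := by rw [hΩ.frontier_eq]; exact ⟨hx, hxΩ⟩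
  refine (hjet.2 hxf).resolve_left (not_le.2 ?_)
  obtain ⟨β, hβ, hg⟩ := exists_inner_gradient_pen (δ := δ) (y := y) hD hδ.le hν hη he.c11 hx hxb
  unfold normalDeriv
  rw [hg]
  have hn := he.neumann x hxb hxf y hyb h.right_mem
  have hR := norm_le_regNorm η (e x - e y)
  have hR0 := regNorm_pos hη (e x - e y)
  have t4 : -(C' * (ν * ‖x - y‖)) ≤ ν * (regNorm η (e x - e y))⁻¹ *
      inner ℝ (e x - e y) (fderiv ℝ e x (outerNormal Ω x)) := by
    have h1 : (regNorm η (e x - e y))⁻¹ * ‖e x - e y‖ ≤ 1 := by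
      rw [inv_mul_le_iff₀ hR0]; linarith
    have h2 := mul_le_mul_of_nonneg_left hn
      (mul_nonneg hν (inv_nonneg.2 hR0.le) : 0 ≤ ν * (regNorm η (e x - e y))⁻¹)
    have h3 : C' * (ν * ‖x - y‖) * ((regNorm η (e x - e y))⁻¹ * ‖e x - e y‖) ≤
        C' * (ν * ‖x - y‖) * 1 := mul_le_mul_of_nonneg_left h1 (by positivity)
    linarith
  rw [hD.normal x hxb hxf, hD.zero x hxb hxf] at *
  set d := ‖gradient D x‖ with hd
  have hd2 := hD.half_le x hxb hxf
  have t1 : -(2 * δ * d) ≤ β (-gradient D x) := by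
    have := (abs_le.1 ((β.le_opNorm (-gradient D x)))).1
    rw [norm_neg] at this
    have h2 : ‖β‖ * d ≤ 2 * δ * d := mul_le_mul_of_nonneg_right hβ (norm_nonneg _)
    linarith
  have t2 : fderiv ℝ D x (-gradient D x) = -d ^ 2 := by
    rw [← inner_gradient, inner_neg_right, real_inner_self_eq_norm_sq]
  have t3 : inner ℝ (x - y) (-gradient D x) = fderiv ℝ D x (y - x) := by
    rw [← inner_gradient, inner_neg_right, ← inner_neg_left, neg_sub, real_inner_comm]
  have t3' := hD.le_fderiv_of_frontier hxb hxf hyb h.right_mem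
  have t3'' := mul_le_mul_of_nonneg_left t3' (show 0 ≤ 2 * ν ^ 2 by positivity)
  rw [t2, t3]
  -- Here the factor `8` is used: with `d ≥ 1/2` the boundary correction beats the confining terms
  -- by `δ`, leaving room for the coupling errors bounded in `hsmall`.
  have t5 : δ ≤ 8 * δ * d ^ 2 - 2 * δ * d := by
    have : (1 : ℝ) ≤ 8 * d ^ 2 - 2 * d := by nlinarith
    nlinarith
  simp only [mul_zero, add_zero, one_pow, div_one, mul_one]
  nlinarith

/-- The constant is `2` from the two confining norms plus `8` from the boundary correction, `D`
being `1`-Lipschitz on `closure Ω` and `flat ν` a contraction; `ν` does not enter. -/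
lemma abs_sidePen_sub_le (hD : IsDefiningAt Ω j x₀ D r C) (hδ : 0 ≤ δ) (hν : 0 ≤ ν)
    (hx : x ∈ closure Ω) (hy : y ∈ closure Ω) :
    |sidePen δ ν x₀ D x - sidePen δ ν x₀ D y| ≤ 10 * δ * ‖x - y‖ := by
  have h1 := abs_le.1 (abs_regNorm_sub_le 1 x y)
  have h2 := abs_regNorm_sub_le 1 (x - x₀) (y - x₀)
  rw [sub_sub_sub_cancel_right] at h2
  have h2 := abs_le.1 h2
  have h3 := abs_le.1 ((abs_flat_sub_le hν (hD.nonneg x hx) (hD.nonneg y hy)).trans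
    (hD.lip_closure x hx y hy))
  unfold sidePen
  rw [abs_le]
  constructor <;> nlinarith

/-- One-sided increments at a maximum point. -/
lemma IsMaxPair.incr_le (J : JumpKernel Ω μ j σ Cj) (hD : IsDefiningAt Ω j x₀ D r C)
    (he : IsCoupling Ω j D x₀ r C' e) (hδ : 0 ≤ δ) (hδ1 : δ ≤ 1) (hν : 1 ≤ ν)
    (h : IsMaxPair Ω U V δ ν η x₀ D e x y) (ha : ν * ‖x - y‖ ≤ 1) {M : ℝ} (hM : 0 ≤ M)
    (hUM : ∀ x ∈ closure Ω, |U x| ≤ M) (z : RN N) (hz : x + j x z ∈ closure Ω) :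
    U (x + j x z) - U x ≤ min (2 * M) ((14 + 2 * M) * Cj * ν * ‖z‖) := by
  have hx := h.left_mem
  have hy := h.right_mem
  have h0 := h.max _ hz y hy
  have hMb : U (x + j x z) - U x ≤ 2 * M := by
    have h1 := (abs_le.1 (hUM _ hz)).2
    have h2 := (abs_le.1 (hUM _ hx)).1
    linarith
  refine le_min hMb ?_
  have hw := J.le_up x hx z
  set w := j x z with hwdef
  have hw0 := norm_nonneg w
  have h1 := (abs_le.1 (abs_sidePen_sub_le hD hδ (zero_le_one.trans hν) hz hx)).2
  rw [add_sub_cancel_left] at h1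
  have h2 : ‖x + w - y‖ ^ 2 ≤ (‖x - y‖ + ‖w‖) ^ 2 := by
    gcongr
    rw [add_sub_right_comm]
    exact norm_add_le _ _
  have h3 := (abs_le.1 (abs_regNorm_sub_le η (e (x + w) - e y) (e x - e y))).2
  rw [sub_sub_sub_cancel_right] at h3
  have h4 := he.lip_closure _ hz x hx
  rw [add_sub_cancel_left] at h4
  unfold linkPen at h0
  have h5 : U (x + w) - U x ≤ 10 * δ * ‖w‖ + 2 * ν * (ν * ‖x - y‖) * ‖w‖ + ν ^ 2 * ‖w‖ ^ 2 +
      ν * ‖w‖ := by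
    have := mul_le_mul_of_nonneg_left h2 (sq_nonneg ν)
    have := mul_le_mul_of_nonneg_left (h3.trans h4) (zero_le_one.trans hν)
    nlinarith
  have h6 : 2 * ν * (ν * ‖x - y‖) * ‖w‖ ≤ 2 * ν * ‖w‖ := by
    have := mul_le_mul_of_nonneg_left ha (show 0 ≤ 2 * ν * ‖w‖ by positivity)
    linarith
  have h7 : 10 * δ * ‖w‖ ≤ 10 * (ν * ‖w‖) := by
    have : δ * ‖w‖ ≤ ν * ‖w‖ := mul_le_mul_of_nonneg_right (by linarith) hw0
    linarith
  -- If `ν‖w‖ ≤ 1` the quadratic term is at most linear and the contributions are `10 + 2 + 1 + 1`;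
  -- otherwise the trivial bound `2M` is at most `2Mν‖w‖`.
  have h8 : U (x + w) - U x ≤ (14 + 2 * M) * (ν * ‖w‖) := by
    have hp : 0 ≤ ν * ‖w‖ := by positivity
    rcases le_total (ν * ‖w‖) 1 with hc | hc
    · have : ν ^ 2 * ‖w‖ ^ 2 ≤ ν * ‖w‖ := by nlinarith
      nlinarith
    · nlinarith
  refine h8.trans ?_
  have := mul_le_mul_of_nonneg_left hw
    (show 0 ≤ (14 + 2 * M) * ν by positivity)
  linarith

/-- Joint increments at a maximum point. -/
lemma IsMaxPair.pair_incr_le (J : JumpKernel Ω μ j σ Cj) (hD : IsDefiningAt Ω j x₀ D r C)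
    (he : IsCoupling Ω j D x₀ r C' e) (hC' : 0 ≤ C') (hδ : 0 ≤ δ) (hν : 0 ≤ ν)
    (h : IsMaxPair Ω U V δ ν η x₀ D e x y)
    (hxb : x ∈ Metric.ball x₀ (r / 2)) (hyb : y ∈ Metric.ball x₀ (r / 2)) {M : ℝ}
    (hUM : ∀ x ∈ closure Ω, |U x| ≤ M) (hVM : ∀ x ∈ closure Ω, |V x| ≤ M) (z : RN N)
    (hz : x + j x z ∈ closure Ω) (hz' : y + j y z ∈ closure Ω) :
    U (x + j x z) - U x + (V (y + j y z) - V y) ≤ min (4 * M)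
      ((20 * Cj * δ + (2 * J.jlip + J.jlip ^ 2) * (ν * ‖x - y‖) ^ 2 + C' * (ν * ‖x - y‖)) *
        (‖z‖ + ‖z‖ ^ 2)) := by
  have hx := h.left_mem
  have hy := h.right_mem
  have h0 := h.max _ hz _ hz'
  have hMb : U (x + j x z) - U x + (V (y + j y z) - V y) ≤ 4 * M := by
    have h1 := (abs_le.1 (hUM _ hz)).2
    have h2 := (abs_le.1 (hUM _ hx)).1
    have h3 := (abs_le.1 (hVM _ hz')).2
    have h4 := (abs_le.1 (hVM _ hy)).1
    linarith
  refine le_min hMb ?_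
  have hw := J.le_up x hx z
  have hw' := J.le_up y hy z
  have hww := J.j_lip x hx y hy z
  have hdb := he.double x hx y hy hxb hyb z hz hz'
  have hjl := J.jlip_pos
  have hCj := J.Cj_pos
  set w := j x z with hwdef
  set w' := j y z with hwdef'
  have hz0 := norm_nonneg z
  have h1 := (abs_le.1 (abs_sidePen_sub_le hD hδ hν hz hx)).2
  have h1' := (abs_le.1 (abs_sidePen_sub_le hD hδ hν hz' hy)).2
  rw [add_sub_cancel_left] at h1 h1'
  set a := ‖x - y‖ with ha
  have ha0 : 0 ≤ a := norm_nonneg _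
  -- By (J1) the two jumps differ by `O(|z||x - y|)`, so the increment of the quadratic coupling
  -- keeps the factor `(ν|x - y|)²`, which vanishes along the doubling.
  have h2 : ‖x + w - (y + w')‖ ^ 2 ≤ (a + J.jlip * ‖z‖ * a) ^ 2 := by
    gcongr
    rw [add_sub_add_comm]
    exact (norm_add_le _ _).trans (by linarith)
  have h3 := (abs_le.1 (abs_regNorm_sub_le η (e (x + w) - e (y + w')) (e x - e y))).2
  rw [sub_sub_sub_comm] at h3
  unfold linkPen at h0
  have t1 : 10 * δ * ‖w‖ + 10 * δ * ‖w'‖ ≤ 20 * Cj * δ * ‖z‖ := by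
    have := mul_le_mul_of_nonneg_left hw hδ
    have := mul_le_mul_of_nonneg_left hw' hδ
    linarith
  have t2 : ν ^ 2 * ‖x + w - (y + w')‖ ^ 2 - ν ^ 2 * a ^ 2 ≤
      (2 * J.jlip + J.jlip ^ 2) * (ν * a) ^ 2 * (‖z‖ + ‖z‖ ^ 2) := by
    have := mul_le_mul_of_nonneg_left h2 (sq_nonneg ν)
    have e1 : ν ^ 2 * (a + J.jlip * ‖z‖ * a) ^ 2 - ν ^ 2 * a ^ 2 =
      (ν * a) ^ 2 * (2 * J.jlip * ‖z‖ + J.jlip ^ 2 * ‖z‖ ^ 2) := by ring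
    have e2 : 2 * J.jlip * ‖z‖ + J.jlip ^ 2 * ‖z‖ ^ 2 ≤
        (2 * J.jlip + J.jlip ^ 2) * (‖z‖ + ‖z‖ ^ 2) := by
      have : 0 ≤ J.jlip * ‖z‖ ^ 2 := by positivity
      have : 0 ≤ J.jlip ^ 2 * ‖z‖ := by positivity
      linarith
    have e3 := mul_le_mul_of_nonneg_left e2 (sq_nonneg (ν * a))
    linarith
  have t3 : ν * (regNorm η (e (x + w) - e (y + w')) - regNorm η (e x - e y)) ≤
      C' * (ν * a) * ‖z‖ := by
    have := mul_le_mul_of_nonneg_left (h3.trans hdb) hν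
    linarith
  have t4 : (20 * Cj * δ + C' * (ν * a)) * ‖z‖ ≤
      (20 * Cj * δ + C' * (ν * a)) * (‖z‖ + ‖z‖ ^ 2) :=
    mul_le_mul_of_nonneg_left (by nlinarith) (by positivity)
  linarith

end Penalization

end CensoredNeumann

end


/-! ### Existence and convergence of maximum pairs. -/

noncomputable section

namespace CensoredNeumann

open Set Filter Topology MeasureTheory

section Maxima

lemma exists_isMaxOn_of_far {X : Type*} [NormedAddCommGroup X] [ProperSpace X] {s : Set X}
    (hs : IsClosed s) {f : X → ℝ} (hf : UpperSemicontinuousOn f s) {x₀ : X} (hx₀ : x₀ ∈ s) {R : ℝ}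
    (hfar : ∀ x ∈ s, R < ‖x - x₀‖ → f x ≤ f x₀) : ∃ x ∈ s, IsMaxOn f s x := by
  have hx₀R : x₀ ∈ Metric.closedBall x₀ (max R 0) ∩ s :=
    ⟨Metric.mem_closedBall_self (le_max_right _ _), hx₀⟩
  obtain ⟨x, hx, hmax⟩ := UpperSemicontinuousOn.exists_isMaxOn ⟨x₀, hx₀R⟩
    ((isCompact_closedBall x₀ (max R 0)).inter_right hs) (hf.mono inter_subset_right)
  refine ⟨x, hx.2, fun y hy => ?_⟩
  by_cases h : y ∈ Metric.closedBall x₀ (max R 0)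
  · exact hmax ⟨h, hy⟩
  · rw [mem_closedBall_iff_norm, not_le, max_lt_iff] at h
    exact (hfar y hy h.1).trans (hmax hx₀R)

variable {N : ℕ} {F : Type*} [NormedAddCommGroup F] [InnerProductSpace ℝ F]
variable {Ω : Set (RN N)} {μ : RN N → Measure (RN N)} {j : RN N → RN N → RN N}
  {σ Cj : ℝ} {D : RN N → ℝ} {x₀ : RN N} {r C C' δ ν η : ℝ} {e : RN N → F} {U V : RN N → ℝ}
  {x y : RN N}

/-- Maximum points of a bounded upper semicontinuous function confined by a growing one. -/
lemma exists_max_confined {f : RN N → ℝ} (hf : UpperSemicontinuousOn f (closure Ω)) {M : ℝ}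
    (hM : ∀ x ∈ closure Ω, |f x| ≤ M) (hne : (closure Ω).Nonempty) (hδ : 0 < δ) :
    ∃ x ∈ closure Ω, ∀ y ∈ closure Ω, f y - δ * regNorm 1 y ≤ f x - δ * regNorm 1 x := by
  obtain ⟨x₀, hx₀⟩ := hne
  have husc : UpperSemicontinuousOn (fun y => f y - δ * regNorm 1 y) (closure Ω) := by
    have h1 : Continuous fun y : RN N => -(δ * regNorm 1 y) :=
      (continuous_const.mul (continuous_regNorm 1)).neg
    simpa [sub_eq_add_neg] using hf.add (h1.upperSemicontinuous.upperSemicontinuousOn _)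
  obtain ⟨x, hx, hmax⟩ := exists_isMaxOn_of_far isClosed_closure husc hx₀
    (R := 2 * M / δ + regNorm 1 x₀ + ‖x₀‖) fun y hy hyR => by
      have h1 := (abs_le.1 (hM y hy)).2
      have h2 := (abs_le.1 (hM x₀ hx₀)).1
      have h3 := norm_le_regNorm 1 y
      have h4 := norm_sub_le y x₀
      have h5 : 2 * M / δ + regNorm 1 x₀ ≤ regNorm 1 y := by linarith
      have h6 := mul_le_mul_of_nonneg_left h5 hδ.le
      rw [mul_add, mul_div_cancel₀ _ hδ.ne'] at h6
      linarith
  exact ⟨x, hx, fun y hy => hmax hy⟩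

lemma continuousOn_sidePen (hD : IsDefiningAt Ω j x₀ D r C) (hδ : 0 ≤ δ) (hν : 0 ≤ ν) :
    ContinuousOn (sidePen δ ν x₀ D) (closure Ω) := by
  have : LipschitzOnWith (Real.toNNReal (10 * δ)) (sidePen δ ν x₀ D) (closure Ω) :=
    LipschitzOnWith.of_dist_le_mul fun y hy y' hy' => by
      rw [Real.dist_eq, dist_eq_norm, Real.coe_toNNReal _ (by positivity)]
      exact abs_sidePen_sub_le hD hδ hν hy hy'
  exact this.continuousOn

lemma IsCoupling.continuousOn (he : IsCoupling Ω j D x₀ r C e) : ContinuousOn e (closure Ω) := by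
  have : LipschitzOnWith 1 e (closure Ω) := LipschitzOnWith.of_dist_le_mul fun y hy y' hy' => by
    rw [dist_eq_norm, dist_eq_norm, NNReal.coe_one, one_mul]
    exact he.lip_closure y hy y' hy'
  exact this.continuousOn

lemma le_sidePen (hD : IsDefiningAt Ω j x₀ D r C) (hδ : 0 ≤ δ) (hν : 0 < ν) (hx : x ∈ closure Ω) :
    δ * (regNorm 1 x + regNorm 1 (x - x₀)) - 8 * δ / ν ≤ sidePen δ ν x₀ D x := by
  have h1 := mul_le_mul_of_nonneg_left (flat_le hν (hD.nonneg x hx))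
    (show 0 ≤ 8 * δ by positivity)
  unfold sidePen
  rw [mul_one_div] at h1
  linarith

/-- Basic comparison of a maximum pair with the diagonal point `(x₀, x₀)`. -/
lemma IsMaxPair.le_of_diag (hD : IsDefiningAt Ω j x₀ D r C) (hx₀ : x₀ ∈ closure Ω)
    (hδ : 0 ≤ δ) (hν : 0 < ν) (hη : 0 ≤ η) (h : IsMaxPair Ω U V δ ν η x₀ D e x y) :
    U x₀ + V x₀ - 2 * δ * regNorm 1 x₀ + (ν * ‖x - y‖) ^ 2 + δ * regNorm 1 x +
      δ * regNorm 1 y + δ * (regNorm 1 (x - x₀) - 1) + δ * (regNorm 1 (y - x₀) - 1) ≤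
      U x + V y + (16 * δ / ν + ν * η) := by
  have h0 := h.max x₀ hx₀ x₀ hx₀
  have h1 := le_sidePen hD hδ hν h.left_mem
  have h2 := le_sidePen hD hδ hν h.right_mem
  have h3 : sidePen δ ν x₀ D x₀ ≤ δ * (regNorm 1 x₀ + 1) := by
    have := mul_nonneg (show 0 ≤ 8 * δ by positivity) (flat_nonneg hν.le (hD.nonneg x₀ hx₀))
    unfold sidePen
    rw [sub_self, regNorm_zero zero_le_one]
    linarith
  have h4 : linkPen ν η e x₀ x₀ = ν * η := by
    unfold linkPen
    rw [sub_self, sub_self, regNorm_zero hη, norm_zero]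
    ring
  have h5 : (ν * ‖x - y‖) ^ 2 ≤ linkPen ν η e x y := by
    unfold linkPen
    have := mul_nonneg hν.le (hη.trans (le_regNorm η (e x - e y)))
    rw [mul_pow]
    linarith
  have h6 : 16 * δ / ν = 8 * δ / ν + 8 * δ / ν := by ring
  rw [h6]
  linarith

lemma exists_isMaxPair (hU : UpperSemicontinuousOn U (closure Ω))
    (hV : UpperSemicontinuousOn V (closure Ω)) {M : ℝ} (hUM : ∀ x ∈ closure Ω, |U x| ≤ M)
    (hVM : ∀ x ∈ closure Ω, |V x| ≤ M) (hD : IsDefiningAt Ω j x₀ D r C)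
    (he : IsCoupling Ω j D x₀ r C' e) (hx₀ : x₀ ∈ closure Ω) (hδ : 0 < δ) (hν : 0 < ν)
    (hη : 0 ≤ η) : ∃ x y, IsMaxPair Ω U V δ ν η x₀ D e x y := by
  set f : RN N × RN N → ℝ := fun p => U p.1 + V p.2 +
    -(sidePen δ ν x₀ D p.1 + sidePen δ ν x₀ D p.2 + linkPen ν η e p.1 p.2) with hf
  have hfst : MapsTo Prod.fst (closure Ω ×ˢ closure Ω) (closure Ω) := fun p hp => hp.1
  have hsnd : MapsTo Prod.snd (closure Ω ×ˢ closure Ω) (closure Ω) := fun p hp => hp.2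
  have hcont : ContinuousOn (fun p : RN N × RN N =>
      -(sidePen δ ν x₀ D p.1 + sidePen δ ν x₀ D p.2 + linkPen ν η e p.1 p.2))
      (closure Ω ×ˢ closure Ω) := by
    have h1 := (continuousOn_sidePen hD hδ.le hν.le).comp continuousOn_fst hfst
    have h2 := (continuousOn_sidePen hD hδ.le hν.le).comp continuousOn_snd hsnd
    have h3 := (he.continuousOn.comp continuousOn_fst hfst).sub
      (he.continuousOn.comp continuousOn_snd hsnd)
    have h4 := (continuous_regNorm (E := F) η).comp_continuousOn h3
    have h5 : ContinuousOn (fun p : RN N × RN N => ν ^ 2 * ‖p.1 - p.2‖ ^ 2)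
        (closure Ω ×ˢ closure Ω) := by fun_prop
    exact ((h1.add h2).add (h5.add (continuousOn_const.mul h4))).neg
  have hU' : UpperSemicontinuousOn (fun p : RN N × RN N => U p.1) (closure Ω ×ˢ closure Ω) :=
    fun p hp c hc => (continuous_fst.continuousWithinAt.tendsto_nhdsWithin hfst).eventually
      (hU p.1 hp.1 c hc)
  have hV' : UpperSemicontinuousOn (fun p : RN N × RN N => V p.2) (closure Ω ×ˢ closure Ω) :=
    fun p hp c hc => (continuous_snd.continuousWithinAt.tendsto_nhdsWithin hsnd).eventually
      (hV p.2 hp.2 c hc)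
  have husc : UpperSemicontinuousOn f (closure Ω ×ˢ closure Ω) :=
    (hU'.add hV').add hcont.upperSemicontinuousOn
  -- Beyond this radius the growth of `δ * regNorm 1 (· - x₀)` outweighs the oscillation of `U + V`
  -- and the bounded gain `16δ/ν` of the boundary correction.
  have hfar : ∀ p ∈ closure Ω ×ˢ closure Ω,
      (4 * M - f (x₀, x₀) + 16 * δ / ν) / δ < ‖p - (x₀, x₀)‖ → f p ≤ f (x₀, x₀) := by
    intro p hp hpR
    have h1 := le_sidePen hD hδ.le hν hp.1
    have h2 := le_sidePen hD hδ.le hν hp.2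
    have h3 : 0 ≤ linkPen ν η e p.1 p.2 := by
      have := hη.trans (le_regNorm η (e p.1 - e p.2))
      unfold linkPen
      positivity
    have hr : ∀ q : RN N, 0 ≤ δ * regNorm 1 q := fun q => mul_nonneg hδ.le (Real.sqrt_nonneg _)
    have h4 : ‖p - (x₀, x₀)‖ ≤ regNorm 1 (p.1 - x₀) + regNorm 1 (p.2 - x₀) := by
      rw [Prod.norm_def]
      have a1 := norm_le_regNorm 1 (p.1 - x₀)
      have a2 := norm_le_regNorm 1 (p.2 - x₀)
      have b1 := norm_nonneg (p.1 - x₀)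
      have b2 := norm_nonneg (p.2 - x₀)
      exact max_le (by simp only [Prod.fst_sub]; linarith) (by simp only [Prod.snd_sub]; linarith)
    have h5 := mul_lt_mul_of_pos_left (hpR.trans_le h4) hδ
    rw [mul_div_cancel₀ _ hδ.ne'] at h5
    have h6 := (abs_le.1 (hUM _ hp.1)).2
    have h7 := (abs_le.1 (hVM _ hp.2)).2
    have h8 : 16 * δ / ν = 8 * δ / ν + 8 * δ / ν := by ring
    have h9 := (abs_nonneg _).trans (hUM _ hx₀)
    have h10 := hr p.1
    have h11 := hr p.2
    have : f p = U p.1 + V p.2 +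
      -(sidePen δ ν x₀ D p.1 + sidePen δ ν x₀ D p.2 + linkPen ν η e p.1 p.2) := rfl
    linarith
  obtain ⟨p, hp, hmax⟩ := exists_isMaxOn_of_far (isClosed_closure.prod isClosed_closure) husc
    (x₀ := (x₀, x₀)) ⟨hx₀, hx₀⟩ hfar
  exact ⟨p.1, p.2, hp.1, hp.2, fun x' hx' y' hy' => by
      have : f (x', y') ≤ f p := hmax (show (x', y') ∈ closure Ω ×ˢ closure Ω from ⟨hx', hy'⟩)
      simp only [hf] at this
      linarith⟩

/-- The maximum points of the penalized doubling converge. -/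
theorem exists_maxPair_seq (hU : UpperSemicontinuousOn U (closure Ω))
    (hV : UpperSemicontinuousOn V (closure Ω)) {M : ℝ} (hUM : ∀ x ∈ closure Ω, |U x| ≤ M)
    (hVM : ∀ x ∈ closure Ω, |V x| ≤ M) (hD : IsDefiningAt Ω j x₀ D r C)
    (he : IsCoupling Ω j D x₀ r C' e) (hx₀ : x₀ ∈ closure Ω) (hδ : 0 < δ)
    (hmax : ∀ y ∈ closure Ω, U y + V y - 2 * δ * regNorm 1 y ≤
      U x₀ + V x₀ - 2 * δ * regNorm 1 x₀)
    {h : ℕ → ℝ} (h0 : ∀ n, 0 < h n) (h1 : ∀ n : ℕ, ((n : ℝ) + 1) * h n ≤ 1 / ((n : ℝ) + 1)) :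
    ∃ φ : ℕ → ℕ, StrictMono φ ∧ ∃ x y : ℕ → RN N,
      (∀ k, IsMaxPair Ω U V δ ((φ k : ℝ) + 1) (h (φ k)) x₀ D e (x k) (y k)) ∧
      Tendsto x atTop (𝓝 x₀) ∧ Tendsto y atTop (𝓝 x₀) ∧
      Tendsto (fun k => ((φ k : ℝ) + 1) * ‖x k - y k‖) atTop (𝓝 0) := by
  have hn1 : ∀ n : ℕ, 0 < (n : ℝ) + 1 := fun n => by positivity
  choose X Y hXY using fun n : ℕ =>
    exists_isMaxPair hU hV hUM hVM hD he hx₀ hδ (hn1 n) (h0 n).le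
  -- The errors in the comparison with the diagonal: the boundary correction and the regularization
  -- `ν η`.
  set c : ℕ → ℝ := fun n => 16 * δ / ((n : ℝ) + 1) + 1 / ((n : ℝ) + 1) with hc
  have hclim : Tendsto c atTop (𝓝 0) := by
    have h2 := (tendsto_one_div_add_atTop_nhds_zero_nat (𝕜 := ℝ)).const_mul (16 * δ + 1)
    rw [mul_zero] at h2
    refine h2.congr fun n => ?_
    simp only [hc]; ring
  have hc1 : ∀ n, c n ≤ 16 * δ + 1 := fun n => by
    have h2 : 1 / ((n : ℝ) + 1) ≤ 1 := by
      rw [div_le_one (hn1 n)]; linarith [(Nat.cast_nonneg n : (0 : ℝ) ≤ n)]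
    have h3 : c n = (16 * δ + 1) * (1 / ((n : ℝ) + 1)) := by simp only [hc]; ring
    rw [h3]
    exact mul_le_of_le_one_right (by positivity) h2
  set m := U x₀ + V x₀ - 2 * δ * regNorm 1 x₀ with hm
  have hkey : ∀ n : ℕ, m + (((n : ℝ) + 1) * ‖X n - Y n‖) ^ 2 + δ * regNorm 1 (X n) +
      δ * regNorm 1 (Y n) + δ * (regNorm 1 (X n - x₀) - 1) + δ * (regNorm 1 (Y n - x₀) - 1) ≤
      U (X n) + V (Y n) + c n := fun n => by
    have h2 := (hXY n).le_of_diag hD hx₀ hδ.le (hn1 n) (h0 n).le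
    have h3 := h1 n
    simp only [hc]
    linarith
  have hpos : ∀ q : RN N, 0 ≤ δ * regNorm 1 q := fun q => mul_nonneg hδ.le (Real.sqrt_nonneg _)
  have hpos1 : ∀ q : RN N, 0 ≤ δ * (regNorm 1 q - 1) := fun q =>
    mul_nonneg hδ.le (sub_nonneg.2 (le_regNorm 1 q))
  set B := 2 * M + 16 * δ + 1 - m with hB
  have hbd : ∀ n, U (X n) + V (Y n) + c n - m ≤ B := fun n => by
    have h2 := (abs_le.1 (hUM _ (hXY n).left_mem)).2
    have h3 := (abs_le.1 (hVM _ (hXY n).right_mem)).2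
    linarith [hc1 n]
  have hreg : ∀ q : RN N, δ * (regNorm 1 q - 1) ≤ B → ‖q‖ ≤ B / δ + 1 := fun q hq => by
    have h2 := norm_le_regNorm 1 q
    have h3 : regNorm 1 q - 1 ≤ B / δ := by rw [le_div_iff₀ hδ]; linarith
    linarith
  have hXb : ∀ n, X n ∈ Metric.closedBall x₀ (B / δ + 1) := fun n => by
    rw [mem_closedBall_iff_norm]
    refine hreg _ ?_
    linarith [hkey n, hbd n, hpos (X n), hpos (Y n), hpos1 (Y n - x₀),
      sq_nonneg (((n : ℝ) + 1) * ‖X n - Y n‖)]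
  have hYb : ∀ n, Y n ∈ Metric.closedBall x₀ (B / δ + 1) := fun n => by
    rw [mem_closedBall_iff_norm]
    refine hreg _ ?_
    linarith [hkey n, hbd n, hpos (X n), hpos (Y n), hpos1 (X n - x₀),
      sq_nonneg (((n : ℝ) + 1) * ‖X n - Y n‖)]
  obtain ⟨p, -, φ, hφ, hlim⟩ :=
    ((isCompact_closedBall x₀ (B / δ + 1)).prod (isCompact_closedBall x₀ (B / δ + 1))).tendsto_subseq
      (x := fun n => (X n, Y n)) fun n => ⟨hXb n, hYb n⟩
  have hXl : Tendsto (fun k => X (φ k)) atTop (𝓝 p.1) := (continuous_fst.tendsto p).comp hlim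
  have hYl : Tendsto (fun k => Y (φ k)) atTop (𝓝 p.2) := (continuous_snd.tendsto p).comp hlim
  have hp1 : p.1 ∈ closure Ω := isClosed_closure.mem_of_tendsto hXl
    (Eventually.of_forall fun k => (hXY _).left_mem)
  have hp2 : p.2 ∈ closure Ω := isClosed_closure.mem_of_tendsto hYl
    (Eventually.of_forall fun k => (hXY _).right_mem)
  have hφn : Tendsto (fun k => 1 / ((φ k : ℝ) + 1)) atTop (𝓝 0) :=
    (tendsto_one_div_add_atTop_nhds_zero_nat (𝕜 := ℝ)).comp hφ.tendsto_atTop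
  have hcφ : Tendsto (fun k => c (φ k)) atTop (𝓝 0) := hclim.comp hφ.tendsto_atTop
  have hsq : ∀ n : ℕ, (((n : ℝ) + 1) * ‖X n - Y n‖) ^ 2 ≤ B := fun n => by
    linarith [hkey n, hbd n, hpos (X n), hpos (Y n), hpos1 (X n - x₀), hpos1 (Y n - x₀)]
  have hB0 : 0 ≤ B := (sq_nonneg _).trans (hsq 0)
  -- First a crude bound: `ν‖X - Y‖` stays bounded, so the two sequences have a common limit;
  -- semicontinuity at that limit then improves it to `ν‖X - Y‖ → 0`.
  have hdist : Tendsto (fun k => ‖X (φ k) - Y (φ k)‖) atTop (𝓝 0) := by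
    have h2 := hφn.const_mul (√B)
    rw [mul_zero] at h2
    refine squeeze_zero (fun _ => norm_nonneg _) (fun k => ?_) h2
    have h3 := Real.le_sqrt_of_sq_le (hsq (φ k))
    rw [mul_one_div, le_div_iff₀ (hn1 _)]
    linarith
  have hpp : p.1 = p.2 := by
    have h2 := (hXl.sub hYl).norm
    have h3 := tendsto_nhds_unique h2 hdist
    exact sub_eq_zero.1 (norm_eq_zero.1 h3)
  have hregc : Continuous (regNorm 1 : RN N → ℝ) := continuous_regNorm 1
  have hA : Tendsto (fun k => c (φ k) - (δ * regNorm 1 (X (φ k)) + δ * regNorm 1 (Y (φ k)) +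
      δ * (regNorm 1 (X (φ k) - x₀) - 1) + δ * (regNorm 1 (Y (φ k) - x₀) - 1))) atTop
      (𝓝 (-(2 * δ * regNorm 1 p.1 + 2 * δ * (regNorm 1 (p.1 - x₀) - 1)))) := by
    have q1 := (((hregc.tendsto p.1).comp hXl).const_mul δ)
    have q2 := (((hregc.tendsto p.2).comp hYl).const_mul δ)
    have q3 := ((((hregc.tendsto (p.1 - x₀)).comp (hXl.sub_const x₀)).sub_const 1).const_mul δ)
    have q4 := ((((hregc.tendsto (p.2 - x₀)).comp (hYl.sub_const x₀)).sub_const 1).const_mul δ)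
    have := hcφ.sub (((q1.add q2).add q3).add q4)
    rw [← hpp] at this
    rw [show -(2 * δ * regNorm 1 p.1 + 2 * δ * (regNorm 1 (p.1 - x₀) - 1)) =
      0 - (δ * regNorm 1 p.1 + δ * regNorm 1 p.1 + δ * (regNorm 1 (p.1 - x₀) - 1) +
        δ * (regNorm 1 (p.1 - x₀) - 1)) by ring]
    exact this
  have husc : ∀ ε > 0, ∀ᶠ k in atTop, U (X (φ k)) + V (Y (φ k)) ≤ U p.1 + V p.1 + ε := by
    intro ε hε
    have h2 := (tendsto_nhdsWithin_iff.2 ⟨hXl, Eventually.of_forall fun k =>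
      (hXY (φ k)).left_mem⟩).eventually (hU p.1 hp1 (U p.1 + ε / 2) (by linarith))
    have h3 := (tendsto_nhdsWithin_iff.2 ⟨hYl, Eventually.of_forall fun k =>
      (hXY (φ k)).right_mem⟩).eventually (hV p.2 hp2 (V p.2 + ε / 2) (by linarith))
    filter_upwards [h2, h3] with k h2 h3
    rw [← hpp] at h3
    linarith
  have hsqe : ∀ ε > 0, ∀ᶠ k in atTop, (((φ k : ℝ) + 1) * ‖X (φ k) - Y (φ k)‖) ^ 2 ≤
      U p.1 + V p.1 - 2 * δ * regNorm 1 p.1 - m - 2 * δ * (regNorm 1 (p.1 - x₀) - 1) + ε := by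
    intro ε hε
    filter_upwards [husc (ε / 2) (by linarith), hA.eventually (gt_mem_nhds
      (show _ < -(2 * δ * regNorm 1 p.1 + 2 * δ * (regNorm 1 (p.1 - x₀) - 1)) + ε / 2 by linarith))]
      with k h2 h3
    linarith [hkey (φ k)]
  -- As `x₀` maximizes `U + V - 2δ regNorm 1`, the additional penalty `regNorm 1 (· - x₀) - 1` must
  -- vanish at the limit point.
  have hpx : p.1 = x₀ := by
    have h2 : 2 * δ * (regNorm 1 (p.1 - x₀) - 1) ≤ 0 := by
      refine le_of_forall_pos_le_add fun ε hε => ?_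
      obtain ⟨k, hk⟩ := (hsqe ε hε).exists
      linarith [hmax p.1 hp1, sq_nonneg (((φ k : ℝ) + 1) * ‖X (φ k) - Y (φ k)‖)]
    have h3 : regNorm 1 (p.1 - x₀) ≤ 1 := by nlinarith
    have h4 : regNorm 1 (p.1 - x₀) ^ 2 = ‖p.1 - x₀‖ ^ 2 + 1 ^ 2 := Real.sq_sqrt (by positivity)
    have h5 : ‖p.1 - x₀‖ ^ 2 ≤ 0 := by
      nlinarith [regNorm_pos one_pos (p.1 - x₀)]
    have h6 : ‖p.1 - x₀‖ = 0 := by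
      have := le_antisymm h5 (sq_nonneg _)
      exact pow_eq_zero_iff two_ne_zero |>.1 this
    exact sub_eq_zero.1 (norm_eq_zero.1 h6)
  refine ⟨φ, hφ, fun k => X (φ k), fun k => Y (φ k), fun k => hXY (φ k), hpx ▸ hXl,
    hpx ▸ hpp ▸ hYl, ?_⟩
  have hsq0 : Tendsto (fun k => (((φ k : ℝ) + 1) * ‖X (φ k) - Y (φ k)‖) ^ 2) atTop (𝓝 0) := by
    refine tendsto_order.2 ⟨fun a ha => Eventually.of_forall fun k => ha.trans_le (sq_nonneg _),
      fun a ha => ?_⟩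
    filter_upwards [hsqe (a / 2) (by linarith)] with k hk
    rw [hpx, sub_self x₀, regNorm_zero zero_le_one] at hk
    linarith
  have := hsq0.sqrt
  rw [Real.sqrt_zero] at this
  exact this.congr fun k => Real.sqrt_sq (mul_nonneg (hn1 _).le (norm_nonneg _))

end Maxima

end CensoredNeumann

end


/-! ### Gradients of the penalization and the two viscosity inequalities. -/

noncomputable section

namespace CensoredNeumann

open Set Filter Topology MeasureTheory

section Doubling

variable {N : ℕ} {F : Type*} [NormedAddCommGroup F] [InnerProductSpace ℝ F]
variable {Ω : Set (RN N)} {μ : RN N → Measure (RN N)} {j : RN N → RN N → RN N}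
  {σ Cj : ℝ} {D : RN N → ℝ} {x₀ : RN N} {r C C' δ ν η : ℝ} {e : RN N → F} {U V : RN N → ℝ}
  {x y : RN N} {G₁ G₂ : RN N → RN N → ℝ}

/-- Two Hamiltonians which cannot both be small for opposite large gradients in the directions
selected by `e`. -/
def NondegenerateAt (Ω : Set (RN N)) (e : RN N → F) (G₁ G₂ : RN N → RN N → ℝ) (x₀ : RN N)
    (θ : ℝ) : Prop :=
  ∀ K : ℝ, ∃ ε > 0, ∃ n₀ : ℝ, ∀ ν ≥ n₀, ∀ x ∈ closure Ω, ∀ y ∈ closure Ω, ‖x - x₀‖ < ε →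
    ‖y - x₀‖ < ε → e x ≠ e y → ∀ ω : F, 1 / 2 ≤ ‖ω‖ → ‖ω‖ ≤ 1 → ∀ p q : RN N,
    (∀ v, |inner ℝ p v - ν * inner ℝ ω (fderiv ℝ e x v)| ≤ ε * ν * ‖v‖) →
    (∀ v, |inner ℝ q v + ν * inner ℝ ω (fderiv ℝ e y v)| ≤ ε * ν * ‖v‖) →
    G₁ x p ≤ K * (1 + ν ^ θ) → G₂ y q ≤ K * (1 + ν ^ θ) → False

/-- The sum of two Hamiltonians at nearby points, for nearly opposite gradients, is at
least `-η`. -/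
def AlmostOppositeAt (Ω : Set (RN N)) (e : RN N → F) (G₁ G₂ : RN N → RN N → ℝ) (x₀ : RN N)
    (h : ℕ → ℝ) (d η : ℝ) : Prop :=
  ∃ ε > 0, ∀ᶠ n : ℕ in atTop, ∀ x ∈ closure Ω, ∀ y ∈ closure Ω, ‖x - x₀‖ < ε → ‖y - x₀‖ < ε →
    ((n : ℝ) + 1) * ‖x - y‖ ≤ ε → ‖e x - e y‖ ≤ h n → ∀ p q : RN N, ‖p‖ ≤ 22 * ((n : ℝ) + 1) →
    ‖q‖ ≤ 22 * ((n : ℝ) + 1) → ‖p + q‖ ≤ d → -η ≤ G₁ x p + G₂ y q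

lemma norm_le_of_inner_le {p : RN N} {B : ℝ} (hB : 0 ≤ B) (h : ∀ v, |inner ℝ p v| ≤ B * ‖v‖) :
    ‖p‖ ≤ B := by
  have h1 := h p
  rw [real_inner_self_eq_norm_sq, abs_of_nonneg (sq_nonneg _)] at h1
  rcases eq_or_lt_of_le (norm_nonneg p) with h0 | h0
  · rwa [← h0]
  · nlinarith

/-- The gradient of the penalization is close to the gradient of its singular part. -/
lemma abs_inner_gradient_pen_sub_le (hD : IsDefiningAt Ω j x₀ D r C) (hδ : 0 ≤ δ) (hν : 0 ≤ ν)
    (hη : 0 < η) (he : IsC11Near e x₀ r C') (hx : x ∈ closure Ω) (hxb : x ∈ Metric.ball x₀ r)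
    (v : RN N) :
    |inner ℝ (gradient (fun x => sidePen δ ν x₀ D x + linkPen ν η e x y) x) v -
      ν * inner ℝ ((regNorm η (e x - e y))⁻¹ • (e x - e y)) (fderiv ℝ e x v)| ≤
      (18 * δ + 2 * ν * (ν * ‖x - y‖)) * ‖v‖ := by
  obtain ⟨β, hβ, hg⟩ := exists_inner_gradient_pen (δ := δ) (y := y) hD hδ hν hη he hx hxb
  rw [hg v, real_inner_smul_left]
  have h1 := abs_le.1 ((β.le_opNorm v).trans (mul_le_mul_of_nonneg_right hβ (norm_nonneg v)))
  have h2 := abs_le.1 (((fderiv ℝ D x).le_opNorm v).trans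
    (mul_le_mul_of_nonneg_right (hD.norm_le x hxb) (norm_nonneg v)))
  have h3 := abs_le.1 (abs_real_inner_le_norm (x - y) v)
  have hDx := hD.nonneg x hx
  set t := 1 / (1 + ν * D x) ^ 2 with ht
  have ht0 : 0 ≤ t := by positivity
  have ht1 : t ≤ 1 := by
    rw [ht, div_le_one (by positivity)]
    nlinarith [mul_nonneg hν hDx]
  have h4 : |8 * δ * t * fderiv ℝ D x v| ≤ 16 * δ * ‖v‖ := by
    rw [abs_mul, abs_of_nonneg (by positivity)]
    have a1 : |fderiv ℝ D x v| ≤ 2 * ‖v‖ := abs_le.2 h2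
    have a2 : 8 * δ * t ≤ 8 * δ := mul_le_of_le_one_right (by positivity) ht1
    calc _ ≤ 8 * δ * (2 * ‖v‖) := mul_le_mul a2 a1 (abs_nonneg _) (by positivity)
      _ = _ := by ring
  have h4 := abs_le.1 h4
  have h5 : |2 * ν ^ 2 * inner ℝ (x - y) v| ≤ 2 * ν ^ 2 * (‖x - y‖ * ‖v‖) := by
    rw [abs_mul, abs_of_nonneg (by positivity)]
    exact mul_le_mul_of_nonneg_left (abs_le.2 h3) (by positivity)
  have h5 := abs_le.1 h5
  rw [abs_le]
  constructor <;> nlinarith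

lemma norm_inv_regNorm_smul_le (hη : 0 < η) (s : F) : ‖(regNorm η s)⁻¹ • s‖ ≤ 1 := by
  have h0 := regNorm_pos hη s
  rw [norm_smul, norm_inv, Real.norm_of_nonneg h0.le, inv_mul_le_iff₀ h0, mul_one]
  exact norm_le_regNorm η s

/-- Beyond the regularization scale `regNorm η s ≤ η + ‖s‖ ≤ 2‖s‖`, so the direction of the coupling
is not degenerate. -/
lemma half_le_norm_inv_regNorm_smul (hη : 0 < η) {s : F} (hs : η ≤ ‖s‖) :
    1 / 2 ≤ ‖(regNorm η s)⁻¹ • s‖ := by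
  have h0 := regNorm_pos hη s
  rw [norm_smul, norm_inv, Real.norm_of_nonneg h0.le, ← div_eq_inv_mul, le_div_iff₀ h0]
  have h1 := regNorm_le_add η s 0
  rw [regNorm_zero hη.le, sub_zero] at h1
  linarith

/-- The constant is `18 + 2` from the confining and quadratic parts, using `δ ≤ 1 ≤ ν` and `ν‖x - y‖
≤ 1`, plus `2` from the coupling, since `‖De‖ ≤ 2`. -/
lemma norm_gradient_pen_le (hD : IsDefiningAt Ω j x₀ D r C) (hδ : 0 ≤ δ) (hδ1 : δ ≤ 1)
    (hν : 1 ≤ ν) (hη : 0 < η) (he : IsC11Near e x₀ r C') (hx : x ∈ closure Ω)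
    (hxb : x ∈ Metric.ball x₀ r) (ha : ν * ‖x - y‖ ≤ 1) :
    ‖gradient (fun x => sidePen δ ν x₀ D x + linkPen ν η e x y) x‖ ≤ 22 * ν := by
  refine norm_le_of_inner_le (by linarith) fun v => ?_
  have h1 := abs_inner_gradient_pen_sub_le (δ := δ) (y := y) hD hδ (zero_le_one.trans hν) hη he hx
    hxb v
  set ω := (regNorm η (e x - e y))⁻¹ • (e x - e y)
  set p := gradient (fun x => sidePen δ ν x₀ D x + linkPen ν η e x y) x
  have h2 : |ν * inner ℝ ω (fderiv ℝ e x v)| ≤ ν * (2 * ‖v‖) := by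
    rw [abs_mul, abs_of_nonneg (zero_le_one.trans hν)]
    refine mul_le_mul_of_nonneg_left ((abs_real_inner_le_norm _ _).trans ?_) (zero_le_one.trans hν)
    have a1 := norm_inv_regNorm_smul_le hη (e x - e y)
    have a2 := ((fderiv ℝ e x).le_opNorm v).trans
      (mul_le_mul_of_nonneg_right (he.norm_le x hxb) (norm_nonneg v))
    calc _ ≤ 1 * (2 * ‖v‖) := mul_le_mul a1 a2 (norm_nonneg _) zero_le_one
      _ = _ := one_mul _
  have h3 := abs_add_le (inner ℝ p v - ν * inner ℝ ω (fderiv ℝ e x v))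
    (ν * inner ℝ ω (fderiv ℝ e x v))
  rw [sub_add_cancel] at h3
  have h4 : 18 * δ + 2 * ν * (ν * ‖x - y‖) ≤ 20 * ν := by nlinarith
  have h5 := mul_le_mul_of_nonneg_right h4 (norm_nonneg v)
  linarith

/-- The two gradients of the penalization are almost opposite. -/
lemma norm_gradient_add_gradient_le (hD : IsDefiningAt Ω j x₀ D r C) (hC' : 0 ≤ C') (hδ : 0 ≤ δ)
    (hν : 0 ≤ ν) (hη : 0 < η) (he : IsC11Near e x₀ r C') (hx : x ∈ closure Ω)
    (hxb : x ∈ Metric.ball x₀ r) (hy : y ∈ closure Ω) (hyb : y ∈ Metric.ball x₀ r) :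
    ‖gradient (fun x => sidePen δ ν x₀ D x + linkPen ν η e x y) x +
      gradient (fun y => sidePen δ ν x₀ D y + linkPen ν η e y x) y‖ ≤
      36 * δ + C' * (ν * ‖x - y‖) := by
  refine norm_le_of_inner_le (by positivity) fun v => ?_
  obtain ⟨β, hβ, hg⟩ := exists_inner_gradient_pen (δ := δ) (y := y) hD hδ hν hη he hx hxb
  obtain ⟨β', hβ', hg'⟩ := exists_inner_gradient_pen (δ := δ) (y := x) hD hδ hν hη he hy hyb
  have aux : ∀ (β : RN N →L[ℝ] ℝ), ‖β‖ ≤ 2 * δ → ∀ x ∈ closure Ω, x ∈ Metric.ball x₀ r →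
      |β v - 8 * δ * (1 / (1 + ν * D x) ^ 2) * fderiv ℝ D x v| ≤ 18 * δ * ‖v‖ := by
    intro β hβ x hx hxb
    have h1 := ((β.le_opNorm v).trans (mul_le_mul_of_nonneg_right hβ (norm_nonneg v)))
    have h2 := (((fderiv ℝ D x).le_opNorm v).trans
      (mul_le_mul_of_nonneg_right (hD.norm_le x hxb) (norm_nonneg v)))
    have hDx := hD.nonneg x hx
    set t := 1 / (1 + ν * D x) ^ 2 with ht
    have ht0 : 0 ≤ t := by positivity
    have ht1 : t ≤ 1 := by
      rw [ht, div_le_one (by positivity)]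
      nlinarith [mul_nonneg hν hDx]
    have h4 : |8 * δ * t * fderiv ℝ D x v| ≤ 16 * δ * ‖v‖ := by
      rw [abs_mul, abs_of_nonneg (by positivity)]
      have a2 : 8 * δ * t ≤ 8 * δ := mul_le_of_le_one_right (by positivity) ht1
      calc _ ≤ 8 * δ * (2 * ‖v‖) := mul_le_mul a2 h2 (abs_nonneg _) (by positivity)
        _ = _ := by ring
    refine (abs_sub _ _).trans ?_
    rw [Real.norm_eq_abs] at h1
    linarith
  have h1 := aux β hβ x hx hxb
  have h2 := aux β' hβ' y hy hyb
  rw [inner_add_left, hg v, hg' v]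
  have e1 : regNorm η (e y - e x) = regNorm η (e x - e y) := by
    rw [← neg_sub (e x), regNorm_neg]
  have e2 : inner ℝ (y - x) v = -inner ℝ (x - y) v := by rw [← neg_sub x, inner_neg_left]
  have e3 : inner ℝ (e y - e x) (fderiv ℝ e y v) = -inner ℝ (e x - e y) (fderiv ℝ e y v) := by
    rw [← neg_sub (e x), inner_neg_left]
  have hR := regNorm_pos hη (e x - e y)
  -- The quadratic parts cancel exactly; the coupling parts cancel up to the variation of `De`
  -- between the two points, which costs `C'ν‖x - y‖`.
  have h3 : |ν * (regNorm η (e x - e y))⁻¹ *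
      (inner ℝ (e x - e y) (fderiv ℝ e x v) - inner ℝ (e x - e y) (fderiv ℝ e y v))| ≤
      C' * (ν * ‖x - y‖) * ‖v‖ := by
    rw [← inner_sub_right, ← sub_apply, mul_assoc, ← real_inner_smul_left,
      abs_mul, abs_of_nonneg hν]
    have a1 := norm_inv_regNorm_smul_le hη (e x - e y)
    have a2 := ((fderiv ℝ e x - fderiv ℝ e y).le_opNorm v).trans
      (mul_le_mul_of_nonneg_right (he.lip x hxb y hyb) (norm_nonneg v))
    calc _ ≤ ν * (1 * (C' * ‖x - y‖ * ‖v‖)) :=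
          mul_le_mul_of_nonneg_left ((abs_real_inner_le_norm _ _).trans
            (mul_le_mul a1 a2 (norm_nonneg _) zero_le_one)) hν
      _ = _ := by ring
  rw [e1, e2, e3]
  have h1 := abs_le.1 h1
  have h2 := abs_le.1 h2
  have h3 := abs_le.1 h3
  rw [abs_le]
  constructor <;> linarith

/-- At a point of subsolution the Hamiltonian is controlled by the increments. -/
lemma SubAt.hamiltonian_le [NeZero N] (J : JumpKernel Ω μ j σ Cj) {p : RN N} (hU : Adm Ω U)
    (hx : x ∈ closure Ω) (h : SubAt Ω μ j G₁ U x p) {B L M : ℝ} (hB : 0 ≤ B) (hL : 0 ≤ L)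
    (hM : |U x| ≤ M)
    (hincU : ∀ z, x + j x z ∈ closure Ω → U (x + j x z) - U x ≤ min B (L * ‖z‖)) :
    G₁ x p ≤ J.C * (∫ z : RN N, min B (L * ‖z‖) * kern σ z) + M + 1 := by
  obtain ⟨ξ, h1, h2⟩ := ((h 1 one_pos).and self_mem_nhdsWithin).exists
  have h3 := J.outerPart_le_of_incr hU hx hB hL hincU (show 0 < ξ from h2)
  linarith [(abs_le.1 hM).1]

/-- The sum of the two viscosity inequalities. -/
lemma SubAt.add_le {p q : RN N} {I : ℝ}
    (h₁ : SubAt Ω μ j G₁ U x p) (h₂ : SubAt Ω μ j G₂ V y q)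
    (hI : ∀ ξ > 0, outerPart Ω μ j ξ U x + outerPart Ω μ j ξ V y ≤ I) :
    U x + V y + (G₁ x p + G₂ y q) ≤ I := by
  refine le_of_forall_pos_le_add fun η hη => ?_
  obtain ⟨ξ, h1, h2, h3⟩ := ((h₁ (η / 2) (half_pos hη)).and
    ((h₂ (η / 2) (half_pos hη)).and self_mem_nhdsWithin)).exists
  linarith [hI ξ h3]

end Doubling

end CensoredNeumann

end


/-! ### The doubling of variables. -/

noncomputable section

namespace CensoredNeumann

open Set Filter Topology MeasureTheory

section DoublingTheorem

variable {N : ℕ} {F : Type*} [NormedAddCommGroup F] [InnerProductSpace ℝ F]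
variable {Ω : Set (RN N)} {μ : RN N → Measure (RN N)} {j : RN N → RN N → RN N}
  {σ Cj : ℝ} {D : RN N → ℝ} {x₀ : RN N} {r C C' δ ν η : ℝ} {e : RN N → F} {U V : RN N → ℝ}
  {x y : RN N} {G₁ G₂ : RN N → RN N → ℝ}

lemma rpow_le_one_add {s θ : ℝ} (hs : 0 ≤ s) (hθ1 : θ ≤ 1) (hθ0 : 0 ≤ θ) : s ^ θ ≤ 1 + s := by
  rcases le_total s 1 with h | h
  · linarith [Real.rpow_le_one hs h hθ0]
  · have := Real.rpow_le_rpow_of_exponent_le h hθ1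
    rw [Real.rpow_one] at this
    linarith

/-- At the maximum points of the penalized doubling, the images under `e` are within the
regularization scale. -/
lemma NondegenerateAt.norm_sub_le [NeZero N] (J : JumpKernel Ω μ j σ Cj) {θ : ℝ} (hθ : σ < θ)
    (hθ1 : θ < 1) (hnd : NondegenerateAt Ω e G₁ G₂ x₀ θ) (hD : IsDefiningAt Ω j x₀ D r C)
    (he : IsCoupling Ω j D x₀ r C' e) (hδ : 0 ≤ δ) {c M : ℝ} (hc : 0 ≤ c) (hM : 0 ≤ M)
    {ν η : ℕ → ℝ} {x y : ℕ → RN N} (hη : ∀ k, 0 < η k) (hν : Tendsto ν atTop atTop)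
    (hx : ∀ k, x k ∈ closure Ω) (hy : ∀ k, y k ∈ closure Ω) (hU : Adm Ω U) (hV : Adm Ω V)
    (hUM : ∀ x ∈ closure Ω, |U x| ≤ M) (hVM : ∀ x ∈ closure Ω, |V x| ≤ M)
    (hxl : Tendsto x atTop (𝓝 x₀)) (hyl : Tendsto y atTop (𝓝 x₀))
    (hxy : Tendsto (fun k => ν k * ‖x k - y k‖) atTop (𝓝 0))
    (hincU : ∀ᶠ k in atTop, ∀ z, x k + j (x k) z ∈ closure Ω →
      U (x k + j (x k) z) - U (x k) ≤ min (2 * M) (c * ν k * ‖z‖))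
    (hincV : ∀ᶠ k in atTop, ∀ z, y k + j (y k) z ∈ closure Ω →
      V (y k + j (y k) z) - V (y k) ≤ min (2 * M) (c * ν k * ‖z‖))
    (hsU : ∀ᶠ k in atTop, SubAt Ω μ j G₁ U (x k)
      (gradient (fun x => sidePen δ (ν k) x₀ D x + linkPen (ν k) (η k) e x (y k)) (x k)))
    (hsV : ∀ᶠ k in atTop, SubAt Ω μ j G₂ V (y k)
      (gradient (fun y => sidePen δ (ν k) x₀ D y + linkPen (ν k) (η k) e y (x k)) (y k))) :
    ∀ᶠ k in atTop, ‖e (x k) - e (y k)‖ ≤ η k := by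
  obtain ⟨Cθ, hCθ, hI⟩ := integral_min_lin_kern_le (N := N) J.σ_pos hθ hθ1
    (B := 2 * M) (by positivity)
  have hθ0 : 0 < θ := J.σ_pos.trans hθ
  -- With slopes `cν`, the nonlocal terms bound both Hamiltonians by `K(1 + ν^θ)`; this is the bound
  -- refuted by nondegeneracy.
  set K := J.C * Cθ * (1 + c ^ θ) + M + 1 with hK
  have hCJ := J.C_pos
  have hcθ : 0 ≤ c ^ θ := Real.rpow_nonneg hc _
  obtain ⟨ε, hε, n₀, hnd⟩ := hnd K
  have hbd : ∀ ν : ℝ, 0 ≤ ν → ∀ G : ℝ,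
      G ≤ J.C * (∫ z : RN N, min (2 * M) (c * ν * ‖z‖) * kern σ z) + M + 1 →
      G ≤ K * (1 + ν ^ θ) := by
    intro ν hν G hG
    have h1 := mul_le_mul_of_nonneg_left (hI (c * ν) (by positivity)) hCJ.le
    rw [Real.mul_rpow hc hν] at h1
    have hνθ : 0 ≤ ν ^ θ := Real.rpow_nonneg hν _
    have h2 : J.C * (Cθ * (1 + c ^ θ * ν ^ θ)) ≤ J.C * Cθ * (1 + c ^ θ) * (1 + ν ^ θ) := by
      have : 0 ≤ J.C * Cθ := by positivity
      have h3 : 1 + c ^ θ * ν ^ θ ≤ (1 + c ^ θ) * (1 + ν ^ θ) := by nlinarith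
      have := mul_le_mul_of_nonneg_left h3 this
      linarith
    have h4 : M + 1 ≤ (M + 1) * (1 + ν ^ θ) := by nlinarith
    rw [hK]
    linarith
  -- Relative to `ν`, all of the gradient except the coupling term is negligible.
  have hsmall : ∀ᶠ k in atTop, 18 * δ + 2 * ν k * (ν k * ‖x k - y k‖) ≤ ε * ν k := by
    filter_upwards [hxy.eventually (gt_mem_nhds (show 0 < ε / 4 by linarith)),
      hν.eventually_ge_atTop (max 0 (36 * δ / ε))] with k h1 h2
    have h3 : 0 ≤ ν k := (le_max_left _ _).trans h2
    have h4 : 36 * δ / ε ≤ ν k := (le_max_right _ _).trans h2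
    rw [div_le_iff₀ hε] at h4
    have h5 := mul_le_mul_of_nonneg_left h1.le (show 0 ≤ 2 * ν k by linarith)
    linarith
  have hball := Metric.ball_mem_nhds x₀ hD.r_pos
  have hballε := Metric.ball_mem_nhds x₀ hε
  filter_upwards [hincU, hincV, hsU, hsV, hsmall, hν.eventually_ge_atTop (max 0 n₀),
    hxl.eventually hball, hyl.eventually hball, hxl.eventually hballε, hyl.eventually hballε]
    with k kU kV kSU kSV ks kn kx ky kxε kyε
  by_contra hcon
  rw [not_le] at hcon
  have hν0 : 0 ≤ ν k := (le_max_left _ _).trans kn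
  have hne : e (x k) ≠ e (y k) := by
    intro h
    rw [h, sub_self, norm_zero] at hcon
    linarith [hη k]
  refine hnd (ν k) ((le_max_right _ _).trans kn) (x k) (hx k) (y k) (hy k)
    (by rwa [← mem_ball_iff_norm]) (by rwa [← mem_ball_iff_norm]) hne
    ((regNorm (η k) (e (x k) - e (y k)))⁻¹ • (e (x k) - e (y k)))
    (half_le_norm_inv_regNorm_smul (hη k) hcon.le) (norm_inv_regNorm_smul_le (hη k) _) _ _
    (fun v => ?_) (fun v => ?_) (hbd _ hν0 _ (kSU.hamiltonian_le J hU (hx k) (by positivity)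
      (by positivity) (hUM _ (hx k)) kU)) (hbd _ hν0 _ (kSV.hamiltonian_le J hV (hy k)
      (by positivity) (by positivity) (hVM _ (hy k)) kV))
  · exact (abs_inner_gradient_pen_sub_le hD hδ hν0 (hη k) he.c11 (hx k) kx v).trans
      (mul_le_mul_of_nonneg_right ks (norm_nonneg v))
  · have h1 := (abs_inner_gradient_pen_sub_le (δ := δ) (y := x k) hD hδ hν0 (hη k) he.c11 (hy k) ky
      v)
    rw [norm_sub_rev (y k)] at h1
    refine le_trans (le_of_eq ?_) (h1.trans (mul_le_mul_of_nonneg_right ks (norm_nonneg v)))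
    rw [← neg_sub (e (x k)) (e (y k)), regNorm_neg, smul_neg, inner_neg_left]
    congr 1
    ring

/-- The conclusion of the doubling of variables. -/
theorem doubling_le [NeZero N] (J : JumpKernel Ω μ j σ Cj) (hΩ : IsOpen Ω) (hO : AssumptionO Ω)
    (hU : IsSubsolution Ω μ j Cj G₁ U) (hV : IsSubsolution Ω μ j Cj G₂ V) {M : ℝ} (hM : 0 ≤ M)
    (hUM : ∀ x ∈ closure Ω, |U x| ≤ M) (hVM : ∀ x ∈ closure Ω, |V x| ≤ M)
    (hD : IsDefiningAt Ω j x₀ D r C) (he : IsCoupling Ω j D x₀ r C' e) (hC' : 0 ≤ C')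
    (hx₀ : x₀ ∈ closure Ω) (hδ : 0 < δ) (hδ1 : δ ≤ 1)
    (hmax : ∀ y ∈ closure Ω, U y + V y - 2 * δ * regNorm 1 y ≤
      U x₀ + V x₀ - 2 * δ * regNorm 1 x₀)
    {θ : ℝ} (hθ : σ < θ) (hθ1 : θ < 1) (hnd : NondegenerateAt Ω e G₁ G₂ x₀ θ)
    {h : ℕ → ℝ} (hh : ∀ n, 0 < h n) (hop : AlmostOppositeAt Ω e G₁ G₂ x₀ h (37 * δ) η) :
    U x₀ + V x₀ ≤ J.C * (∫ z : RN N, min (4 * M) ((20 * Cj + 1) * δ * (‖z‖ + ‖z‖ ^ 2)) *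
      kern σ z) + η := by
  have hn1 : ∀ n : ℕ, 0 < (n : ℝ) + 1 := fun n => by positivity
  have hUadm := adm_of_usc hU.1 hU.2.1
  have hVadm := adm_of_usc hV.1 hV.2.1
  have hσ := J.σ_pos
  have hσ1 := J.σ_lt_one
  have hCj := J.Cj_pos
  -- the scales
  have hs : ∀ n : ℕ, ∃ s > 0, ballMoment N σ s ≤ 1 / ((n : ℝ) + 1) ^ 2 := fun n => by
    have hp : 0 < 1 / ((n : ℝ) + 1) ^ 2 := by positivity
    obtain ⟨s, h1, h2⟩ := (((tendsto_ballMoment (N := N) hσ hσ1).eventually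
      (gt_mem_nhds hp)).and self_mem_nhdsWithin).exists
    exact ⟨s, h2, h1.le⟩
  choose s hs0 hsb using hs
  -- The regularization scale is chosen after `s n`: it meets the requirement `h n` of the
  -- Hamiltonian, gives `ν η → 0`, and gives `ν η / s → 0` for the mismatch.
  set h' : ℕ → ℝ := fun n => min (h n) (min (1 / ((n : ℝ) + 1) ^ 2) (s n / ((n : ℝ) + 1) ^ 2))
    with hh'
  have h'0 : ∀ n, 0 < h' n := fun n => by
    have := hs0 n; have := hh n; have := hn1 n; simp only [hh']; positivity
  have h'1 : ∀ n : ℕ, ((n : ℝ) + 1) * h' n ≤ 1 / ((n : ℝ) + 1) := fun n => by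
    have h1 : h' n ≤ 1 / ((n : ℝ) + 1) ^ 2 := (min_le_right _ _).trans (min_le_left _ _)
    refine (mul_le_mul_of_nonneg_left h1 (hn1 n).le).trans (le_of_eq ?_)
    have := (hn1 n).ne'
    field_simp
  have h's : ∀ n : ℕ, h' n / s n ≤ 1 / ((n : ℝ) + 1) ^ 2 := fun n => by
    rw [div_le_iff₀ (hs0 n), one_div_mul_eq_div]
    exact (min_le_right _ _).trans (min_le_right _ _)
  obtain ⟨φ, hφ, x, y, hxy, hxl, hyl, ha⟩ :=
    exists_maxPair_seq hU.2.1 hV.2.1 hUM hVM hD he hx₀ hδ hmax h'0 h'1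
  set ν : ℕ → ℝ := fun k => (φ k : ℝ) + 1 with hν
  set η' : ℕ → ℝ := fun k => h' (φ k) with hη'
  have hν1 : ∀ k, 1 ≤ ν k := fun k => by simp [hν]
  have hνt : Tendsto ν atTop atTop :=
    tendsto_atTop_add_const_right _ _ (tendsto_natCast_atTop_atTop.comp hφ.tendsto_atTop)
  have hνinv : Tendsto (fun k => 1 / ν k) atTop (𝓝 0) :=
    hνt.inv_tendsto_atTop.congr fun k => (one_div _).symm
  have hx : ∀ k, x k ∈ closure Ω := fun k => (hxy k).left_mem
  have hy : ∀ k, y k ∈ closure Ω := fun k => (hxy k).right_mem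
  have ha' : Tendsto (fun k => ν k * ‖y k - x k‖) atTop (𝓝 0) :=
    ha.congr fun k => by rw [norm_sub_rev]
  have hr2 := Metric.ball_mem_nhds x₀ (half_pos hD.r_pos)
  have hr := Metric.ball_mem_nhds x₀ hD.r_pos
  have hev1 : ∀ᶠ k in atTop, ν k * ‖x k - y k‖ ≤ 1 :=
    (ha.eventually (gt_mem_nhds one_pos)).mono fun _ h => h.le
  have hquad : ∀ A B : ℝ, Tendsto (fun k => A * (ν k * ‖x k - y k‖) ^ 2 +
      B * (ν k * ‖x k - y k‖)) atTop (𝓝 0) := fun A B => by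
    simpa using ((ha.pow 2).const_mul A).add (ha.const_mul B)
  have hevN : ∀ᶠ k in atTop, 2 * C * (ν k * ‖x k - y k‖) ^ 2 + C' * (ν k * ‖x k - y k‖) < δ :=
    (hquad _ _).eventually (gt_mem_nhds hδ)
  have hsU : ∀ᶠ k in atTop, SubAt Ω μ j G₁ U (x k)
      (gradient (fun x => sidePen δ (ν k) x₀ D x + linkPen (ν k) (η' k) e x (y k)) (x k)) := by
    filter_upwards [hevN, hxl.eventually hr, hyl.eventually hr] with k h1 h2 h3
    exact (hxy k).subAt J hΩ hU hD he hC' hδ (zero_le_one.trans (hν1 k)) (h'0 _) h2 h3 h1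
  have hsV : ∀ᶠ k in atTop, SubAt Ω μ j G₂ V (y k)
      (gradient (fun y => sidePen δ (ν k) x₀ D y + linkPen (ν k) (η' k) e y (x k)) (y k)) := by
    filter_upwards [hevN, hxl.eventually hr, hyl.eventually hr] with k h1 h2 h3
    rw [norm_sub_rev] at h1
    exact (hxy k).symm.subAt J hΩ hV hD he hC' hδ (zero_le_one.trans (hν1 k)) (h'0 _) h3 h2 h1
  -- the increments
  set c := (14 + 2 * M) * (Cj + 1) with hc
  have hc1 : 1 ≤ c := by nlinarith
  have hweak : ∀ k, ∀ z : RN N, (14 + 2 * M) * Cj * ν k * ‖z‖ ≤ c * ν k * ‖z‖ := fun k z => by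
    have := hν1 k
    have : (14 + 2 * M) * Cj ≤ c := by rw [hc]; nlinarith
    gcongr
  have hincU : ∀ᶠ k in atTop, ∀ z, x k + j (x k) z ∈ closure Ω →
      U (x k + j (x k) z) - U (x k) ≤ min (2 * M) (c * ν k * ‖z‖) := by
    filter_upwards [hev1] with k h1 z hz
    exact ((hxy k).incr_le J hD he hδ.le hδ1 (hν1 k) h1 hM hUM z hz).trans
      (min_le_min_left _ (hweak k z))
  have hincV : ∀ᶠ k in atTop, ∀ z, y k + j (y k) z ∈ closure Ω →
      V (y k + j (y k) z) - V (y k) ≤ min (2 * M) (c * ν k * ‖z‖) := by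
    filter_upwards [hev1] with k h1 z hz
    rw [norm_sub_rev] at h1
    exact ((hxy k).symm.incr_le J hD he hδ.le hδ1 (hν1 k) h1 hM hVM z hz).trans
      (min_le_min_left _ (hweak k z))
  have hclose : ∀ᶠ k in atTop, ‖e (x k) - e (y k)‖ ≤ η' k :=
    hnd.norm_sub_le J hθ hθ1 hD he hδ.le (by linarith) hM (fun k => h'0 _) hνt hx hy hUadm hVadm
      hUM hVM hxl hyl ha hincU hincV hsU hsV
  -- the Hamiltonians
  have hham : ∀ᶠ k in atTop, -η ≤
      G₁ (x k) (gradient (fun x => sidePen δ (ν k) x₀ D x + linkPen (ν k) (η' k) e x (y k)) (x k)) +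
      G₂ (y k)
        (gradient (fun y => sidePen δ (ν k) x₀ D y + linkPen (ν k) (η' k) e y (x k)) (y k)) := by
    obtain ⟨ε, hε, hop⟩ := hop
    filter_upwards [hφ.tendsto_atTop.eventually hop, hclose, hev1,
      hxl.eventually (Metric.ball_mem_nhds x₀ hε), hyl.eventually (Metric.ball_mem_nhds x₀ hε),
      ha.eventually (gt_mem_nhds hε), hxl.eventually hr, hyl.eventually hr,
      (hquad 0 C').eventually (gt_mem_nhds hδ)] with k k1 k2 k3 k4 k5 k6 k7 k8 k9
    refine k1 (x k) (hx k) (y k) (hy k) (by rwa [← mem_ball_iff_norm])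
      (by rwa [← mem_ball_iff_norm]) k6.le (k2.trans (min_le_left _ _)) _ _
      (norm_gradient_pen_le hD hδ.le hδ1 (hν1 k) (h'0 _) he.c11 (hx k) k7 k3)
      (norm_gradient_pen_le hD hδ.le hδ1 (hν1 k) (h'0 _) he.c11 (hy k) k8
        (by rwa [norm_sub_rev])) ?_
    refine (norm_gradient_add_gradient_le hD hC' hδ.le (zero_le_one.trans (hν1 k)) (h'0 _) he.c11
      (hx k) k7 (hy k) k8).trans ?_
    linarith
  -- the nonlocal terms
  obtain ⟨Cθ, hCθ, hI⟩ := integral_min_lin_kern_le (N := N) hσ hθ hθ1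
    (B := 2 * M) (by positivity)
  have hmis := J.tendsto_mismatch hΩ hO hx hy hx₀ hxl hyl hD (L := fun k => c * ν k) (η := η')
    (s := fun k => s (φ k)) (fun k => by nlinarith [hν1 k]) (fun k => (h'0 _).le)
    (fun k => hs0 _) (hclose.mono fun k hk => (he.control _ (hx k) _ (hy k)).trans hk)
    (by simpa [mul_assoc] using ha.const_mul c)
    (by
      have h1 := hνinv.const_mul c
      rw [mul_zero] at h1
      refine squeeze_zero (fun k => mul_nonneg (mul_nonneg (by linarith)
        (zero_le_one.trans (hν1 k))) (ballMoment_nonneg _)) (fun k => ?_) h1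
      have h2 := mul_le_mul_of_nonneg_left (hsb (φ k))
        (mul_nonneg (show 0 ≤ c by linarith) (zero_le_one.trans (hν1 k)))
      refine h2.trans (le_of_eq ?_)
      have := (hn1 (φ k)).ne'
      simp only [hν]
      field_simp)
    (by
      have h1 := hνinv.const_mul c
      rw [mul_zero] at h1
      refine squeeze_zero (fun k => mul_nonneg (mul_nonneg (by linarith)
        (zero_le_one.trans (hν1 k))) (div_nonneg (h'0 _).le (hs0 _).le)) (fun k => ?_) h1
      have h2 := mul_le_mul_of_nonneg_left (h's (φ k))
        (mul_nonneg (show 0 ≤ c by linarith) (zero_le_one.trans (hν1 k)))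
      refine h2.trans (le_of_eq ?_)
      have := (hn1 (φ k)).ne'
      simp only [hν]
      field_simp)
    (B := 2 * M) (by positivity)
  have hdist : Tendsto (fun k => ‖x k - y k‖) atTop (𝓝 0) := by
    have := (hxl.sub hyl).norm
    simpa using this
  have hlin : Tendsto (fun k => J.D * ‖x k - y k‖ *
      (∫ z : RN N, min (2 * M) (c * ν k * ‖z‖) * kern σ z)) atTop (𝓝 0) := by
    have h1 : Tendsto (fun k => J.D * Cθ * (2 * ‖x k - y k‖ + c * (ν k * ‖x k - y k‖)))
        atTop (𝓝 0) := by
      simpa using ((hdist.const_mul 2).add (ha.const_mul c)).const_mul (J.D * Cθ)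
    refine squeeze_zero (fun k => mul_nonneg (mul_nonneg J.D_pos.le (norm_nonneg _))
      (integral_nonneg fun z => mul_nonneg (le_min (by positivity) (mul_nonneg (mul_nonneg
        (by linarith) (zero_le_one.trans (hν1 k))) (norm_nonneg _))) (kern_nonneg z)))
      (fun k => ?_) h1
    have hL0 : 0 ≤ c * ν k := mul_nonneg (by linarith) (zero_le_one.trans (hν1 k))
    have h2 := (hI (c * ν k) hL0).trans (mul_le_mul_of_nonneg_left
      (add_le_add_right (rpow_le_one_add hL0 hθ1.le (hσ.trans hθ).le) 1) hCθ)
    have h3 := mul_le_mul_of_nonneg_left h2 (mul_nonneg J.D_pos.le (norm_nonneg (x k - y k)))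
    refine h3.trans (le_of_eq ?_)
    ring
  -- conclusion
  refine le_of_forall_pos_le_add fun ε hε => ?_
  set I₀ := ∫ z : RN N, min (4 * M) ((20 * Cj + 1) * δ * (‖z‖ + ‖z‖ ^ 2)) * kern σ z with hI₀
  have hrest : Tendsto (fun k => 16 * δ / ν k + ν k * η' k +
      2 * δ * regNorm 1 x₀ - δ * regNorm 1 (x k) - δ * regNorm 1 (y k)) atTop (𝓝 0) := by
    have q0 := hνinv.const_mul (16 * δ)
    have q1 : Tendsto (fun k => ν k * η' k) atTop (𝓝 0) :=
      squeeze_zero (fun k => mul_nonneg (zero_le_one.trans (hν1 k)) (h'0 _).le)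
        (fun k => h'1 (φ k)) hνinv
    have hregc : Continuous (regNorm 1 : RN N → ℝ) := continuous_regNorm 1
    have q2 := ((hregc.tendsto x₀).comp hxl).const_mul δ
    have q3 := ((hregc.tendsto x₀).comp hyl).const_mul δ
    have q4 := (((q0.add q1).add_const (2 * δ * regNorm 1 x₀)).sub q2).sub q3
    rw [show 16 * δ * 0 + 0 + 2 * δ * regNorm 1 x₀ - δ * regNorm 1 x₀ - δ * regNorm 1 x₀ = 0 by
      ring] at q4
    refine q4.congr fun k => ?_
    simp only [Function.comp_def, mul_one_div]
  have htot := (hrest.add hlin).add (hmis.const_mul J.C)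
  simp only [mul_zero, add_zero] at htot
  obtain ⟨k, k1, k2, k3, k4, k5, k6, k7, k8, k9⟩ := ((htot.eventually (gt_mem_nhds hε)).and
    (hsU.and (hsV.and (hincU.and (hincV.and (hham.and ((hxl.eventually hr2).and
      ((hyl.eventually hr2).and ((hquad (2 * J.jlip + J.jlip ^ 2) C').eventually
        (gt_mem_nhds hδ)))))))))).exists
  have hνk := zero_le_one.trans (hν1 k)
  have hdiag := (hxy k).le_of_diag hD hx₀ hδ.le (zero_lt_one.trans_le (hν1 k)) (h'0 _).le
  have hr1 := le_regNorm 1 (x k - x₀)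
  have hr3 := le_regNorm 1 (y k - x₀)
  have hm1 := mul_nonneg hδ.le (sub_nonneg.2 hr1)
  have hm2 := mul_nonneg hδ.le (sub_nonneg.2 hr3)
  have hadd := k2.add_le k3 (I := J.C * I₀ +
      J.D * ‖x k - y k‖ * (∫ z : RN N, min (2 * M) (c * ν k * ‖z‖) * kern σ z) +
      J.C * (∫ z, (mismatch Ω j (x k) (y k)).indicator (fun z => min (2 * M) (c * ν k * ‖z‖)) z *
        kern σ z)) fun ξ hξ =>
    J.outerPart_add_outerPart_le hUadm hVadm (hx k) (hy k) (by positivity) (by positivity)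
      (mul_nonneg (by linarith) hνk) (by positivity) (fun z hz hz' => by
        refine ((hxy k).pair_incr_le J hD he hC' hδ.le hνk k7 k8 hUM hVM z hz hz').trans
          (min_le_min_left _ (mul_le_mul_of_nonneg_right ?_ (by positivity)))
        linarith) k4 k5 hξ
  have hsq := sq_nonneg (ν k * ‖x k - y k‖)
  simp only [hν, hη'] at *
  linarith

end DoublingTheorem

end CensoredNeumann

end


noncomputable section

namespace CensoredNeumann

open Set Filter Topology MeasureTheory

section Comparison

variable {N : ℕ} {Ω : Set (RN N)} {μ : RN N → Measure (RN N)} {j : RN N → RN N → RN N}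
  {σ Cj : ℝ} {D : RN N → ℝ} {x₀ : RN N} {r C : ℝ} {H : RN N → RN N → ℝ}

lemma IsDefiningAt.isCoupling_id (J : JumpKernel Ω μ j σ Cj) (hD : IsDefiningAt Ω j x₀ D r C) :
    IsCoupling Ω j D x₀ r (C + J.jlip) (fun x => x) where
  c11 := by
    have hC := hD.C_nonneg
    have hj := J.jlip_pos
    refine ⟨fun x _ => differentiableAt_id, fun x _ y _ => ?_, fun x _ => ?_⟩
    · rw [fderiv_fun_id, fderiv_fun_id, sub_self, norm_zero]
      positivity
    · rw [fderiv_fun_id]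
      exact ContinuousLinearMap.norm_id_le.trans one_le_two
  lip_closure := fun x _ y _ => le_rfl
  double := fun x hx y hy _ _ z _ _ => by
    rw [add_sub_cancel_left, add_sub_cancel_left]
    refine (J.j_lip x hx y hy z).trans ?_
    have := mul_nonneg hD.C_nonneg (mul_nonneg (norm_nonneg (x - y)) (norm_nonneg z))
    linarith
  neumann := fun x hxb hx y hyb hy => by
    have h1 := hD.le_fderiv_of_frontier hxb hx hyb hy
    rw [fderiv_fun_id, ContinuousLinearMap.id_apply, hD.normal x hxb hx, inner_neg_right,
      real_inner_comm, inner_gradient, ← map_neg, neg_sub]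
    have := mul_nonneg J.jlip_pos.le (mul_nonneg (norm_nonneg (x - y)) (norm_nonneg (x - y)))
    linarith
  control := hD.lip_closure

lemma IsDefiningAt.isCoupling_self (J : JumpKernel Ω μ j σ Cj) (hD : IsDefiningAt Ω j x₀ D r C) :
    IsCoupling Ω j D x₀ r (C + C * Cj + 2 * J.jlip + 4 * Cj / r) D where
  c11 := by
    have hC := hD.C_nonneg
    have hj := J.jlip_pos
    have hCj := J.Cj_pos
    have hr := hD.r_pos
    refine ⟨hD.diff, fun x hx y hy => (hD.lip x hx y hy).trans ?_, hD.norm_le⟩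
    refine mul_le_mul_of_nonneg_right ?_ (norm_nonneg _)
    have : 0 ≤ C * Cj + 2 * J.jlip + 4 * Cj / r := by positivity
    linarith
  lip_closure := hD.lip_closure
  double := fun x hx y hy hxb hyb z hz hz' => by
    have hC := hD.C_nonneg
    have hj := J.jlip_pos
    have hCj := J.Cj_pos
    have hr := hD.r_pos
    have hw := J.le_up x hx z
    have hw' := J.le_up y hy z
    have hww := J.j_lip x hx y hy z
    have hp : 0 ≤ ‖x - y‖ * ‖z‖ := by positivity
    rcases lt_or_ge (Cj * ‖z‖) (r / 2) with h | h
    · have h1 := hD.isC11Near.norm_double_incr_le hxb hyb (hw.trans_lt h) (hw'.trans_lt h)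
      have h2 : C * ‖j x z‖ * ‖x - y‖ ≤ C * (Cj * ‖z‖) * ‖x - y‖ := by gcongr
      have h3 : 0 ≤ (C + 4 * Cj / r) * (‖x - y‖ * ‖z‖) := by positivity
      linarith
    · have h1 := hD.lip_closure _ hz _ hz'
      have h2 := hD.lip_closure x hx y hy
      have h3 := norm_add_le (x - y) (j x z - j y z)
      rw [← add_sub_add_comm] at h3
      have h4 : |(D (x + j x z) - D x) - (D (y + j y z) - D y)| ≤
          |D (x + j x z) - D (y + j y z)| + |D x - D y| := by
        rw [show (D (x + j x z) - D x) - (D (y + j y z) - D y) =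
          (D (x + j x z) - D (y + j y z)) - (D x - D y) by ring]
        exact abs_sub _ _
      have h5 : 2 * ‖x - y‖ ≤ 4 * Cj / r * (‖x - y‖ * ‖z‖) := by
        rw [div_mul_eq_mul_div, le_div_iff₀ hr]
        have := mul_le_mul_of_nonneg_left h (norm_nonneg (x - y))
        linarith
      have h6 : 0 ≤ (C + C * Cj + J.jlip) * (‖x - y‖ * ‖z‖) := by positivity
      rw [Real.norm_eq_abs]
      linarith
  neumann := fun x hxb hx y hyb hy => by
    have hC := hD.C_nonneg
    have hj := J.jlip_pos
    have hCj := J.Cj_pos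
    have hr := hD.r_pos
    have h1 : 0 ≤ inner ℝ (D x - D y) (fderiv ℝ D x (outerNormal Ω x)) := by
      have h2 := hD.nonneg y hy
      rw [hD.normal x hxb hx, hD.zero x hxb hx, map_neg, ← inner_gradient,
        real_inner_self_eq_norm_sq]
      simp only [RCLike.inner_apply, conj_trivial]
      nlinarith [sq_nonneg ‖gradient D x‖]
    refine le_trans ?_ h1
    have : 0 ≤ (C + C * Cj + 2 * J.jlip + 4 * Cj / r) * ‖D x - D y‖ * ‖x - y‖ := by positivity
    linarith
  control := fun x _ y _ => le_rfl

/-- Multiples of subsolutions. -/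
lemma IsSubsolution.const_mul [NeZero N] (J : JumpKernel Ω μ j σ Cj) {u : RN N → ℝ}
    (hu : IsSubsolution Ω μ j Cj H u) {t : ℝ} (ht : 0 < t) :
    IsSubsolution Ω μ j Cj (fun x p => t * H x (t⁻¹ • p)) (fun x => t * u x) := by
  obtain ⟨K, hK⟩ := hu.1
  refine isSubsolution_of_jets J ⟨t * K, fun x hx => ?_⟩ ?_ fun x hx φ hφ hmax => ?_
  · rw [abs_mul, abs_of_pos ht]
    exact mul_le_mul_of_nonneg_left (hK x hx) ht.le
  · intro x hx c hc
    have h1 : u x < t⁻¹ * c := by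
      rw [lt_inv_mul_iff₀ ht]; exact hc
    filter_upwards [hu.2.1 x hx _ h1] with y hy
    rwa [lt_inv_mul_iff₀ ht] at hy
  · have hg : gradient (fun y => t⁻¹ * φ y) x = t⁻¹ • gradient φ x := by
      unfold gradient
      rw [fderiv_const_mul (hφ.differentiable one_ne_zero x), map_smul]
    have hjet := hu.jet J hx (φ := fun y => t⁻¹ * φ y) (contDiffAt_const.mul hφ.contDiffAt)
      (hmax.mono fun y hy => by
        have := mul_le_mul_of_nonneg_left hy (inv_pos.2 ht).le
        rw [mul_sub, mul_sub, inv_mul_cancel_left₀ ht.ne', inv_mul_cancel_left₀ ht.ne'] at this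
        exact this)
    have hsub : SubAt Ω μ j H u x (gradient (fun y => t⁻¹ * φ y) x) →
        SubAt Ω μ j (fun x p => t * H x (t⁻¹ • p)) (fun x => t * u x) x (gradient φ x) := by
      intro h η hη
      rw [hg] at h
      filter_upwards [h (η / t) (by positivity)] with ξ hξ
      rw [outerPart_const_mul]
      rw [le_div_iff₀ ht] at hξ
      linarith
    refine ⟨fun h => hsub (hjet.1 h), fun h => (hjet.2 h).imp (fun h1 => ?_) hsub⟩
    unfold normalDeriv at h1 ⊢
    rw [hg, real_inner_smul_left] at h1
    exact nonpos_of_mul_nonpos_right h1 (inv_pos.2 ht)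

/-- What the comparison principle requires of the Hamiltonian. -/
def ComparisonStructure (Ω : Set (RN N)) (j : RN N → RN N → RN N) (σ : ℝ)
    (H : RN N → RN N → ℝ) : Prop :=
  ∀ η > 0, ∃ t : ℝ, 0 < t ∧ t ≤ 1 ∧ 1 - t ≤ η ∧ ∃ d > 0, ∀ x₀ ∈ closure Ω,
    ∀ (D : RN N → ℝ) (r C : ℝ), IsDefiningAt Ω j x₀ D r C → (x₀ ∈ Ω → D = fun _ => 1) →
    ∃ (F : Type) (_ : NormedAddCommGroup F) (_ : InnerProductSpace ℝ F) (e : RN N → F) (C' θ : ℝ)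
      (h : ℕ → ℝ), 0 ≤ C' ∧ IsCoupling Ω j D x₀ r C' e ∧ σ < θ ∧ θ < 1 ∧ (∀ n, 0 < h n) ∧
      NondegenerateAt Ω e (fun x p => t * H x (t⁻¹ • p)) (dualH H) x₀ θ ∧
      AlmostOppositeAt Ω e (fun x p => t * H x (t⁻¹ • p)) (dualH H) x₀ h d η

lemma AlmostOppositeAt.mono {F : Type*} [NormedAddCommGroup F] [InnerProductSpace ℝ F]
    {e : RN N → F} {G₁ G₂ : RN N → RN N → ℝ} {h : ℕ → ℝ} {d d' η : ℝ} (hd : d' ≤ d)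
    (hop : AlmostOppositeAt Ω e G₁ G₂ x₀ h d η) : AlmostOppositeAt Ω e G₁ G₂ x₀ h d' η := by
  obtain ⟨ε, hε, hev⟩ := hop
  exact ⟨ε, hε, hev.mono fun n hn x hx y hy h1 h2 h3 h4 p q h5 h6 h7 =>
    hn x hx y hy h1 h2 h3 h4 p q h5 h6 (h7.trans hd)⟩

/-- The comparison principle. -/
theorem comparison [NeZero N] (J : JumpKernel Ω μ j σ Cj) (hΩ : IsOpen Ω) (hO : AssumptionO Ω)
    (hH : ComparisonStructure Ω j σ H) {u v : RN N → ℝ} (hu : IsSubsolution Ω μ j Cj H u)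
    (hv : IsSupersolution Ω μ j Cj H v) {x : RN N} (hx : x ∈ closure Ω) : u x ≤ v x := by
  by_contra hcon
  rw [not_le] at hcon
  set m := u x - v x with hm
  have hm0 : 0 < m := sub_pos.2 hcon
  obtain ⟨K₁, hK₁⟩ := hu.1
  obtain ⟨K₂, hK₂⟩ := hv.1
  set M := max K₁ K₂ with hM
  have huM : ∀ y ∈ closure Ω, |u y| ≤ M := fun y hy => (hK₁ y hy).trans (le_max_left _ _)
  have hvM : ∀ y ∈ closure Ω, |v y| ≤ M := fun y hy => (hK₂ y hy).trans (le_max_right _ _)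
  have hM0 : 0 ≤ M := (abs_nonneg _).trans (huM x hx)
  obtain ⟨η, hη, hη1, hη2⟩ : ∃ η > 0, η ≤ m / 8 ∧ η * M ≤ m / 8 := by
    refine ⟨m / (8 * (M + 1)), by positivity, ?_, ?_⟩
    · exact div_le_div_of_nonneg_left hm0.le (by norm_num) (by linarith)
    · rw [div_mul_eq_mul_div, div_le_div_iff₀ (by positivity) (by norm_num)]
      nlinarith
  obtain ⟨t, ht0, ht1, ht, d, hd, hst⟩ := hH η hη
  have hCj := J.Cj_pos
  -- the choice of `δ`
  have hev : ∀ c : ℝ, ∀ b > 0, ∀ᶠ δ in 𝓝[>] (0 : ℝ), c * δ < b := fun c b hb => by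
    have hc : Continuous fun δ : ℝ => c * δ := by fun_prop
    exact nhdsWithin_le_nhds (hc.continuousAt.eventually_lt_const (by simpa using hb))
  have hint : ∀ᶠ δ in 𝓝[>] (0 : ℝ), J.C * (∫ z : RN N,
      min (4 * M) ((20 * Cj + 1) * δ * (‖z‖ + ‖z‖ ^ 2)) * kern σ z) < m / 8 := by
    have h1 : Tendsto (fun δ : ℝ => (20 * Cj + 1) * δ) (𝓝[>] 0) (𝓝[≥] 0) := by
      refine tendsto_nhdsWithin_iff.2 ⟨?_, ?_⟩
      · have hc : Continuous fun δ : ℝ => (20 * Cj + 1) * δ := by fun_prop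
        simpa using (hc.tendsto 0).mono_left nhdsWithin_le_nhds
      · filter_upwards [self_mem_nhdsWithin] with δ hδ
        have hδ : 0 < δ := hδ
        show 0 ≤ (20 * Cj + 1) * δ
        positivity
    have h2 := ((tendsto_integral_min_quad_kern (N := N) J.σ_pos J.σ_lt_one
      (B := 4 * M) (by positivity)).comp h1).const_mul J.C
    rw [mul_zero] at h2
    exact h2.eventually (gt_mem_nhds (show 0 < m / 8 by linarith))
  obtain ⟨δ, h1, h2, h3, h4, hδ⟩ := ((hev 1 1 one_pos).and ((hev 37 d hd).and
    ((hev (2 * regNorm 1 x) (m / 8) (by linarith)).and (hint.and self_mem_nhdsWithin)))).exists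
  have hδ : 0 < δ := hδ
  set U : RN N → ℝ := fun y => t * u y with hU
  set V : RN N → ℝ := fun y => -v y with hV
  have hUs : IsSubsolution Ω μ j Cj (fun x p => t * H x (t⁻¹ • p)) U := hu.const_mul J ht0
  have hVs : IsSubsolution Ω μ j Cj (dualH H) V := hv.dual
  have hUM : ∀ y ∈ closure Ω, |U y| ≤ M := fun y hy => by
    simp only [hU]
    rw [abs_mul, abs_of_pos ht0]
    exact (mul_le_of_le_one_left (abs_nonneg _) ht1).trans (huM y hy)
  have hVM : ∀ y ∈ closure Ω, |V y| ≤ M := fun y hy => by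
    simp only [hV]; rw [abs_neg]; exact hvM y hy
  obtain ⟨x₀, hx₀, hmax⟩ := exists_max_confined (δ := 2 * δ) (hUs.2.1.add hVs.2.1)
    (M := 2 * M) (fun y hy => (abs_add_le _ _).trans (by linarith [hUM y hy, hVM y hy])) ⟨x, hx⟩
    (by positivity)
  obtain ⟨D, r, C, hD, hDin⟩ := exists_isDefiningAt J hΩ hO hx₀
  obtain ⟨F, _, _, e, C', θ, h, hC', he, hθ, hθ1, hh, hnd, hop⟩ := hst x₀ hx₀ D r C hD hDin
  have hdbl := doubling_le J hΩ hO hUs hVs hM0 hUM hVM hD he hC' hx₀ hδ (by linarith) hmax hθ hθ1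
    hnd hh (hop.mono h2.le)
  have hxm := hmax x hx
  have hr0 : 0 ≤ 2 * δ * regNorm 1 x₀ := by
    have := regNorm_pos one_pos x₀
    positivity
  have hux : u x - m / 8 ≤ U x := by
    have q1 := (abs_le.1 (huM x hx)).2
    have q2 : (1 - t) * u x ≤ η * M :=
      (mul_le_mul_of_nonneg_left q1 (by linarith)).trans (mul_le_mul_of_nonneg_right ht hM0)
    simp only [hU]
    linarith
  have hvx : V x = -v x := rfl
  linarith

end Comparison

end CensoredNeumann

end


noncomputable section

namespace CensoredNeumann

open Set Filter Topology MeasureTheory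

section Hamiltonians

variable {N : ℕ} {Ω : Set (RN N)} {μ : RN N → Measure (RN N)} {j : RN N → RN N → RN N}
  {σ Cj : ℝ} {H : RN N → RN N → ℝ}

/-- The larger power dominates. -/
lemma exists_forall_rpow_lt {θ m A : ℝ} (hθ : 0 < θ) (hm : θ < m) (hA : 0 < A) (K B : ℝ) :
    ∃ n₀ : ℝ, ∀ ν ≥ n₀, 0 < ν ∧ K * (1 + ν ^ θ) < A * ν ^ m - B := by
  have h1 := (tendsto_rpow_atTop (sub_pos.2 hm)).eventually_ge_atTop ((K + 1) / A)
  have h2 := (tendsto_rpow_atTop hθ).eventually_gt_atTop (K + B)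
  obtain ⟨n₀, hn⟩ := eventually_atTop.1 ((h1.and h2).and (eventually_gt_atTop (0 : ℝ)))
  refine ⟨n₀, fun ν hν => ?_⟩
  obtain ⟨⟨h1, h2⟩, h3⟩ := hn ν hν
  refine ⟨h3, ?_⟩
  rw [div_le_iff₀ hA] at h1
  have h4 : ν ^ m = ν ^ θ * ν ^ (m - θ) := by rw [← Real.rpow_add h3]; congr 1; ring
  have h5 : 0 < ν ^ θ := Real.rpow_pos_of_pos h3 θ
  have h6 := mul_le_mul_of_nonneg_left h1 h5.le
  rw [h4]
  linarith

/-- Stability of the Hamiltonian with respect to small perturbations of the gradient. -/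
def GradientStable (Ω : Set (RN N)) (H : RN N → RN N → ℝ) : Prop :=
  ∀ η > 0, ∃ t : ℝ, 0 < t ∧ t ≤ 1 ∧ 1 - t ≤ η ∧ ∃ d > 0, ∀ x ∈ closure Ω, ∀ p q : RN N,
    ‖q - p‖ ≤ d → H x q ≤ t * H x (t⁻¹ • p) + η

lemma AssumptionHa.gradientStable (h : AssumptionHa Ω H) : GradientStable Ω H := by
  obtain ⟨C, ω, hC, hω, h⟩ := h
  intro η hη
  refine ⟨1, one_pos, le_rfl, by linarith, η / C, by positivity, fun x hx p q hpq => ?_⟩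
  have h1 := h x hx x hx q p
  rw [sub_self, norm_zero, hω.1, zero_mul, zero_add] at h1
  have h2 := mul_le_mul_of_nonneg_left hpq hC.le
  rw [mul_div_cancel₀ _ hC.ne'] at h2
  rw [inv_one, one_smul, one_mul]
  linarith

lemma gradientStable_of_superlinear {m : ℝ} (hb : AssumptionHb Ω H m) (hc : AssumptionHc Ω H m) :
    GradientStable Ω H := by
  obtain ⟨hm, A, C', hA, hC', hb⟩ := hb
  obtain ⟨C, ω, hC, hω, hc⟩ := hc
  intro η hη
  obtain ⟨s, hs, hs1, hsη, hsA⟩ : ∃ s > 0, s < 1 ∧ s ≤ η ∧ s * A ≤ η / 2 := by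
    refine ⟨min (1 / 2) (min η (η / (2 * A))), by positivity,
      (min_le_left _ _).trans_lt (by norm_num), (min_le_right _ _).trans (min_le_left _ _), ?_⟩
    have h1 : min (1 / 2) (min η (η / (2 * A))) ≤ η / (2 * A) :=
      (min_le_right _ _).trans (min_le_right _ _)
    refine (mul_le_mul_of_nonneg_right h1 hA.le).trans (le_of_eq ?_)
    field_simp
  have h2m : (0 : ℝ) < 2 ^ m := Real.rpow_pos_of_pos two_pos m
  have hm1 : 0 < m - 1 := sub_pos.2 hm
  obtain ⟨d, hd, hd1, hdη, hds⟩ : ∃ d > 0, d ≤ 1 ∧ C * d * 2 ^ m ≤ η / 2 ∧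
      C * d * 2 ^ m ≤ s * (C' * (m - 1)) := by
    set b := min (η / 2) (s * (C' * (m - 1))) with hbdef
    have hb0 : 0 < b := by positivity
    have h1 : C * min 1 (b / (C * 2 ^ m)) * 2 ^ m ≤ b := by
      have : min 1 (b / (C * 2 ^ m)) ≤ b / (C * 2 ^ m) := min_le_right _ _
      calc C * min 1 (b / (C * 2 ^ m)) * 2 ^ m ≤ C * (b / (C * 2 ^ m)) * 2 ^ m := by gcongr
        _ = b := by field_simp
    exact ⟨min 1 (b / (C * 2 ^ m)), by positivity, min_le_left _ _, h1.trans (min_le_left _ _),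
      h1.trans (min_le_right _ _)⟩
  refine ⟨1 - s, by linarith, by linarith, by linarith, d, hd, fun x hx p q hpq => ?_⟩
  have h1 := hb (1 - s) (by linarith) (by linarith) x hx p
  have h2 := hc x hx x hx q p
  rw [sub_self, norm_zero, hω.1, zero_mul, zero_add] at h2
  have hp0 := norm_nonneg p
  have hmax : max (‖q‖ ^ (m - 1)) (‖p‖ ^ (m - 1)) ≤ 2 ^ m * (‖p‖ ^ m + 1) := by
    have hq : ‖q‖ ≤ ‖p‖ + 1 := by
      have := norm_le_norm_add_norm_sub' q p
      linarith
    have e1 : max (‖q‖ ^ (m - 1)) (‖p‖ ^ (m - 1)) ≤ (‖p‖ + 1) ^ (m - 1) :=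
      max_le (Real.rpow_le_rpow (norm_nonneg _) hq hm1.le)
        (Real.rpow_le_rpow hp0 (by linarith) hm1.le)
    have e2 : (‖p‖ + 1) ^ (m - 1) ≤ (‖p‖ + 1) ^ m :=
      Real.rpow_le_rpow_of_exponent_le (by linarith) (by linarith)
    have e3 : (‖p‖ + 1) ^ m ≤ 2 ^ m * (‖p‖ ^ m + 1) := by
      rcases le_total ‖p‖ 1 with hp1 | hp1
      · have a1 : (‖p‖ + 1) ^ m ≤ 2 ^ m :=
          Real.rpow_le_rpow (by linarith) (by linarith) (by linarith)
        have a2 : 0 ≤ ‖p‖ ^ m := Real.rpow_nonneg hp0 m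
        nlinarith
      · have a1 : (‖p‖ + 1) ^ m ≤ (2 * ‖p‖) ^ m :=
          Real.rpow_le_rpow (by linarith) (by linarith) (by linarith)
        rw [Real.mul_rpow two_pos.le hp0] at a1
        nlinarith
    exact e1.trans (e2.trans e3)
  have h3 : C * ‖q - p‖ * max (‖q‖ ^ (m - 1)) (‖p‖ ^ (m - 1)) ≤
      C * d * (2 ^ m * (‖p‖ ^ m + 1)) := by
    refine mul_le_mul (mul_le_mul_of_nonneg_left hpq hC.le) hmax ?_ (by positivity)
    exact le_max_of_le_left (Real.rpow_nonneg (norm_nonneg _) _)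
  have h4 := mul_le_mul_of_nonneg_right hds (Real.rpow_nonneg hp0 m)
  rw [sub_sub_cancel] at h1
  linarith

/-- Coercive Hamiltonians. -/
lemma comparisonStructure_of_coercive (J : JumpKernel Ω μ j σ Cj)
    (hcont : ContinuousOn (fun q : RN N × RN N => H q.1 q.2) (closure Ω ×ˢ univ)) {m : ℝ}
    (hH1 : AssumptionH1 Ω H σ m) (hst : GradientStable Ω H) : ComparisonStructure Ω j σ H := by
  obtain ⟨hm, c₀, D₀, hc₀, hD₀, hcoer⟩ := hH1
  intro η hη
  obtain ⟨t, ht0, ht1, htη, d, hd, hloc⟩ := hst (η / 2) (half_pos hη)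
  refine ⟨t, ht0, ht1, by linarith, d, hd, fun x₀ hx₀ D r C hD _ => ?_⟩
  have hσ := J.σ_pos
  have hσ1 := J.σ_lt_one
  have hmin : σ < min m 1 := lt_min hm hσ1
  set θ := (σ + min m 1) / 2 with hθdef
  have hθ : σ < θ := by linarith
  have hθm : θ < min m 1 := by linarith
  have hm0 : 0 < m := hσ.trans hm
  -- the scale at which the Hamiltonian is nearly constant in space
  have hcpt : ∀ R : ℝ, IsCompact ((closure Ω ∩ Metric.closedBall x₀ 1) ×ˢ
      Metric.closedBall (0 : RN N) R) := fun R =>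
    ((isCompact_closedBall x₀ 1).inter_left isClosed_closure).prod (isCompact_closedBall 0 R)
  have huc : ∀ n : ℕ, ∃ s > 0, ∀ x ∈ closure Ω, ∀ y ∈ closure Ω, ‖x - x₀‖ ≤ 1 → ‖y - x₀‖ ≤ 1 →
      ‖x - y‖ ≤ s → ∀ q : RN N, ‖q‖ ≤ 22 * ((n : ℝ) + 1) → H y q ≤ H x q + η / 2 := by
    intro n
    have h1 := (hcpt (22 * ((n : ℝ) + 1))).uniformContinuousOn_of_continuous
      (hcont.mono (prod_mono inter_subset_left (subset_univ _)))
    obtain ⟨s, hs, h2⟩ := Metric.uniformContinuousOn_iff.1 h1 (η / 2) (half_pos hη)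
    refine ⟨s / 2, half_pos hs, fun x hx y hy hx1 hy1 hxy q hq => ?_⟩
    have h3 := h2 (y, q) ⟨⟨hy, by rwa [mem_closedBall_iff_norm]⟩, by rwa [mem_closedBall_zero_iff]⟩
      (x, q) ⟨⟨hx, by rwa [mem_closedBall_iff_norm]⟩, by rwa [mem_closedBall_zero_iff]⟩ (by
        rw [Prod.dist_eq, dist_self, max_eq_left dist_nonneg, dist_eq_norm, norm_sub_rev]
        linarith)
    rw [Real.dist_eq] at h3
    linarith [(abs_lt.1 h3).2]
  choose h hh0 hh using huc
  refine ⟨RN N, inferInstance, inferInstance, fun x => x, C + J.jlip, θ, h,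
    add_nonneg hD.C_nonneg J.jlip_pos.le, hD.isCoupling_id J, hθ,
    hθm.trans_le (min_le_right _ _), hh0, ?_, ?_⟩
  · intro K
    obtain ⟨n₀, hn₀⟩ := exists_forall_rpow_lt (hσ.trans hθ) (hθm.trans_le (min_le_left _ _))
      (show 0 < t * (c₀ * (1 / 4) ^ m) by positivity) K (t * D₀)
    refine ⟨1 / 4, by norm_num, n₀, fun ν hν x hx y hy _ _ _ w hw1 hw2 p q hp _ hG _ => ?_⟩
    obtain ⟨hν0, hlt⟩ := hn₀ ν hν
    have h1 := (abs_le.1 (hp w)).1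
    rw [fderiv_fun_id, ContinuousLinearMap.id_apply, real_inner_self_eq_norm_sq] at h1
    have h2 := real_inner_le_norm p w
    have hw0 : 0 < ‖w‖ := by linarith
    have h3 : 1 / 4 * ν ≤ ‖p‖ := by
      have h4 : (ν * ‖w‖ - 1 / 4 * ν) * ‖w‖ ≤ ‖p‖ * ‖w‖ := by linarith
      have h5 := le_of_mul_le_mul_right h4 hw0
      nlinarith
    have h4 : 1 / 4 * ν ≤ ‖t⁻¹ • p‖ := by
      rw [norm_smul, Real.norm_of_nonneg (inv_nonneg.2 ht0.le)]
      have : 1 ≤ t⁻¹ := (one_le_inv₀ ht0).2 ht1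
      nlinarith [norm_nonneg p]
    have h5 := Real.rpow_le_rpow (by positivity) h4 hm0.le
    rw [Real.mul_rpow (by norm_num) hν0.le] at h5
    have h6 := hcoer x hx (t⁻¹ • p)
    have h7 := mul_le_mul_of_nonneg_left h5 hc₀.le
    have h8 : t * (c₀ * ((1 / 4) ^ m * ν ^ m) - D₀) ≤ t * H x (t⁻¹ • p) :=
      mul_le_mul_of_nonneg_left (by linarith) ht0.le
    linarith
  · refine ⟨1, one_pos, Eventually.of_forall fun n x hx y hy hx1 hy1 _ hxy p q _ hq hpq => ?_⟩
    have h1 := hloc x hx p (-q) (by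
      rw [← neg_add', norm_neg, add_comm]; exact hpq)
    have h2 := hh n x hx y hy hx1.le hy1.le hxy (-q) (by rwa [norm_neg])
    simp only [dualH]
    linarith

/-- The sign of the drift at a boundary point. -/
lemma AssumptionB.exists_drift_bound {A : Type*} [TopologicalSpace A] [CompactSpace A] [Nonempty A]
    {b : RN N → A → RN N} (hB : AssumptionB Ω b) {x₀ : RN N} (hx₀ : x₀ ∈ frontier Ω)
    (hb : Continuous (b x₀)) :
    ∃ c > 0, ∀ w : ℝ, 1 / 2 ≤ |w| →
      (∃ α, c ≤ w * inner ℝ (b x₀ α) (outerNormal Ω x₀)) ∨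
      ∀ α, w * inner ℝ (b x₀ α) (outerNormal Ω x₀) ≤ -c := by
  set f : A → ℝ := fun α => inner ℝ (b x₀ α) (outerNormal Ω x₀) with hf
  have hfc : Continuous f := hb.inner continuous_const
  have hmem : x₀ ∈ gammaIn Ω b ∪ gammaOut Ω b ∪ gammaMixed Ω b := by rw [hB.1]; exact hx₀
  rcases hmem with (h | h) | h
  · obtain ⟨α₀, -, hα₀⟩ := isCompact_univ.exists_isMaxOn univ_nonempty hfc.continuousOn
    have hneg : f α₀ < 0 := h.2 α₀
    have hle : ∀ α, f α ≤ f α₀ := fun α => hα₀ (mem_univ α)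
    refine ⟨-f α₀ / 2, by linarith, fun w hw => ?_⟩
    rcases le_or_gt 0 w with hw0 | hw0
    · rw [abs_of_nonneg hw0] at hw
      exact Or.inr fun α => by
        show w * f α ≤ _
        nlinarith [hle α]
    · rw [abs_of_neg hw0] at hw
      refine Or.inl ⟨α₀, ?_⟩
      show _ ≤ w * f α₀
      nlinarith
  · obtain ⟨α₀, -, hα₀⟩ := isCompact_univ.exists_isMinOn univ_nonempty hfc.continuousOn
    have hpos : 0 < f α₀ := h.2 α₀
    have hle : ∀ α, f α₀ ≤ f α := fun α => hα₀ (mem_univ α)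
    refine ⟨f α₀ / 2, by linarith, fun w hw => ?_⟩
    rcases le_or_gt 0 w with hw0 | hw0
    · rw [abs_of_nonneg hw0] at hw
      refine Or.inl ⟨α₀, ?_⟩
      show _ ≤ w * f α₀
      nlinarith
    · rw [abs_of_neg hw0] at hw
      exact Or.inr fun α => by
        show w * f α ≤ _
        nlinarith [hle α]
  · obtain ⟨-, α₁, α₂, h1, h2⟩ := h
    have h1 : f α₁ < 0 := h1
    have h2 : 0 < f α₂ := h2
    refine ⟨min (-f α₁) (f α₂) / 2, by have := neg_pos.2 h1; positivity, fun w hw => Or.inl ?_⟩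
    have m1 := min_le_left (-f α₁) (f α₂)
    have m2 := min_le_right (-f α₁) (f α₂)
    rcases le_or_gt 0 w with hw0 | hw0
    · rw [abs_of_nonneg hw0] at hw
      refine ⟨α₂, ?_⟩
      show _ ≤ w * f α₂
      nlinarith
    · rw [abs_of_neg hw0] at hw
      refine ⟨α₁, ?_⟩
      show _ ≤ w * f α₁
      nlinarith

/-- Bellman Hamiltonians. -/
lemma IsBellman.comparisonStructure (J : JumpKernel Ω μ j σ Cj) (hΩ : IsOpen Ω)
    (hB : IsBellman.{u} Ω H) : ComparisonStructure Ω j σ H := by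
  obtain ⟨A, _, _, _, b, l, hbc, -, ⟨K, hK⟩, hlub, ⟨w, hw, hl⟩, ⟨L, hL, hbL⟩, hB⟩ := hB
  intro η hη
  have hlow : ∀ x ∈ closure Ω, ∀ p α, -inner ℝ (b x α) p - l x α ≤ H x p := fun x hx p α =>
    (hlub x hx p).1 ⟨α, rfl⟩
  have hupp : ∀ x ∈ closure Ω, ∀ p B, (∀ α, -inner ℝ (b x α) p - l x α ≤ B) → H x p ≤ B :=
    fun x hx p B h => (hlub x hx p).2 (by rintro _ ⟨α, rfl⟩; exact h α)
  set K' := max K 0 with hK'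
  have hK0 : 0 ≤ K' := le_max_right _ _
  have hb' : ∀ x ∈ closure Ω, ∀ α, ‖b x α‖ ≤ K' := fun x hx α =>
    (hK x hx α).1.trans (le_max_left _ _)
  have hl' : ∀ x ∈ closure Ω, ∀ α, |l x α| ≤ K' := fun x hx α =>
    (hK x hx α).2.trans (le_max_left _ _)
  refine ⟨1, one_pos, le_rfl, by linarith, η / (4 * (K' + 1)), by positivity,
    fun x₀ hx₀ D r C hD hDin => ?_⟩
  have hσ := J.σ_pos
  have hσ1 := J.σ_lt_one
  have hG : (fun x p => 1 * H x ((1 : ℝ)⁻¹ • p)) = H := by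
    ext x p; rw [inv_one, one_smul, one_mul]
  rw [hG]
  refine ⟨ℝ, inferInstance, inferInstance, D, C + C * Cj + 2 * J.jlip + 4 * Cj / r, (σ + 1) / 2,
    fun _ => 1, ?_, hD.isCoupling_self J, by linarith, by linarith, fun _ => one_pos, ?_, ?_⟩
  · have := hD.C_nonneg; have := J.jlip_pos; have := J.Cj_pos; have := hD.r_pos
    positivity
  · intro K₁
    by_cases hxΩ : x₀ ∈ Ω
    · refine ⟨1, one_pos, 0, fun ν _ x _ y _ _ _ hne => absurd ?_ hne⟩
      rw [hDin hxΩ]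
    have hxf : x₀ ∈ frontier Ω := by rw [hΩ.frontier_eq]; exact ⟨hx₀, hxΩ⟩
    have hbx₀ : Continuous (b x₀) := by
      have h1 : Continuous fun α : A => (x₀, α) := by fun_prop
      exact hbc.comp_continuous h1 fun α => ⟨hx₀, mem_univ _⟩
    obtain ⟨c, hc, hdich⟩ := hB.exists_drift_bound hxf hbx₀
    have hC := hD.C_nonneg
    have hr := hD.r_pos
    have hx₀b := Metric.mem_ball_self (x := x₀) hr
    set C₃ := C * K' + 2 * L + K' with hC₃
    have hC₃0 : 0 ≤ C₃ := by positivity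
    obtain ⟨n₀, hn₀⟩ := exists_forall_rpow_lt (θ := (σ + 1) / 2) (m := 1) (by linarith)
      (by linarith) (half_pos hc) K₁ K'
    obtain ⟨ε, hε, hεr, hε3⟩ : ∃ ε > 0, ε ≤ r ∧ C₃ * ε ≤ c / 2 := by
      refine ⟨min r (c / (2 * (C₃ + 1))), by positivity, min_le_left _ _, ?_⟩
      calc C₃ * min r (c / (2 * (C₃ + 1))) ≤ (C₃ + 1) * (c / (2 * (C₃ + 1))) :=
            mul_le_mul (by linarith) (min_le_right _ _) (by positivity) (by positivity)
        _ = c / 2 := by field_simp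
    refine ⟨ε, hε, n₀, fun ν hν x hx y hy hxε hyε _ ω hω hω1 p q hp hq hGp hGq => ?_⟩
    obtain ⟨hν0, hlt⟩ := hn₀ ν hν
    rw [Real.rpow_one] at hlt
    rw [Real.norm_eq_abs] at hω hω1
    have hderiv : ∀ x ∈ closure Ω, ‖x - x₀‖ < ε → ∀ α,
        |ω * fderiv ℝ D x (b x α) + ω * inner ℝ (b x₀ α) (outerNormal Ω x₀)| ≤
          (C * K' + 2 * L) * ε := by
      intro x hx hxε α
      have hxb : x ∈ Metric.ball x₀ r := by rw [mem_ball_iff_norm]; linarith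
      have e1 : inner ℝ (b x₀ α) (outerNormal Ω x₀) = -fderiv ℝ D x₀ (b x₀ α) := by
        rw [hD.normal x₀ hx₀b hxf, inner_neg_right, real_inner_comm, inner_gradient]
      have e2 : fderiv ℝ D x (b x α) - fderiv ℝ D x₀ (b x₀ α) =
          (fderiv ℝ D x - fderiv ℝ D x₀) (b x α) + fderiv ℝ D x₀ (b x α - b x₀ α) := by
        rw [map_sub, sub_apply]; ring
      have e3 : |(fderiv ℝ D x - fderiv ℝ D x₀) (b x α)| ≤ C * ε * K' :=
        ((fderiv ℝ D x - fderiv ℝ D x₀).le_opNorm _).trans (mul_le_mul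
          ((hD.lip x hxb x₀ hx₀b).trans (mul_le_mul_of_nonneg_left hxε.le hC)) (hb' x hx α)
          (norm_nonneg _) (by positivity))
      have e4 : |fderiv ℝ D x₀ (b x α - b x₀ α)| ≤ 2 * (L * ε) :=
        ((fderiv ℝ D x₀).le_opNorm _).trans (mul_le_mul (hD.norm_le x₀ hx₀b)
          ((hbL α x hx x₀ hx₀).trans (mul_le_mul_of_nonneg_left hxε.le hL.le)) (norm_nonneg _)
          (by norm_num))
      have e5 := abs_add_le ((fderiv ℝ D x - fderiv ℝ D x₀) (b x α))
        (fderiv ℝ D x₀ (b x α - b x₀ α))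
      rw [e1, mul_neg, ← sub_eq_add_neg, ← mul_sub, abs_mul, e2]
      calc _ ≤ 1 * _ := mul_le_mul_of_nonneg_right hω1 (abs_nonneg _)
        _ ≤ _ := by linarith
    have hinner : ∀ s : ℝ, inner ℝ ω s = ω * s := fun s => by
      simp only [RCLike.inner_apply, conj_trivial]; ring
    rcases hdich ω hω with ⟨α, hα⟩ | hα
    · have h1 := hlow x hx p α
      have h2 := (abs_le.1 (hp (b x α))).2
      rw [hinner, real_inner_comm] at h2
      have h3 := (abs_le.1 (hderiv x hx hxε α)).2
      have h4 := (abs_le.1 (hl' x hx α)).2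
      have h5 : ε * ν * ‖b x α‖ ≤ ε * ν * K' :=
        mul_le_mul_of_nonneg_left (hb' x hx α) (by positivity)
      have h6 := mul_le_mul_of_nonneg_left (h3.trans' (add_le_add_right hα _)) hν0.le
      have h7 := mul_le_mul_of_nonneg_left hε3 hν0.le
      linarith
    · have h1 : H y (-q) ≤ -(c / 2 * ν - K') := by
        refine hupp y hy (-q) _ fun α => ?_
        have h2 := (abs_le.1 (hq (b y α))).2
        rw [hinner, real_inner_comm] at h2
        have h3 := (abs_le.1 (hderiv y hy hyε α)).1
        have h4 := (abs_le.1 (hl' y hy α)).1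
        have h5 : ε * ν * ‖b y α‖ ≤ ε * ν * K' :=
          mul_le_mul_of_nonneg_left (hb' y hy α) (by positivity)
        have h6 := mul_le_mul_of_nonneg_left (h3.trans (add_le_add_right (hα α) _)) hν0.le
        have h7 := mul_le_mul_of_nonneg_left hε3 hν0.le
        rw [inner_neg_right, neg_neg]
        linarith
      simp only [dualH] at hGq
      linarith
  · have hwt : ∀ᶠ s in 𝓝[≥] (0 : ℝ), w s < η / 4 := by
      have h1 : Tendsto w (𝓝[≥] 0) (𝓝 (w 0)) := hw.2.2
      rw [hw.1] at h1
      exact h1.eventually (gt_mem_nhds (by linarith))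
    obtain ⟨s, hs, hsw⟩ := (mem_nhdsGE_iff_exists_Icc_subset).1 hwt
    have hs : 0 < s := hs
    obtain ⟨ε, hε, hεs, hεL⟩ : ∃ ε > 0, ε ≤ s ∧ 22 * L * ε ≤ η / 4 := by
      refine ⟨min s (η / (88 * L)), by positivity, min_le_left _ _, ?_⟩
      calc 22 * L * min s (η / (88 * L)) ≤ 22 * L * (η / (88 * L)) :=
            mul_le_mul_of_nonneg_left (min_le_right _ _) (by positivity)
        _ = η / 4 := by field_simp; norm_num
    refine ⟨ε, hε, Eventually.of_forall fun n x hx y hy _ _ hna _ p q hp _ hpq => ?_⟩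
    have hn0 : (0 : ℝ) ≤ n := Nat.cast_nonneg n
    have ha : ‖x - y‖ ≤ ε := by nlinarith [norm_nonneg (x - y)]
    have hwa : w ‖x - y‖ < η / 4 := hsw ⟨norm_nonneg _, ha.trans hεs⟩
    have h1 : H y (-q) ≤ H x p + η := by
      refine hupp y hy (-q) _ fun α => ?_
      have h2 := hlow x hx p α
      have h3 := (abs_le.1 (hl α x hx y hy)).2
      have h4 : inner ℝ (b y α) q + inner ℝ (b x α) p =
          inner ℝ (b y α) (p + q) + inner ℝ (b x α - b y α) p := by
        rw [inner_add_right, inner_sub_left]; ring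
      have h5 : inner ℝ (b y α) (p + q) ≤ η / 4 := by
        refine (real_inner_le_norm _ _).trans ?_
        calc _ ≤ (K' + 1) * (η / (4 * (K' + 1))) :=
              mul_le_mul ((hb' y hy α).trans (by linarith)) hpq (norm_nonneg _) (by positivity)
          _ = η / 4 := by field_simp
      have h6 : inner ℝ (b x α - b y α) p ≤ η / 4 := by
        refine (real_inner_le_norm _ _).trans ?_
        calc _ ≤ (L * ‖x - y‖) * (22 * ((n : ℝ) + 1)) :=
              mul_le_mul (hbL α x hx y hy) hp (norm_nonneg _) (by positivity)
          _ = 22 * L * (((n : ℝ) + 1) * ‖x - y‖) := by ring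
          _ ≤ 22 * L * ε := mul_le_mul_of_nonneg_left hna (by positivity)
          _ ≤ _ := hεL
      rw [inner_neg_right, neg_neg]
      linarith
    simp only [dualH]
    linarith

end Hamiltonians

end CensoredNeumann

end

theorem corollary3p2 {N : ℕ} [NeZero N]
    (Ω : Set (CensoredNeumann.RN N)) (hΩ : IsOpen Ω) (hO : CensoredNeumann.AssumptionO Ω)
    (μ : CensoredNeumann.RN N → MeasureTheory.Measure (CensoredNeumann.RN N)) (σ : ℝ)
    (hM : CensoredNeumann.AssumptionM Ω μ σ)
    (j : CensoredNeumann.RN N → CensoredNeumann.RN N → CensoredNeumann.RN N)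
    (hJ0 : CensoredNeumann.AssumptionJ0 Ω j)
    (Cj' Cj Dj : ℝ) (hJ1 : CensoredNeumann.AssumptionJ1 Ω j Cj' Cj Dj)
    (H : CensoredNeumann.RN N → CensoredNeumann.RN N → ℝ)
    (hHcont : ContinuousOn (fun q : CensoredNeumann.RN N × CensoredNeumann.RN N => H q.1 q.2)
      (closure Ω ×ˢ Set.univ))
    (hH : CensoredNeumann.IsBellman.{u} Ω H ∨ CensoredNeumann.IsSublinearlyCoercive Ω H σ ∨
      CensoredNeumann.IsSuperlinearlyCoercive Ω H σ)
    (hE : CensoredNeumann.AssumptionE Ω H) :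
    ∃ u : CensoredNeumann.RN N → ℝ,
      CensoredNeumann.IsViscositySolution Ω μ j Cj H u ∧
      ContinuousOn u (closure Ω) ∧
      ∀ v : CensoredNeumann.RN N → ℝ,
        CensoredNeumann.IsViscositySolution Ω μ j Cj H v → Set.EqOn v u (closure Ω) := by
  obtain ⟨J⟩ := CensoredNeumann.exists_jumpKernel hM hJ0 hJ1
  have hst : CensoredNeumann.ComparisonStructure Ω j σ H := by
    rcases hH with h | ⟨⟨m, -, h1⟩, ha⟩ | ⟨⟨m, h1⟩, m', hb, hc⟩
    · exact h.comparisonStructure J hΩ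
    · exact CensoredNeumann.comparisonStructure_of_coercive J hHcont h1 ha.gradientStable
    · exact CensoredNeumann.comparisonStructure_of_coercive J hHcont h1
        (CensoredNeumann.gradientStable_of_superlinear hb hc)
  exact CensoredNeumann.exists_unique_of_comparison J hΩ hO hHcont hE
    fun u v hu hv x hx => CensoredNeumann.comparison J hΩ hO hst hu hv hx
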